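/- Let $S$ be a finite set of places of $\mathbb{Q}$ containing $\infty$, let $\mathbb{A}_S=\prod_{v\in S}\mathbb{Q}_v$ with the product of the Haar measures ($\mathbb{Z}_p$ having measure $1$), $\Gamma=\{\pm\prod_{p\in S\setminus\{\infty\}}p^{n_p} : n_p\in\mathbb{Z}\}\subset\mathbb{Q}^*$, $\Gamma_+=\Gamma\cap\mathbb{Q}_{>0}$ and $X_S=\mathbb{A}_S/\Gamma$, with projection $\pi:\mathbb{A}_S\to X_S$. Endow $X_S$ with the measure induced by that of $\mathbb{A}_S$, that is, the image under $\pi$ of its restriction to the fundamental domain $\prod_{p}\mathbb{Z}_p^*\times\mathbb{R}_+^*$ for the action of $\Gamma$ on $\mathbb{A}_S^*$, and let $|x|=\prod_{v\in S}|x_v|_v$ be the module, which passes to $X_S$. Let $L^2(X_S)^{K_S}$ be the space of the functions in $L^2(X_S)$ that are invariant under multiplication by the elements of $K_S=\{a\in\mathbb{A}_S^*/\Gamma : |a|=1\}$. The class of a function $h$ on $\mathbb{A}_S$ is the function on $X_S$ $$[h](\pi(x))=\tfrac12\sum_{\gamma\in\Gamma}h(\gamma x),$$ which is $\sum_{\gamma\in\Gamma_+}h(\gamma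 x)$ if $h(-x)=h(x)$. Let $\alpha=\prod_{p}e_p\cdot e_\infty$, where $e_\infty(x)=e^{2\pi i x}$ and $e_p$ is the composite $\mathbb{Q}_p\to\mathbb{Q}_p/\mathbb{Z}_p\subset\mathbb{Q}/\mathbb{Z}\to U(1)$, the last map being $t\mapsto e^{2\pi i t}$, and let $(\mathcal{F}h)(y)=\int_{\mathbb{A}_S}h(x)\,\alpha(-xy)\,dx$. There is a unique bounded operator $\mathbb{F}_S$ on $L^2(X_S)$ with $\mathbb{F}_S[h]=[\mathcal{F}h]$ for every Schwartz--Bruhat function $h$ on $\mathbb{A}_S$. For $\lambda>0$ let $\mathbf{S}_\lambda(\mathbb{R},e_\infty)$ be the space of the even functions $f\in L^2(\mathbb{R})$ such that $f$ and its Fourier transform $\hat f(y)=\int f(x)e^{-2\pi i xy}dx$ (extended to $L^2(\mathbb{R})$) vanish almost everywhere on $|x|<\lambda$, and let $\mathbf{S}_\lambda(X_S,\alpha)$ be the space of the $f\in L^2(X_S)^{K_S}$ such that $f$ and $\mathbb{F}_S f$ vanish almost everywhere on $|x|<\lambda$. Let $\sigma_S=\bigotimes_{p\in S\setminus\{\infty\}}\sigma_p$,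 where $\sigma_p$ is the function on $\mathbb{Q}_p$ equal to $1$ if $|x|=1$, to $-1/p$ if $|x|=p$, and to $0$ otherwise. Then, for every $\lambda>0$, the map $\theta_S:f\mapsto[\sigma_S\otimes f]$ is a hilbertian isomorphism, that is, a bounded linear bijection with bounded inverse, from $\mathbf{S}_\lambda(\mathbb{R},e_\infty)$ onto $\mathbf{S}_\lambda(X_S,\alpha)$. -/

import Mathlib

open MeasureTheory
open scoped FourierTransform

noncomputable section

namespace SemilocalSonin

/-! ### The local fields `ℚ_p` -/

instance factPrime (p : Nat.Primes) : Fact (p : ℕ).Prime := ⟨p.2⟩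

instance padicMeasurableSpace (p : ℕ) [Fact p.Prime] : MeasurableSpace ℚ_[p] := borel _

instance padicBorelSpace (p : ℕ) [Fact p.Prime] : BorelSpace ℚ_[p] := ⟨rfl⟩

/-- The compact open subring `ℤ_p` of `ℚ_p`. -/
def padicUnitBall (p : ℕ) [Fact p.Prime] : TopologicalSpace.PositiveCompacts ℚ_[p] where
  carrier := Metric.closedBall 0 1
  isCompact' := isCompact_closedBall 0 1
  interior_nonempty' :=
    ⟨0, Metric.ball_subset_interior_closedBall (Metric.mem_ball_self one_pos)⟩

/-- The additive Haar measure of `ℚ_p` for which `ℤ_p` has measure `1`. -/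
def padicHaar (p : ℕ) [Fact p.Prime] : Measure ℚ_[p] :=
  Measure.addHaarMeasure (padicUnitBall p)

theorem exists_fracPart (p : ℕ) [Fact p.Prime] (x : ℚ_[p]) :
    ∃ r : ℚ, (∃ (k : ℤ) (n : ℕ), r = k / (p : ℚ) ^ n) ∧ ‖x - (r : ℚ_[p])‖ ≤ 1 := by
  have hp : (1 : ℝ) < p := by exact_mod_cast (Fact.out : p.Prime).one_lt
  have hp0 : (p : ℚ_[p]) ≠ 0 := by exact_mod_cast (Fact.out : p.Prime).ne_zero
  obtain ⟨n, hn⟩ := pow_unbounded_of_one_lt ‖x‖ hp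
  have hx : ‖(p : ℚ_[p]) ^ n * x‖ ≤ 1 := by
    rw [norm_mul, norm_pow, Padic.norm_p, inv_pow]
    rw [inv_mul_le_iff₀ (by positivity)]
    linarith
  obtain ⟨y, hy⟩ : ∃ y : ℤ_[p], (y : ℚ_[p]) = (p : ℚ_[p]) ^ n * x := ⟨⟨_, hx⟩, rfl⟩
  have h := PadicInt.appr_spec n y
  rw [← PadicInt.norm_le_pow_iff_mem_span_pow] at h
  set k := PadicInt.appr y n
  refine ⟨(k : ℤ) / (p : ℚ) ^ n, ⟨k, n, rfl⟩, ?_⟩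
  rw [PadicInt.norm_def, PadicInt.coe_sub, PadicInt.coe_natCast, hy] at h
  push_cast
  have e : x - (k : ℚ_[p]) / (p : ℚ_[p]) ^ n
      = ((p : ℚ_[p]) ^ n)⁻¹ * ((p : ℚ_[p]) ^ n * x - k) := by
    field_simp
  rw [e, norm_mul, norm_inv, norm_pow, Padic.norm_p, inv_pow, inv_inv]
  calc (p : ℝ) ^ n * ‖(p : ℚ_[p]) ^ n * x - k‖
      ≤ (p : ℝ) ^ n * (p : ℝ) ^ (-(n : ℤ)) := by gcongr
    _ = 1 := by
        rw [zpow_neg, zpow_natCast]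
        exact mul_inv_cancel₀ (by positivity)

/-- The image of `x` under `ℚ_p → ℚ_p / ℤ_p ⊂ ℚ / ℤ`, given by a representative in `ℤ[1/p]`. -/
def fracPart (p : ℕ) [Fact p.Prime] (x : ℚ_[p]) : ℚ := (exists_fracPart p x).choose

theorem exists_int_of_norm_le_one (p : ℕ) [Fact p.Prime] (k : ℤ) (n : ℕ)
    (h : ‖(((k : ℚ) / (p : ℚ) ^ n : ℚ) : ℚ_[p])‖ ≤ 1) :
    ∃ m : ℤ, (k : ℚ) / (p : ℚ) ^ n = m := by
  have hp0 : (p : ℚ) ≠ 0 := by exact_mod_cast (Fact.out : p.Prime).ne_zero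
  have hp1 : (0 : ℝ) < p := by exact_mod_cast (Fact.out : p.Prime).pos
  push_cast at h
  rw [norm_div, norm_pow, Padic.norm_p, inv_pow, div_inv_eq_mul] at h
  have h2 : ‖(k : ℚ_[p])‖ ≤ (p : ℝ) ^ (-(n : ℤ)) := by
    rw [zpow_neg, zpow_natCast, ← one_div, le_div_iff₀ (by positivity)]
    exact h
  rw [Padic.norm_int_le_pow_iff_dvd] at h2
  obtain ⟨m, hm⟩ := h2
  refine ⟨m, ?_⟩
  rw [hm]
  push_cast
  field_simp

theorem fourierChar_fracPart_add (p : ℕ) [Fact p.Prime] (x y : ℚ_[p]) :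
    Real.fourierChar ((fracPart p (x + y) : ℚ) : ℝ) =
      Real.fourierChar ((fracPart p x : ℚ) : ℝ) * Real.fourierChar ((fracPart p y : ℚ) : ℝ) := by
  obtain ⟨⟨k, n, h1⟩, h1'⟩ := (exists_fracPart p x).choose_spec
  obtain ⟨⟨l, m, h2⟩, h2'⟩ := (exists_fracPart p y).choose_spec
  obtain ⟨⟨j, i, h3⟩, h3'⟩ := (exists_fracPart p (x + y)).choose_spec
  change fracPart p x = _ at h1
  change fracPart p y = _ at h2
  change fracPart p (x + y) = _ at h3
  change ‖x - (fracPart p x : ℚ_[p])‖ ≤ 1 at h1'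
  change ‖y - (fracPart p y : ℚ_[p])‖ ≤ 1 at h2'
  change ‖x + y - (fracPart p (x + y) : ℚ_[p])‖ ≤ 1 at h3'
  have hp0 : (p : ℚ) ≠ 0 := by exact_mod_cast (Fact.out : p.Prime).ne_zero
  have hd : fracPart p (x + y) - fracPart p x - fracPart p y
      = ((j * p ^ (n + m) - k * p ^ (i + m) - l * p ^ (i + n) : ℤ) : ℚ)
        / (p : ℚ) ^ (i + n + m) := by
    rw [h1, h2, h3]
    push_cast
    field_simp
    ring
  have hn : ‖((fracPart p (x + y) - fracPart p x - fracPart p y : ℚ) : ℚ_[p])‖ ≤ 1 := by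
    have e : ((fracPart p (x + y) - fracPart p x - fracPart p y : ℚ) : ℚ_[p])
        = (x - fracPart p x) + ((y - fracPart p y) - (x + y - fracPart p (x + y))) := by
      push_cast
      ring
    rw [e]
    refine (Padic.nonarchimedean _ _).trans (max_le h1' ?_)
    rw [sub_eq_add_neg]
    refine (Padic.nonarchimedean _ _).trans (max_le h2' ?_)
    rwa [norm_neg]
  rw [hd] at hn
  obtain ⟨c, hc⟩ := exists_int_of_norm_le_one p _ _ hn
  have hs : fracPart p (x + y) = fracPart p x + fracPart p y + c := by
    rw [← hc, ← hd]
    ring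
  rw [hs]
  push_cast
  rw [AddChar.map_add_eq_mul, AddChar.map_add_eq_mul]
  have : Real.fourierChar (c : ℝ) = 1 := by
    rw [Real.fourierChar_apply']
    have := Circle.exp_int_mul_two_pi c
    rwa [mul_comm] at this
  rw [this, mul_one]

/-- The additive character `e_p : ℚ_p → ℚ_p / ℤ_p ⊂ ℚ / ℤ → U(1)`, the last map being
`t ↦ exp (2 π i t)`. -/
def padicChar (p : ℕ) [Fact p.Prime] : AddChar ℚ_[p] Circle where
  toFun x := Real.fourierChar ((fracPart p x : ℚ) : ℝ)
  map_zero_eq_one' := by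
    have h := fourierChar_fracPart_add p 0 0
    rw [add_zero] at h
    exact left_eq_mul.mp h
  map_add_eq_mul' := fourierChar_fracPart_add p

/-- The function `σ_p = 1_{|x| = 1} - p⁻¹ 1_{|x| = p}` on `ℚ_p`. -/
def sigma (p : ℕ) [Fact p.Prime] (x : ℚ_[p]) : ℂ :=
  ({x : ℚ_[p] | ‖x‖ = 1}).indicator 1 x
    - (p : ℂ)⁻¹ * ({x : ℚ_[p] | ‖x‖ = p}).indicator 1 x

/-! ### Semilocal adeles

A finite set of places of `ℚ` containing the archimedean one is given by the finite set `S` of the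
primes in it. -/

/-- The semilocal adele ring `𝔸_S = (∏_{p ∈ S} ℚ_p) × ℝ`. -/
abbrev Adele (S : Finset Nat.Primes) : Type := ((p : S) → ℚ_[((p : Nat.Primes) : ℕ)]) × ℝ

/-- The product of the Haar measures of the local fields. -/
def adeleHaar (S : Finset Nat.Primes) : Measure (Adele S) :=
  (Measure.pi fun p : S => padicHaar ((p : Nat.Primes) : ℕ)).prod volume

/-- The module `|x|_S = ∏_v |x_v|_v`. -/
def adeleModule (S : Finset Nat.Primes) (x : Adele S) : ℝ := (∏ p : S, ‖x.1 p‖) * |x.2|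

/-- The normalized character `α = (∏_p e_p) · e_∞` of `𝔸_S`, where `e_∞ t = exp (2 π i t)`. -/
def adeleChar (S : Finset Nat.Primes) : AddChar (Adele S) Circle where
  toFun x := (∏ p : S, padicChar ((p : Nat.Primes) : ℕ) (x.1 p)) * Real.fourierChar x.2
  map_zero_eq_one' := by simp
  map_add_eq_mul' x y := by
    simp only [Prod.fst_add, Prod.snd_add, Pi.add_apply, AddChar.map_add_eq_mul,
      Finset.prod_mul_distrib]
    exact mul_mul_mul_comm _ _ _ _

/-- The Fourier transform on `𝔸_S` with respect to `α`:
`(ℱ h) y = ∫ h x * α (- (x * y)) dx`. -/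
def adeleFourier (S : Finset Nat.Primes) (h : Adele S → ℂ) : Adele S → ℂ :=
  Fourier.fourierIntegral (adeleChar S) (adeleHaar S) h

/-- The Schwartz–Bruhat space of `𝔸_S`: linear combinations of products of locally constant
compactly supported functions on the `ℚ_p` and a Schwartz function on `ℝ`. -/
def schwartzBruhat (S : Finset Nat.Primes) : Submodule ℂ (Adele S → ℂ) :=
  Submodule.span ℂ {h | ∃ (φ : (p : S) → ℚ_[((p : Nat.Primes) : ℕ)] → ℂ) (f : SchwartzMap ℝ ℂ),
    (∀ p, IsLocallyConstant (φ p) ∧ HasCompactSupport (φ p)) ∧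
      h = fun x => (∏ p, φ p (x.1 p)) * f x.2}

/-- The group `Γ = GL₁(ℚ_S)` of the rational numbers that are units at all primes outside `S`. -/
def Gam (S : Finset Nat.Primes) : Subgroup ℚˣ where
  carrier := {q | ∀ p : Nat.Primes, p ∉ S → ‖((q : ℚ) : ℚ_[(p : ℕ)])‖ = 1}
  mul_mem' {a b} ha hb p hp := by simp [ha p hp, hb p hp]
  one_mem' p _ := by simp
  inv_mem' {a} ha p hp := by simp [ha p hp]

theorem prod_padicNorm_natCast (n N : ℕ) (hn : n ≠ 0) (h : n < N) :
    ∏ p ∈ (Finset.range N).filter Nat.Prime, padicNorm p (n : ℚ) = (n : ℚ)⁻¹ := by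
  have h1 := Nat.prod_pow_prime_padicValNat n hn N h
  have h2 : (n : ℚ) = ∏ p ∈ (Finset.range N).filter Nat.Prime, (p : ℚ) ^ padicValNat p n := by
    exact_mod_cast h1.symm
  conv_rhs => rw [h2]
  rw [← Finset.prod_inv_distrib]
  refine Finset.prod_congr rfl fun p _ => ?_
  rw [padicNorm.eq_zpow_of_nonzero (by exact_mod_cast hn), padicValRat.of_nat, zpow_neg,
    zpow_natCast]

/-- The product formula for the elements of `Γ`. -/
theorem prod_norm_mul_abs (S : Finset Nat.Primes) (q : Gam S) :
    (∏ p : S, ‖(((q : ℚˣ) : ℚ) : ℚ_[((p : Nat.Primes) : ℕ)])‖) * |(((q : ℚˣ) : ℚ) : ℝ)| = 1 := by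
  obtain ⟨u, hu⟩ := q
  obtain ⟨r, hr⟩ : ∃ r : ℚ, r = u := ⟨_, rfl⟩
  have hr0 : r ≠ 0 := hr ▸ u.ne_zero
  have hS : ∀ p : Nat.Primes, p ∉ S → padicNorm p r = 1 := by
    intro p hp
    have := hu p hp
    rw [← hr, Padic.eq_padicNorm] at this
    exact_mod_cast this
  simp only [← hr, Padic.eq_padicNorm]
  suffices h : (∏ p : S, padicNorm ((p : Nat.Primes) : ℕ) r) * |r| = 1 by exact_mod_cast h
  rw [Finset.prod_coe_sort S (fun p : Nat.Primes => padicNorm (p : ℕ) r)]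
  set N : ℕ := r.num.natAbs + r.den + (∑ p ∈ S, (p : ℕ)) + 1 with hN
  have hnum : r.num.natAbs ≠ 0 := by simpa using hr0
  have e1 : ∏ p ∈ S, padicNorm (p : ℕ) r
      = ∏ p ∈ (Finset.range N).filter Nat.Prime, padicNorm p r := by
    rw [← Finset.prod_image (s := S) (g := fun p : Nat.Primes => (p : ℕ))
      (f := fun p : ℕ => padicNorm p r) (fun a _ b _ hab => Subtype.ext hab)]
    refine Finset.prod_subset ?_ ?_
    · intro p hp
      obtain ⟨p', hp', rfl⟩ := Finset.mem_image.mp hp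
      have : (p' : ℕ) ≤ ∑ p ∈ S, (p : ℕ) :=
        Finset.single_le_sum (f := fun p : Nat.Primes => (p : ℕ)) (fun _ _ => Nat.zero_le _) hp'
      simp only [Finset.mem_filter, Finset.mem_range]
      exact ⟨by omega, p'.2⟩
    · intro p hp hp'
      have hpp := (Finset.mem_filter.mp hp).2
      exact hS ⟨p, hpp⟩ fun hmem => hp' (Finset.mem_image.mpr ⟨_, hmem, rfl⟩)
  have e2 : ∏ p ∈ (Finset.range N).filter Nat.Prime, padicNorm p r
      = (∏ p ∈ (Finset.range N).filter Nat.Prime, padicNorm p (r.num.natAbs : ℚ))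
        / ∏ p ∈ (Finset.range N).filter Nat.Prime, padicNorm p (r.den : ℚ) := by
    rw [← Finset.prod_div_distrib]
    refine Finset.prod_congr rfl fun p hp => ?_
    have : Fact p.Prime := ⟨(Finset.mem_filter.mp hp).2⟩
    rw [← padicNorm.div]
    rcases abs_choice (r.num : ℚ) with h | h
    · rw [Nat.cast_natAbs, Int.cast_abs, h, Rat.num_div_den]
    · rw [Nat.cast_natAbs, Int.cast_abs, h, neg_div, padicNorm.neg, Rat.num_div_den]
  rw [e1, e2, prod_padicNorm_natCast _ _ hnum (by omega),
    prod_padicNorm_natCast _ _ r.den_ne_zero (by omega)]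
  have hd : (r.den : ℚ) ≠ 0 := by exact_mod_cast r.den_ne_zero
  have hn' : (r.num.natAbs : ℚ) ≠ 0 := by exact_mod_cast hnum
  have habs : |r| = (r.num.natAbs : ℚ) / r.den := by
    conv_lhs => rw [← Rat.num_div_den r]
    rw [abs_div, Nat.cast_natAbs, Int.cast_abs, Nat.abs_cast]
  rw [habs]
  field_simp

theorem adeleModule_smul (S : Finset Nat.Primes) (q : Gam S) (x : Adele S) :
    adeleModule S (q • x) = adeleModule S x := by
  have h1 : ∀ p : S, ‖(q • x).1 p‖
      = ‖(((q : ℚˣ) : ℚ) : ℚ_[((p : Nat.Primes) : ℕ)])‖ * ‖x.1 p‖ := by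
    intro p
    change ‖((q : ℚˣ) : ℚ) • x.1 p‖ = _
    rw [Rat.smul_def, norm_mul]
  have h2 : |(q • x).2| = |(((q : ℚˣ) : ℚ) : ℝ)| * |x.2| := by
    change |((q : ℚˣ) : ℚ) • x.2| = _
    rw [Rat.smul_def, abs_mul]
  unfold adeleModule
  rw [h2, Finset.prod_congr rfl fun p _ => h1 p, Finset.prod_mul_distrib, mul_mul_mul_comm,
    prod_norm_mul_abs, one_mul]

/-! ### The semilocal adele class space -/

/-- The semilocal adele class space `X_S = 𝔸_S / Γ`, with the quotient σ-algebra. -/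
abbrev AdeleClass (S : Finset Nat.Primes) : Type := MulAction.orbitRel.Quotient (Gam S) (Adele S)

/-- The canonical projection `π_S : 𝔸_S → X_S`. -/
def proj (S : Finset Nat.Primes) (x : Adele S) : AdeleClass S := Quotient.mk _ x

/-- The set `F = (∏_p ℤ_p^×) × ℝ_{>0}`, which meets the `Γ`-orbit of each invertible element
of `𝔸_S` in exactly one point. -/
def fundDomain (S : Finset Nat.Primes) : Set (Adele S) := {x | (∀ p, ‖x.1 p‖ = 1) ∧ 0 < x.2}

/-- The measure on `X_S` induced by the `Γ`-invariant measure of `𝔸_S`. -/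
def classMeasure (S : Finset Nat.Primes) : Measure (AdeleClass S) :=
  ((adeleHaar S).restrict (fundDomain S)).map (proj S)

/-- The Hilbert space `L²(X_S)`. -/
abbrev L2Class (S : Finset Nat.Primes) : Type := Lp ℂ 2 (classMeasure S)

/-- The module `|x|_S` on `X_S`. -/
def classModule (S : Finset Nat.Primes) : AdeleClass S → ℝ :=
  Quotient.lift (adeleModule S) (by
    rintro a b ⟨q, rfl⟩
    exact adeleModule_smul S q b)

/-- The action by multiplication of the invertible elements of `𝔸_S` on `X_S`. -/
def ideleAct (S : Finset Nat.Primes) (a : (Adele S)ˣ) : AdeleClass S → AdeleClass S :=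
  Quotient.map (fun x => (a : Adele S) * x) (by
    rintro x y ⟨q, rfl⟩
    exact ⟨q, (mul_smul_comm ((q : ℚˣ) : ℚ) (a : Adele S) y).symm⟩)

/-- The class on `X_S` of a function `h` on `𝔸_S`, that is `x ↦ ∑_γ h (γ x)`, where `γ` runs
through `Γ` modulo `±1` and `h` is symmetrized under `±1`. For `h` invariant under `-1` it is the
sum over the positive elements of `Γ`. -/
def toClass (S : Finset Nat.Primes) (h : Adele S → ℂ) : AdeleClass S → ℂ :=
  Quotient.lift (fun x => (1 / 2 : ℂ) * ∑' q : Gam S, h (q • x)) (by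
    rintro a b ⟨q, rfl⟩
    simp only [smul_smul]
    congr 1
    exact (Equiv.mulRight q).tsum_eq fun r : Gam S => h (r • b))

/-- The subspace `L²(X_S)^{K_S}`, where `K_S` is the group of the classes of the invertible
elements of `𝔸_S` of module `1`. -/
def kInvariant (S : Finset Nat.Primes) : Submodule ℂ (L2Class S) where
  carrier := {f | ∃ g : AdeleClass S → ℂ, f =ᵐ[classMeasure S] g ∧
    ∀ a : (Adele S)ˣ, adeleModule S a = 1 →
      ∀ᵐ x ∂classMeasure S, g (ideleAct S a x) = g x}
  zero_mem' := ⟨0, Lp.coeFn_zero _ _ _, fun _ _ => by simp⟩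
  add_mem' := by
    rintro f f' ⟨g, hg, h⟩ ⟨g', hg', h'⟩
    refine ⟨g + g', (Lp.coeFn_add f f').trans (hg.add hg'), fun a ha => ?_⟩
    filter_upwards [h a ha, h' a ha] with x hx hx'
    simp [hx, hx']
  smul_mem' := by
    rintro c f ⟨g, hg, h⟩
    refine ⟨c • g, (Lp.coeFn_smul c f).trans (hg.const_smul c), fun a ha => ?_⟩
    filter_upwards [h a ha] with x hx
    simp [hx]

/-- The bounded operator `F` on `L²(X_S)` is induced by the Fourier transform of `𝔸_S`: it maps
the class of `h` to the class of `ℱ h`, for all Schwartz–Bruhat functions `h`. -/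
def IsSemilocalFourier (S : Finset Nat.Primes) (F : L2Class S →L[ℂ] L2Class S) : Prop :=
  ∀ h ∈ schwartzBruhat S, ∀ φ : L2Class S, φ =ᵐ[classMeasure S] toClass S h →
    F φ =ᵐ[classMeasure S] toClass S (adeleFourier S h)

/-! ### Sonin spaces -/

/-- The `L²` functions that vanish almost everywhere on `s`. -/
def vanishingOn {X : Type*} [MeasurableSpace X] (μ : Measure X) (s : Set X) :
    Submodule ℂ (Lp ℂ 2 μ) where
  carrier := {f | ∀ᵐ x ∂μ, x ∈ s → f x = 0}
  zero_mem' := by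
    filter_upwards [Lp.coeFn_zero ℂ 2 μ] with x hx _
    exact hx
  add_mem' {f g} hf hg := by
    filter_upwards [hf, hg, Lp.coeFn_add f g] with x h1 h2 h3 hx
    rw [h3, Pi.add_apply, h1 hx, h2 hx, add_zero]
  smul_mem' c f hf := by
    filter_upwards [hf, Lp.coeFn_smul c f] with x h1 h3 hx
    rw [h3, Pi.smul_apply, h1 hx, smul_zero]

/-- The subspace `L²(ℝ)^{ev}` of even functions. -/
def evenL2 : Submodule ℂ (Lp ℂ 2 (volume : Measure ℝ)) where
  carrier := {f | ∀ᵐ x : ℝ, f (-x) = f x}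
  zero_mem' := by
    have h := Lp.coeFn_zero ℂ 2 (volume : Measure ℝ)
    filter_upwards [h,
      (Measure.measurePreserving_neg (volume : Measure ℝ)).quasiMeasurePreserving.ae h]
      with x h1 h2
    exact h2.trans h1.symm
  add_mem' {f g} hf hg := by
    have h := Lp.coeFn_add f g
    filter_upwards [hf, hg, h,
      (Measure.measurePreserving_neg (volume : Measure ℝ)).quasiMeasurePreserving.ae h]
      with x h1 h2 h3 h4
    rw [h3, h4, Pi.add_apply, Pi.add_apply, h1, h2]
  smul_mem' c f hf := by
    have h := Lp.coeFn_smul c f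
    filter_upwards [hf, h,
      (Measure.measurePreserving_neg (volume : Measure ℝ)).quasiMeasurePreserving.ae h]
      with x h1 h3 h4
    rw [h3, h4, Pi.smul_apply, Pi.smul_apply, h1]

/-- The archimedean Sonin space `S_λ(ℝ, e_∞)`, inside `L²(ℝ)^{ev}`: the even functions that
vanish, together with their Fourier transform, where `|x| < λ`. -/
def realSonin (lam : ℝ) : Submodule ℂ (Lp ℂ 2 (volume : Measure ℝ)) :=
  evenL2 ⊓ vanishingOn volume {x | |x| < lam} ⊓
    (vanishingOn volume {x | |x| < lam}).comap
      (Lp.fourierTransformₗᵢ ℝ ℂ).toLinearEquiv.toLinearMap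

/-- The semilocal Sonin space `S_λ(X_S, α)`, for the Fourier transform `F` of `L²(X_S)`. -/
def semilocalSonin (S : Finset Nat.Primes) (F : L2Class S →L[ℂ] L2Class S) (lam : ℝ) :
    Submodule ℂ (L2Class S) :=
  kInvariant S ⊓ vanishingOn (classMeasure S) {x | classModule S x < lam} ⊓
    (vanishingOn (classMeasure S) {x | classModule S x < lam}).comap F.toLinearMap

/-- The class `θ_S(f)` of the function `σ_S ⊗ f` on `𝔸_S`, where `σ_S = ⊗_p σ_p`. -/
def theta (S : Finset Nat.Primes) (f : ℝ → ℂ) : AdeleClass S → ℂ :=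
  toClass S fun x => (∏ p : S, sigma ((p : Nat.Primes) : ℕ) (x.1 p)) * f x.2

end SemilocalSonin

end

/-!
The group `Γ` acts on the invertible adeles with fundamental domain `F = ∏ ℤ_p^× × (0, ∞)`, so that
`L²(X_S)` is `L²(F)` (`isFundamentalDomain_fundDomain`, `ae_class_iff`).

*The operator `𝔽_S`.* For a Schwartz–Bruhat function `h` the series `∑_γ h (γ x)` is, on `F`,
bounded by a multiple of `min (t ^ (-1/4), t ^ (-1))` in the real coordinate `t`, hence square
integrable (`exists_class_bound`). Unfolding gives `‖[h]‖² = ¼ ∑_γ ⟨h (γ ·), h⟩`. As the measure and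
the character of `𝔸_S` are self-dual and `ℱ` turns `h (γ ·)` into `(ℱ h) (γ⁻¹ ·)`, Plancherel's
formula on `𝔸_S` permutes the terms of this sum, and `‖[ℱ h]‖ = ‖[h]‖` (`norm_classMap_fourier`).
Since the classes `[h]` are dense (`denseRange_classMap`), `[h] ↦ [ℱ h]` extends to `L²(X_S)` in
exactly one way.

*The isomorphism `θ_S`.* A function in `L²(X_S)` is invariant under `K_S` when it is a function of
the module, so that `J : f ↦ f (|·|)` maps `L²(ℝ)^{ev}` onto `L²(X_S)^{K_S}` and multiplies the norm
by a constant (`exists_ofModule_eq`, `norm_le_norm_ofModule`). On `F` the only terms of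
`∑_γ (σ_S ⊗ f) (γ x)` that do not vanish are those of `γ = ± ∏_{p ∈ T} p⁻¹` with `T ⊆ S`. Hence
`θ_S = J ∘ A` on even functions, where `A = ∏_{p ∈ S} (1 - p⁻¹ D_p)` and `D_p f = f (p⁻¹ ·)`
(`theta_proj`). As `‖p⁻¹ D_p‖ ≤ p ^ (-1/2) < 1`, the operator `A` is invertible, and `A` and `A⁻¹`
preserve the even functions that vanish where `|t| < λ`, because `D_p` does (`exists_eulerEquiv`).
Finally `σ_p` is its own Fourier transform, whence `𝔽_S ∘ θ_S = θ_S ∘ ℱ_ℝ`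
(`classFourier_thetaL2`). So `θ_S` transports both vanishing conditions, in both directions.
-/

noncomputable section

namespace SemilocalSonin

/-! ### Haar measure on `ℚ_p` -/

section Local

variable {p : ℕ} [Fact p.Prime]

open Metric

instance : (padicHaar p).IsAddHaarMeasure := by unfold padicHaar; infer_instance

theorem prime_cast_pos : (0 : ℝ) < p := by exact_mod_cast (Fact.out : p.Prime).pos

theorem one_lt_prime_cast : (1 : ℝ) < p := by exact_mod_cast (Fact.out : p.Prime).one_lt

theorem padicHaar_closedBall_one : padicHaar p (closedBall 0 1) = 1 :=
  Measure.addHaarMeasure_self (K₀ := padicUnitBall p)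

theorem mul_preimage_closedBall {a : ℚ_[p]} (ha : a ≠ 0) (r : ℝ) :
    (fun x => a * x) ⁻¹' closedBall 0 r = closedBall 0 (r / ‖a‖) := by
  ext x
  simp only [Set.mem_preimage, mem_closedBall, dist_zero_right, norm_mul]
  rw [le_div_iff₀ (norm_pos_iff.mpr ha), mul_comm]

theorem measurable_padic_mul (a : ℚ_[p]) : Measurable fun x : ℚ_[p] => a * x :=
  (continuous_const_mul a).measurable

/-- The scaling factor of the Haar measure, found by uniqueness, is the measure of the inverse image
of `ℤ_p`. -/
theorem padicHaar_map_mul_aux {a : ℚ_[p]} (ha : a ≠ 0) :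
    (padicHaar p).map (fun x => a * x) = padicHaar p (closedBall 0 (1 / ‖a‖)) • padicHaar p := by
  have hmap : ((padicHaar p).map (fun x => a * x)).IsAddHaarMeasure :=
    AddEquiv.isAddHaarMeasure_map (padicHaar p) (AddAut.mulLeft (Units.mk0 a ha))
      (continuous_const_mul a) (continuous_const_mul a⁻¹)
  have h := Measure.addHaarMeasure_unique ((padicHaar p).map (fun x => a * x)) (padicUnitBall p)
  rw [h]
  congr 1
  change ((padicHaar p).map (fun x => a * x)) (closedBall 0 1) = _
  rw [Measure.map_apply (measurable_padic_mul a) isClosed_closedBall.measurableSet,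
    mul_preimage_closedBall ha]

/-- The ball `ℤ_p` is the disjoint union of `p` translates of `p ℤ_p`. -/
theorem padicHaar_closedBall_inv_prime :
    padicHaar p (closedBall 0 (p : ℝ)⁻¹) = ENNReal.ofReal (p : ℝ)⁻¹ := by
  have hU : closedBall (0 : ℚ_[p]) 1 =
      ⋃ k ∈ Finset.range p, closedBall ((k : ℕ) : ℚ_[p]) (p : ℝ)⁻¹ := by
    ext x
    simp only [Set.mem_iUnion, mem_closedBall, dist_zero_right, Finset.mem_range, exists_prop]
    constructor
    · intro hx
      obtain ⟨y, rfl⟩ : ∃ y : ℤ_[p], (y : ℚ_[p]) = x := ⟨⟨x, hx⟩, rfl⟩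
      obtain ⟨k, hk, hk'⟩ := PadicInt.exists_mem_range y
      refine ⟨k, hk, ?_⟩
      rw [PadicInt.maximalIdeal_eq_span_p, ← pow_one (p : ℤ_[p]),
        ← PadicInt.norm_le_pow_iff_mem_span_pow] at hk'
      rw [dist_eq_norm, ← zpow_neg_one]
      rw [PadicInt.norm_def, PadicInt.coe_sub, PadicInt.coe_natCast] at hk'
      exact_mod_cast hk'
    · rintro ⟨k, -, hk⟩
      rw [dist_eq_norm] at hk
      have : x = (x - k) + k := by ring
      rw [this]
      refine (Padic.nonarchimedean _ _).trans (max_le (hk.trans ?_) ?_)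
      · exact inv_le_one_of_one_le₀ one_lt_prime_cast.le
      · exact_mod_cast Padic.norm_int_le_one (p := p) k
  have hd : Set.PairwiseDisjoint (↑(Finset.range p))
      (fun k : ℕ => closedBall (k : ℚ_[p]) (p : ℝ)⁻¹) := by
    intro i hi j hj hij
    rw [Function.onFun, Set.disjoint_left]
    intro x hxi hxj
    apply hij
    rw [mem_closedBall, dist_eq_norm] at hxi hxj
    have h : ‖((i - j : ℤ) : ℚ_[p])‖ ≤ (p : ℝ) ^ (-((1 : ℕ) : ℤ)) := by
      have : ((i - j : ℤ) : ℚ_[p]) = (x - j) + -(x - i) := by push_cast; ring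
      rw [this]
      refine (Padic.nonarchimedean _ _).trans (max_le ?_ ?_)
      · simpa using hxj
      · rw [norm_neg]; simpa using hxi
    rw [Padic.norm_int_le_pow_iff_dvd] at h
    simp only [Finset.coe_range, Set.mem_Iio] at hi hj
    have h' : (p : ℤ) ∣ (i : ℤ) - j := by simpa using h
    have := Int.eq_zero_of_abs_lt_dvd h' (by rw [abs_lt]; constructor <;> omega)
    omega
  have hm := padicHaar_closedBall_one (p := p)
  rw [hU, measure_biUnion_finset hd fun _ _ => isClosed_closedBall.measurableSet] at hm
  simp only [Measure.addHaar_closedBall_center] at hm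
  rw [Finset.sum_const, Finset.card_range, nsmul_eq_mul] at hm
  rw [ENNReal.ofReal_inv_of_pos prime_cast_pos, ENNReal.ofReal_natCast]
  exact ENNReal.eq_inv_of_mul_eq_one_left (by rwa [mul_comm])

theorem padicHaar_closedBall_div_prime (r : ℝ) :
    padicHaar p (closedBall 0 (r / p))
      = ENNReal.ofReal (p : ℝ)⁻¹ * padicHaar p (closedBall 0 r) := by
  have hp : (p : ℚ_[p])⁻¹ ≠ 0 := inv_ne_zero (by exact_mod_cast (Fact.out : p.Prime).ne_zero)
  have h := congrArg (fun μ => μ (closedBall 0 r)) (padicHaar_map_mul_aux hp)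
  simp only [Measure.smul_apply, smul_eq_mul] at h
  rw [Measure.map_apply (measurable_padic_mul _) isClosed_closedBall.measurableSet,
    mul_preimage_closedBall hp, norm_inv, Padic.norm_p, inv_inv, one_div,
    padicHaar_closedBall_inv_prime] at h
  exact h

theorem padicHaar_closedBall (n : ℤ) :
    padicHaar p (closedBall 0 ((p : ℝ) ^ n)) = ENNReal.ofReal ((p : ℝ) ^ n) := by
  have hp := prime_cast_pos (p := p)
  induction n using Int.induction_on with
  | zero => simpa using padicHaar_closedBall_one
  | succ n ih =>
    have h := padicHaar_closedBall_div_prime (p := p) ((p : ℝ) ^ ((n : ℤ) + 1))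
    rw [zpow_add_one₀ hp.ne', mul_div_cancel_right₀ _ hp.ne', ih] at h
    rw [zpow_add_one₀ hp.ne', mul_comm (_ ^ _) (p : ℝ), ENNReal.ofReal_mul hp.le, h,
      mul_comm (_ ^ _) (p : ℝ), ← mul_assoc, ← ENNReal.ofReal_mul hp.le, mul_inv_cancel₀ hp.ne',
      ENNReal.ofReal_one, one_mul]
  | pred n ih =>
    rw [zpow_sub_one₀ hp.ne', ← div_eq_mul_inv, padicHaar_closedBall_div_prime, ih, div_eq_mul_inv,
      mul_comm, ← ENNReal.ofReal_mul (by positivity)]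

/-- `d(ax) = |a| dx` on `ℚ_p`. -/
theorem padicHaar_map_mul {a : ℚ_[p]} (ha : a ≠ 0) :
    (padicHaar p).map (fun x => a * x) = ENNReal.ofReal ‖a‖⁻¹ • padicHaar p := by
  rw [padicHaar_map_mul_aux ha]
  obtain ⟨n, hn⟩ := Padic.padicNormE.image ha
  rw [one_div, hn]
  push_cast
  rw [← zpow_neg, padicHaar_closedBall]

/-! ### The additive character -/

/-- The self-duality of `e_p`: its kernel is `ℤ_p`. -/
theorem padicChar_eq_one_iff (x : ℚ_[p]) : padicChar p x = 1 ↔ ‖x‖ ≤ 1 := by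
  obtain ⟨⟨k, n, h1⟩, h2⟩ := (exists_fracPart p x).choose_spec
  change fracPart p x = _ at h1
  change ‖x - (fracPart p x : ℚ_[p])‖ ≤ 1 at h2
  have hint : ∀ m : ℤ, ‖(m : ℚ_[p])‖ ≤ 1 := Padic.norm_int_le_one
  change Real.fourierChar ((fracPart p x : ℚ) : ℝ) = 1 ↔ _
  constructor
  · intro h
    rw [Real.fourierChar_apply', Circle.exp_eq_one] at h
    obtain ⟨m, hm⟩ := h
    have hm' : ((fracPart p x : ℚ) : ℝ) = m := by
      have : (2 * Real.pi) ≠ 0 := by positivity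
      apply mul_left_cancel₀ this
      linarith
    have hm'' : fracPart p x = m := by exact_mod_cast hm'
    rw [hm''] at h2
    have : x = (x - ((m : ℚ) : ℚ_[p])) + m := by push_cast; ring
    rw [this]
    exact (Padic.nonarchimedean _ _).trans (max_le h2 (hint m))
  · intro h
    have h3 : ‖((fracPart p x : ℚ) : ℚ_[p])‖ ≤ 1 := by
      have : ((fracPart p x : ℚ) : ℚ_[p]) = x + -(x - (fracPart p x : ℚ_[p])) := by ring
      rw [this]
      exact (Padic.nonarchimedean _ _).trans (max_le h (by rwa [norm_neg]))
    rw [h1] at h3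
    obtain ⟨m, hm⟩ := exists_int_of_norm_le_one p k n h3
    rw [h1, hm, Real.fourierChar_apply', Circle.exp_eq_one]
    exact ⟨m, by push_cast; ring⟩

theorem continuous_padicChar : Continuous (padicChar p) := by
  apply IsLocallyConstant.continuous
  rw [IsLocallyConstant.iff_exists_open]
  intro x
  refine ⟨ball x 1, isOpen_ball, mem_ball_self one_pos, fun y hy => ?_⟩
  have : y = x + (y - x) := by ring
  rw [this, AddChar.map_add_eq_mul, (padicChar_eq_one_iff (y - x)).mpr, mul_one]
  rw [mem_ball, dist_eq_norm] at hy
  exact hy.le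

end Local

/-! ### Fourier transform of locally constant functions -/

section LocalFourier

variable {p : ℕ} [Fact p.Prime]

open Metric

/-- The Fourier transform of `ℚ_p` with respect to `e_p`. -/
def padicFourier (p : ℕ) [Fact p.Prime] (φ : ℚ_[p] → ℂ) : ℚ_[p] → ℂ :=
  Fourier.fourierIntegral (padicChar p) (padicHaar p) φ

theorem padicFourier_apply (φ : ℚ_[p] → ℂ) (y : ℚ_[p]) :
    padicFourier p φ y = ∫ x, (padicChar p (-(x * y)) : ℂ) * φ x ∂padicHaar p := rfl

/-- The indicator function of the ball of radius `p ^ n`. -/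
def ballInd (p : ℕ) [Fact p.Prime] (n : ℤ) : ℚ_[p] → ℂ :=
  (closedBall (0 : ℚ_[p]) ((p : ℝ) ^ n)).indicator (fun _ => (1 : ℂ))

theorem ballInd_of_mem {n : ℤ} {x : ℚ_[p]} (h : ‖x‖ ≤ (p : ℝ) ^ n) : ballInd p n x = 1 :=
  Set.indicator_of_mem (by simpa using h) _

theorem ballInd_of_notMem {n : ℤ} {x : ℚ_[p]} (h : ¬ ‖x‖ ≤ (p : ℝ) ^ n) : ballInd p n x = 0 :=
  Set.indicator_of_notMem (by simpa using h) _

theorem ballInd_apply (n : ℤ) (x : ℚ_[p]) :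
    ballInd p n x = if ‖x‖ ≤ (p : ℝ) ^ n then 1 else 0 := by
  split_ifs with h
  exacts [ballInd_of_mem h, ballInd_of_notMem h]

theorem integral_ballInd (n : ℤ) : ∫ x, ballInd p n x ∂padicHaar p = (p : ℂ) ^ n := by
  unfold ballInd
  rw [integral_indicator isClosed_closedBall.measurableSet, setIntegral_const, measureReal_def,
    padicHaar_closedBall, ENNReal.toReal_ofReal (zpow_nonneg prime_cast_pos.le _)]
  simp

theorem norm_prime_zpow (n : ℤ) : ‖(p : ℚ_[p]) ^ (-n)‖ = (p : ℝ) ^ n := by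
  rw [norm_zpow, Padic.norm_p, inv_zpow, zpow_neg, inv_inv]

theorem integrable_ballInd (n : ℤ) : Integrable (ballInd p n) (padicHaar p) := by
  refine (integrable_indicator_iff isClosed_closedBall.measurableSet).mpr ?_
  exact integrableOn_const (isCompact_closedBall _ _).measure_lt_top.ne

theorem add_mem_closedBall_iff {r : ℝ} {x z : ℚ_[p]} (hz : ‖z‖ ≤ r) :
    x + z ∈ closedBall (0 : ℚ_[p]) r ↔ x ∈ closedBall (0 : ℚ_[p]) r := by
  simp only [mem_closedBall, dist_zero_right]
  constructor
  · intro h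
    have : x = (x + z) + -z := by ring
    rw [this]
    exact (Padic.nonarchimedean _ _).trans (max_le h (by rwa [norm_neg]))
  · intro h
    exact (Padic.nonarchimedean _ _).trans (max_le h hz)

theorem ballInd_add (n : ℤ) {x z : ℚ_[p]} (hz : ‖z‖ ≤ (p : ℝ) ^ n) :
    ballInd p n (x + z) = ballInd p n x := by
  have := add_mem_closedBall_iff (x := x) hz
  simp only [mem_closedBall, dist_zero_right] at this
  simp only [ballInd_apply, this]

/-- Orthogonality of characters on the ball of radius `p ^ n`. -/
theorem padicFourier_ballInd (n : ℤ) :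
    padicFourier p (ballInd p n) = fun y => (p : ℂ) ^ n * ballInd p (-n) y := by
  ext y
  have hp := prime_cast_pos (p := p)
  rw [padicFourier_apply]
  by_cases hy : ‖y‖ ≤ (p : ℝ) ^ (-n)
  · have e : ∀ x, (padicChar p (-(x * y)) : ℂ) * ballInd p n x = ballInd p n x := by
      intro x
      by_cases hx : x ∈ closedBall (0 : ℚ_[p]) ((p : ℝ) ^ n)
      · rw [(padicChar_eq_one_iff _).mpr, Circle.coe_one, one_mul]
        rw [norm_neg, norm_mul]
        rw [mem_closedBall, dist_zero_right] at hx
        calc ‖x‖ * ‖y‖ ≤ (p : ℝ) ^ n * (p : ℝ) ^ (-n) := by gcongr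
          _ = 1 := by rw [← zpow_add₀ hp.ne', add_neg_cancel, zpow_zero]
      · rw [ballInd_of_notMem (by simpa using hx), mul_zero]
    simp only [e]
    rw [ballInd_of_mem hy, mul_one, integral_ballInd]
  · rw [ballInd_of_notMem hy, mul_zero]
    set z : ℚ_[p] := (p : ℚ_[p]) ^ (-n) with hz
    have hzn : ‖z‖ = (p : ℝ) ^ n := norm_prime_zpow n
    have hc : padicChar p (-(z * y)) ≠ 1 := by
      rw [Ne, padicChar_eq_one_iff, norm_neg, norm_mul, hzn, not_le]
      rw [not_le, zpow_neg] at hy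
      calc (1 : ℝ) = (p : ℝ) ^ n * ((p : ℝ) ^ n)⁻¹ := (mul_inv_cancel₀ (by positivity)).symm
        _ < _ := by gcongr
    -- translating by `z` multiplies the integral by a scalar that is not `1`
    have ht := integral_add_right_eq_self (μ := padicHaar p)
      (fun x => (padicChar p (-(x * y)) : ℂ) * ballInd p n x) z
    have e : ∀ x, (padicChar p (-((x + z) * y)) : ℂ) * ballInd p n (x + z)
        = (padicChar p (-(z * y)) : ℂ) * ((padicChar p (-(x * y)) : ℂ) * ballInd p n x) := by
      intro x
      rw [ballInd_add n hzn.le, add_mul, neg_add, AddChar.map_add_eq_mul, Circle.coe_mul]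
      ring
    simp only [e] at ht
    rw [integral_const_mul] at ht
    have hc' : (padicChar p (-(z * y)) : ℂ) - 1 ≠ 0 := by
      rwa [sub_ne_zero, Ne, Circle.coe_eq_one]
    apply (mul_eq_zero.mp _).resolve_left hc'
    rw [sub_mul, ht, one_mul, sub_self]

/-- A function on `ℚ_p` that is supported in the ball of radius `p ^ n` and invariant under the
translations by the ball of radius `p ^ (-n)`. -/
structure HasLevel (n : ℕ) (φ : ℚ_[p] → ℂ) : Prop where
  support : ∀ x, (p : ℝ) ^ n < ‖x‖ → φ x = 0
  invariant : ∀ x z, ‖z‖ ≤ (p : ℝ) ^ (-(n : ℤ)) → φ (x + z) = φ x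

theorem HasLevel.isLocallyConstant {n : ℕ} {φ : ℚ_[p] → ℂ} (h : HasLevel n φ) :
    IsLocallyConstant φ := by
  have hp := prime_cast_pos (p := p)
  rw [IsLocallyConstant.iff_exists_open]
  intro x
  refine ⟨ball x ((p : ℝ) ^ (-(n : ℤ))), isOpen_ball, mem_ball_self (by positivity),
    fun y hy => ?_⟩
  have : y = x + (y - x) := by ring
  rw [this]
  refine h.invariant _ _ ?_
  rw [mem_ball, dist_eq_norm] at hy
  exact hy.le

theorem HasLevel.hasCompactSupport {n : ℕ} {φ : ℚ_[p] → ℂ} (h : HasLevel n φ) :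
    HasCompactSupport φ := by
  refine HasCompactSupport.intro (isCompact_closedBall 0 ((p : ℝ) ^ n)) fun x hx => ?_
  refine h.support x ?_
  simpa using hx

/-- By compactness of the support, the scale at which `φ` is constant can be chosen uniformly. -/
theorem exists_hasLevel {φ : ℚ_[p] → ℂ} (h1 : IsLocallyConstant φ) (h2 : HasCompactSupport φ) :
    ∃ n : ℕ, HasLevel n φ := by
  have hp1 := one_lt_prime_cast (p := p)
  have hp := prime_cast_pos (p := p)
  obtain ⟨R, hR⟩ := h2.isCompact.isBounded.subset_closedBall 0
  obtain ⟨m, hm⟩ := pow_unbounded_of_one_lt R hp1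
  have hsupp : ∀ x, (p : ℝ) ^ m < ‖x‖ → φ x = 0 := by
    intro x hx
    by_contra hne
    have := hR (subset_tsupport _ hne)
    rw [mem_closedBall, dist_zero_right] at this
    linarith
  obtain ⟨δ, hδ, hL⟩ := lebesgue_number_lemma_of_metric (ι := ℂ)
    (isCompact_closedBall (0 : ℚ_[p]) ((p : ℝ) ^ m)) (c := fun c => φ ⁻¹' {c})
    (fun c => h1.isOpen_fiber c) (fun x _ => Set.mem_iUnion.mpr ⟨φ x, rfl⟩)
  obtain ⟨k, hk⟩ := exists_pow_lt_of_lt_one hδ (inv_lt_one_of_one_lt₀ hp1)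
  refine ⟨max m k, fun x hx => hsupp x (lt_of_le_of_lt ?_ hx), fun x z hz => ?_⟩
  · exact pow_le_pow_right₀ hp1.le (le_max_left _ _)
  · by_cases hx : x ∈ closedBall (0 : ℚ_[p]) ((p : ℝ) ^ m)
    · obtain ⟨c, hc⟩ := hL x hx
      have hzd : ‖z‖ < δ := by
        refine hz.trans_lt (lt_of_le_of_lt ?_ hk)
        rw [inv_pow, zpow_neg, zpow_natCast]
        exact inv_anti₀ (by positivity) (pow_le_pow_right₀ hp1.le (le_max_right _ _))
      have e1 : φ x = c := hc (mem_ball_self hδ)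
      have e2 : φ (x + z) = c := hc (by simpa [mem_ball, dist_eq_norm] using hzd)
      rw [e1, e2]
    · have hzm : ‖z‖ ≤ (p : ℝ) ^ m := by
        refine hz.trans ((zpow_le_one_of_nonpos₀ hp1.le (by simp)).trans ?_)
        exact one_le_pow₀ hp1.le
      have hx' := (add_mem_closedBall_iff hzm).not.mpr hx
      rw [hsupp x (by simpa using hx), hsupp (x + z) (by simpa using hx')]

theorem integrable_of_compactSupport {φ : ℚ_[p] → ℂ} (h1 : IsLocallyConstant φ)
    (h2 : HasCompactSupport φ) : Integrable φ (padicHaar p) :=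
  h1.continuous.integrable_of_hasCompactSupport h2

theorem HasLevel.integrable {n : ℕ} {φ : ℚ_[p] → ℂ} (h : HasLevel n φ) :
    Integrable φ (padicHaar p) :=
  integrable_of_compactSupport h.isLocallyConstant h.hasCompactSupport

/-- The Fourier transform exchanges the two conditions in the definition of the level. -/
theorem HasLevel.padicFourier {n : ℕ} {φ : ℚ_[p] → ℂ} (h : HasLevel n φ) :
    HasLevel n (padicFourier p φ) := by
  have hp := prime_cast_pos (p := p)
  constructor
  · intro y hy
    set z : ℚ_[p] := (p : ℚ_[p]) ^ (n : ℤ) with hz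
    have hzn : ‖z‖ = (p : ℝ) ^ (-(n : ℤ)) := by rw [hz, ← norm_prime_zpow, neg_neg]
    have hc : padicChar p (z * y) ≠ 1 := by
      rw [Ne, padicChar_eq_one_iff, norm_mul, hzn, not_le, zpow_neg, zpow_natCast]
      calc (1 : ℝ) = ((p : ℝ) ^ n)⁻¹ * (p : ℝ) ^ n := (inv_mul_cancel₀ (by positivity)).symm
        _ < _ := by gcongr
    -- translating by `z` multiplies the transform at `y` by a nontrivial scalar, but fixes `φ`
    have ht := congrFun (Fourier.fourierIntegral_comp_add_right (padicChar p) (padicHaar p) φ z) y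
    have e : (φ ∘ fun v => v + z) = φ := by
      ext x
      exact h.invariant x z hzn.le
    rw [e] at ht
    change SemilocalSonin.padicFourier p φ y
      = (padicChar p (z * y) : ℂ) * SemilocalSonin.padicFourier p φ y at ht
    have hc' : (padicChar p (z * y) : ℂ) - 1 ≠ 0 := by
      rwa [sub_ne_zero, Ne, Circle.coe_eq_one]
    apply (mul_eq_zero.mp _).resolve_left hc'
    rw [sub_mul, ← ht, one_mul, sub_self]
  · intro y w hw
    rw [padicFourier_apply, padicFourier_apply]
    congr 1
    ext x
    by_cases hx : (p : ℝ) ^ n < ‖x‖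
    · rw [h.support x hx, mul_zero, mul_zero]
    · rw [mul_add, neg_add, AddChar.map_add_eq_mul, (padicChar_eq_one_iff (-(x * w))).mpr, mul_one]
      rw [norm_neg, norm_mul]
      calc ‖x‖ * ‖w‖ ≤ (p : ℝ) ^ n * (p : ℝ) ^ (-(n : ℤ)) := by gcongr; exact not_lt.mp hx
        _ = 1 := by rw [zpow_neg, zpow_natCast, mul_inv_cancel₀ (by positivity)]

/-- Fourier inversion on `ℚ_p`. On the ball of radius `p ^ n`, which supports the transform of
`φ`, the outer character may be cut off; the multiplication formula then turns the iterated integral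
into the average of `φ` over a ball on which it is constant. -/
theorem HasLevel.padicFourier_padicFourier {n : ℕ} {φ : ℚ_[p] → ℂ} (h : HasLevel n φ)
    (x : ℚ_[p]) :
    SemilocalSonin.padicFourier p (SemilocalSonin.padicFourier p φ) x = φ (-x) := by
  have hp := prime_cast_pos (p := p)
  set g : ℚ_[p] → ℂ := fun y => (padicChar p (-(y * x)) : ℂ) * ballInd p n y with hg
  have hgi : Integrable g (padicHaar p) := by
    refine (integrable_ballInd (p := p) n).bdd_mul (c := 1) ?_ ?_
    · exact (continuous_subtype_val.comp (continuous_padicChar.comp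
        (by fun_prop))).aestronglyMeasurable
    · exact Filter.Eventually.of_forall fun y => (Circle.norm_coe _).le
  have hF : ∀ z, SemilocalSonin.padicFourier p g z = (p : ℂ) ^ n * ballInd p (-n) (z + x) := by
    intro z
    have := congrFun (padicFourier_ballInd (p := p) n) (z + x)
    rw [zpow_natCast] at this
    rw [← this, padicFourier_apply, padicFourier_apply]
    congr 1
    ext y
    rw [hg, mul_add, neg_add, AddChar.map_add_eq_mul, Circle.coe_mul, mul_assoc]
  have h1 : SemilocalSonin.padicFourier p (SemilocalSonin.padicFourier p φ) x
      = ∫ y, SemilocalSonin.padicFourier p φ y • g y ∂padicHaar p := by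
    rw [padicFourier_apply]
    congr 1
    ext y
    simp only [hg, smul_eq_mul]
    by_cases hy : (p : ℝ) ^ n < ‖y‖
    · rw [h.padicFourier.support y hy, mul_zero, zero_mul]
    · rw [ballInd_of_mem (by simpa using hy)]
      ring
  have h2 : ∫ y, SemilocalSonin.padicFourier p φ y • g y ∂padicHaar p
      = ∫ z, φ z • SemilocalSonin.padicFourier p g z ∂padicHaar p := by
    have := VectorFourier.integral_fourierIntegral_smul_eq_flip (L := LinearMap.mul ℚ_[p] ℚ_[p])
      continuous_padicChar (by exact continuous_mul) h.integrable hgi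
    rwa [LinearMap.flip_mul] at this
  have h3 : ∀ z, φ z • SemilocalSonin.padicFourier p g z
      = φ (-x) * ((p : ℂ) ^ n * ballInd p (-n) (z + x)) := by
    intro z
    rw [hF, smul_eq_mul]
    by_cases hz : z + x ∈ closedBall (0 : ℚ_[p]) ((p : ℝ) ^ (-(n : ℤ)))
    · have := h.invariant (-x) (z + x) (by simpa using hz)
      rw [← this]
      congr 2
      ring
    · rw [ballInd_of_notMem (by simpa using hz), mul_zero, mul_zero, mul_zero]
  rw [h1, h2]
  simp only [h3]
  rw [integral_const_mul, integral_const_mul,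
    integral_add_right_eq_self (μ := padicHaar p) (ballInd p (-n)) x,
    integral_ballInd, zpow_neg, zpow_natCast, mul_inv_cancel₀, mul_one]
  exact pow_ne_zero _ (by exact_mod_cast (Fact.out : p.Prime).ne_zero)

theorem padic_norm_lt_iff (x : ℚ_[p]) (n : ℤ) :
    ‖x‖ < (p : ℝ) ^ n ↔ ‖x‖ ≤ (p : ℝ) ^ (n - 1) := by
  rw [Padic.norm_le_pow_iff_norm_lt_pow_add_one, sub_add_cancel]

theorem sigma_eq : sigma p = fun x =>
    (1 + (p : ℂ)⁻¹) * ballInd p 0 x - ballInd p (-1) x - (p : ℂ)⁻¹ * ballInd p 1 x := by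
  have hp1 := one_lt_prime_cast (p := p)
  ext x
  have h0 := padic_norm_lt_iff x 0
  have h1 := padic_norm_lt_iff x 1
  simp only [zpow_zero, zpow_one, sub_self, zero_sub] at h0 h1
  have a0 : ballInd p 0 x = if ‖x‖ ≤ 1 then 1 else 0 := by
    simp [ballInd_apply]
  have a1 : ballInd p 1 x = if ‖x‖ ≤ p then 1 else 0 := by
    simp [ballInd_apply]
  have a2 : ballInd p (-1) x = if ‖x‖ < 1 then 1 else 0 := by
    simp only [ballInd_apply, h0]
  have b0 : ({x : ℚ_[p] | ‖x‖ = 1}).indicator (1 : ℚ_[p] → ℂ) x = if ‖x‖ = 1 then 1 else 0 := by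
    simp [Set.indicator_apply]
  have b1 : ({x : ℚ_[p] | ‖x‖ = p}).indicator (1 : ℚ_[p] → ℂ) x = if ‖x‖ = p then 1 else 0 := by
    simp [Set.indicator_apply]
  rw [sigma, a0, a1, a2, b0, b1]
  rcases lt_trichotomy ‖x‖ 1 with h | h | h
  · rw [if_neg h.ne, if_neg (h.trans hp1).ne, if_pos h.le, if_pos h, if_pos (h.trans hp1).le]
    ring
  · rw [if_pos h, if_neg (by rw [h]; exact hp1.ne), if_pos h.le, if_neg (by rw [h]; simp),
      if_pos (by rw [h]; exact hp1.le)]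
    ring
  · have h' : ¬ ‖x‖ < p := fun hh => absurd (h1.mp hh) (not_le.mpr h)
    rw [if_neg h.ne', if_neg (not_le.mpr h), if_neg (not_lt.mpr h.le)]
    by_cases hx : ‖x‖ = p
    · rw [if_pos hx, if_pos hx.le]
      ring
    · rw [if_neg hx, if_neg fun hle => hx (le_antisymm hle (not_lt.mp h'))]
      ring

theorem integrable_char_mul {φ : ℚ_[p] → ℂ} (hφ : Integrable φ (padicHaar p)) (y : ℚ_[p]) :
    Integrable (fun x => (padicChar p (-(x * y)) : ℂ) * φ x) (padicHaar p) := by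
  refine hφ.bdd_mul (c := 1) ?_ ?_
  · exact (continuous_subtype_val.comp (continuous_padicChar.comp
      (by fun_prop))).aestronglyMeasurable
  · exact Filter.Eventually.of_forall fun y => (Circle.norm_coe _).le

/-- The function `σ_p` is its own Fourier transform: the transform exchanges `1_{pℤ_p}` and
`p⁻¹ 1_{p⁻¹ℤ_p}`, and fixes `1_{ℤ_p}`. -/
theorem padicFourier_sigma : padicFourier p (sigma p) = sigma p := by
  have hp0 : (p : ℂ) ≠ 0 := by exact_mod_cast (Fact.out : p.Prime).ne_zero
  have hF : ∀ n : ℤ, ∀ y, ∫ x, (padicChar p (-(x * y)) : ℂ) * ballInd p n x ∂padicHaar p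
      = (p : ℂ) ^ n * ballInd p (-n) y := fun n y => congrFun (padicFourier_ballInd n) y
  have hi := fun n y => integrable_char_mul (integrable_ballInd (p := p) n) y
  ext y
  rw [padicFourier_apply]
  simp only [sigma_eq]
  have e : ∀ x, (padicChar p (-(x * y)) : ℂ) * ((1 + (p : ℂ)⁻¹) * ballInd p 0 x
        - ballInd p (-1) x - (p : ℂ)⁻¹ * ballInd p 1 x)
      = (1 + (p : ℂ)⁻¹) * ((padicChar p (-(x * y)) : ℂ) * ballInd p 0 x)
        - (padicChar p (-(x * y)) : ℂ) * ballInd p (-1) x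
        - (p : ℂ)⁻¹ * ((padicChar p (-(x * y)) : ℂ) * ballInd p 1 x) := by
    intro x; ring
  simp only [e]
  rw [integral_sub, integral_sub, integral_const_mul, integral_const_mul, hF, hF, hF]
  · simp only [neg_zero, neg_neg, zpow_zero, zpow_one, zpow_neg_one]
    field_simp
    ring
  · exact (hi 0 y).const_mul _
  · exact hi (-1) y
  · exact ((hi 0 y).const_mul _).sub (hi (-1) y)
  · exact (hi 1 y).const_mul _

theorem hasLevel_sigma : HasLevel 1 (sigma p) := by
  have hp1 := one_lt_prime_cast (p := p)
  rw [sigma_eq]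
  have hp0 := prime_cast_pos (p := p)
  constructor
  · intro x hx
    rw [pow_one] at hx
    have h1 : ∀ n : ℤ, n ≤ 1 → ballInd p n x = 0 := by
      intro n hn
      apply ballInd_of_notMem
      rw [not_le]
      refine lt_of_le_of_lt ?_ hx
      simpa using zpow_le_zpow_right₀ hp1.le hn
    simp [h1]
  · intro x z hz
    have h1 : ∀ n : ℤ, -1 ≤ n → ballInd p n (x + z) = ballInd p n x := fun n hn =>
      ballInd_add n (hz.trans (zpow_le_zpow_right₀ hp1.le (by simpa using hn)))
    rw [h1 0 (by norm_num), h1 (-1) le_rfl, h1 1 (by norm_num)]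

end LocalFourier

/-! ### The group `Γ` -/

section Group

variable {S : Finset Nat.Primes}

theorem gam_smul_fst (q : Gam S) (x : Adele S) (p : S) :
    (q • x).1 p = (((q : ℚˣ) : ℚ) : ℚ_[((p : Nat.Primes) : ℕ)]) * x.1 p :=
  Rat.smul_def ((q : ℚˣ) : ℚ) (x.1 p)

theorem gam_smul_snd (q : Gam S) (x : Adele S) : (q • x).2 = (((q : ℚˣ) : ℚ) : ℝ) * x.2 :=
  Rat.smul_def ((q : ℚˣ) : ℚ) x.2

theorem gam_ne_zero (q : Gam S) : ((q : ℚˣ) : ℚ) ≠ 0 := (q : ℚˣ).ne_zero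

/-- A positive element of `Γ` whose local norms are all `1` is `1`, by the product formula. -/
theorem gam_eq_one {q : Gam S} (h : ∀ p : S, ‖(((q : ℚˣ) : ℚ) : ℚ_[((p : Nat.Primes) : ℕ)])‖ = 1)
    (hq : 0 < ((q : ℚˣ) : ℚ)) : q = 1 := by
  have hf := prod_norm_mul_abs S q
  rw [Finset.prod_congr rfl fun p _ => h p, Finset.prod_const_one, one_mul, abs_of_pos] at hf
  · refine Subtype.ext (Units.ext ?_)
    exact Rat.cast_injective (α := ℝ) (hf.trans Rat.cast_one.symm)
  · exact_mod_cast hq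

theorem padic_norm_prime_of_ne {p l : Nat.Primes} (h : p ≠ l) :
    ‖((p : ℕ) : ℚ_[(l : ℕ)])‖ = 1 :=
  Padic.norm_natCast_eq_one_iff.mpr
    ((Nat.coprime_primes l.2 p.2).mpr fun e => h (Subtype.ext e.symm))

/-- The element `∏ p, p ^ n p` of `Γ`. -/
def gamOf (n : S → ℤ) : Gam S :=
  ⟨∏ p : S, (Units.mk0 (((p : Nat.Primes) : ℕ) : ℚ) (by exact_mod_cast p.1.2.ne_zero)) ^ n p, by
    intro l hl
    simp only [Units.coe_prod, Units.val_zpow_eq_zpow_val, Units.val_mk0, Rat.cast_prod,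
      Rat.cast_zpow, Rat.cast_natCast, norm_prod, norm_zpow]
    refine Finset.prod_eq_one fun p _ => ?_
    have hne : l ≠ (p : Nat.Primes) := fun h => hl (h ▸ p.2)
    rw [padic_norm_prime_of_ne hne.symm, one_zpow]⟩

theorem coe_gamOf (n : S → ℤ) :
    (((gamOf n : Gam S) : ℚˣ) : ℚ) = ∏ p : S, (((p : Nat.Primes) : ℕ) : ℚ) ^ n p := by
  simp [gamOf, Units.coe_prod]

theorem gamOf_pos (n : S → ℤ) : 0 < (((gamOf n : Gam S) : ℚˣ) : ℚ) := by
  rw [coe_gamOf]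
  exact Finset.prod_pos fun p _ => zpow_pos (by exact_mod_cast p.1.2.pos) _

theorem norm_gamOf (n : S → ℤ) (l : S) :
    ‖((((gamOf n : Gam S) : ℚˣ) : ℚ) : ℚ_[((l : Nat.Primes) : ℕ)])‖
      = (((l : Nat.Primes) : ℕ) : ℝ) ^ (-n l) := by
  rw [coe_gamOf]
  simp only [Rat.cast_prod, Rat.cast_zpow, Rat.cast_natCast, norm_prod, norm_zpow]
  rw [Finset.prod_eq_single l]
  · rw [Padic.norm_p, inv_zpow, zpow_neg]
  · intro p _ hne
    rw [padic_norm_prime_of_ne fun h => hne (Subtype.ext h), one_zpow]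
  · simp

/-- The element `-1` of `Γ`. -/
def gamNeg : Gam S := ⟨-1, fun p _ => by simp⟩

/-- The sign `-1` for `true` and `1` for `false`, as an element of `Γ`. -/
def gamSign (b : Bool) : Gam S := if b then gamNeg else 1

theorem coe_gamSign (b : Bool) :
    (((gamSign b : Gam S) : ℚˣ) : ℚ) = if b then -1 else 1 := by
  cases b <;> rfl

theorem norm_gamSign (b : Bool) (l : S) :
    ‖((((gamSign b : Gam S) : ℚˣ) : ℚ) : ℚ_[((l : Nat.Primes) : ℕ)])‖ = 1 := by
  rw [coe_gamSign]; cases b <;> simp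

theorem norm_gamSign_mul_gamOf (b : Bool) (n : S → ℤ) (l : S) :
    ‖((((gamSign b * gamOf n : Gam S) : ℚˣ) : ℚ) : ℚ_[((l : Nat.Primes) : ℕ)])‖
      = (((l : Nat.Primes) : ℕ) : ℝ) ^ (-n l) := by
  rw [Subgroup.coe_mul, Units.val_mul, Rat.cast_mul, norm_mul, norm_gamSign, one_mul, norm_gamOf]

theorem gamSign_mul_gamOf_bijective :
    Function.Bijective fun x : Bool × (S → ℤ) => (gamSign x.1 * gamOf x.2 : Gam S) := by
  constructor
  · rintro ⟨b, n⟩ ⟨c, m⟩ h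
    simp only at h
    have hn : n = m := by
      ext l
      have h1 := norm_gamSign_mul_gamOf b n l
      rw [h, norm_gamSign_mul_gamOf] at h1
      have := zpow_right_injective₀ (one_lt_prime_cast (p := ((l : Nat.Primes) : ℕ)) |>.trans'
        one_pos) (one_lt_prime_cast (p := ((l : Nat.Primes) : ℕ))).ne' h1
      omega
    subst hn
    have hs := mul_right_cancel h
    have h3 : (if b then (-1 : ℚ) else 1) = if c then -1 else 1 := by
      rw [← coe_gamSign (S := S), ← coe_gamSign (S := S), hs]
    have : b = c := by
      cases b <;> cases c <;> norm_num at h3 <;> rfl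
    rw [this]
  · intro q
    have hv : ∀ l : S, ∃ k : ℤ, ‖(((q : ℚˣ) : ℚ) : ℚ_[((l : Nat.Primes) : ℕ)])‖
        = (((l : Nat.Primes) : ℕ) : ℝ) ^ (-k) := by
      intro l
      obtain ⟨k, hk⟩ := Padic.padicNormE.image (p := ((l : Nat.Primes) : ℕ))
        (q := (((q : ℚˣ) : ℚ) : ℚ_[((l : Nat.Primes) : ℕ)])) (by exact_mod_cast gam_ne_zero q)
      exact ⟨k, by rw [hk]; push_cast; rfl⟩
    choose n hn using hv
    set b : Bool := decide (((q : ℚˣ) : ℚ) < 0) with hb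
    have key : (gamSign b * gamOf n)⁻¹ * q = 1 := by
      apply gam_eq_one
      · intro l
        rw [Subgroup.coe_mul, Units.val_mul, Rat.cast_mul, norm_mul, hn, Subgroup.coe_inv,
          Units.val_inv_eq_inv_val, Rat.cast_inv, norm_inv, norm_gamSign_mul_gamOf]
        exact inv_mul_cancel₀ (zpow_ne_zero _ prime_cast_pos.ne')
      · rw [Subgroup.coe_mul, Units.val_mul, Subgroup.coe_inv, Units.val_inv_eq_inv_val,
          Subgroup.coe_mul, Units.val_mul, coe_gamSign]
        have hg := gamOf_pos n
        rcases lt_or_gt_of_ne (gam_ne_zero q) with h | h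
        · have : b = true := by simpa [hb] using h
          rw [this, if_pos rfl, neg_one_mul, inv_neg, neg_mul, neg_pos]
          exact mul_neg_of_pos_of_neg (inv_pos.mpr hg) h
        · have : b = false := by simpa [hb] using h.le
          rw [this, if_neg (by simp), one_mul]
          positivity
    exact ⟨(b, n), (inv_mul_eq_one.mp key)⟩

/-- `Γ` is the product of `{± 1}` and a free abelian group on `S`. -/
def gamEquiv (S : Finset Nat.Primes) : Bool × (S → ℤ) ≃ Gam S :=
  Equiv.ofBijective _ gamSign_mul_gamOf_bijective

theorem gamEquiv_apply (b : Bool) (n : S → ℤ) : gamEquiv S (b, n) = gamSign b * gamOf n := rfl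

instance : Countable (Gam S) := (gamEquiv S).symm.injective.countable

end Group

/-! ### Invariance of the measure and the fundamental domain -/

section Domain

variable {S : Finset Nat.Primes}

instance : SigmaFinite (adeleHaar S) := by unfold adeleHaar; infer_instance

theorem pi_smul_measure {ι : Type*} [Fintype ι] {α : ι → Type*} [∀ i, MeasurableSpace (α i)]
    (μ : ∀ i, Measure (α i)) [∀ i, SigmaFinite (μ i)] (c : ι → ENNReal)
    [∀ i, SigmaFinite (c i • μ i)] :
    Measure.pi (fun i => c i • μ i) = (∏ i, c i) • Measure.pi μ := by
  refine Measure.pi_eq fun s _ => ?_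
  simp only [Measure.smul_apply, smul_eq_mul, Measure.pi_pi, Finset.prod_mul_distrib]

/-- Multiplication by an element with invertible components scales the Haar measure of `𝔸_S` by
the inverse of its module. -/
theorem adeleHaar_map_mul {a : Adele S} (h1 : ∀ p, a.1 p ≠ 0) (h2 : a.2 ≠ 0) :
    (adeleHaar S).map (fun x => a * x) = ENNReal.ofReal (adeleModule S a)⁻¹ • adeleHaar S := by
  have e : (fun x : Adele S => a * x) = Prod.map (fun x p => a.1 p * x p) (fun t => a.2 * t) := rfl
  have hsf : ∀ p : S, SigmaFinite (ENNReal.ofReal ‖a.1 p‖⁻¹ •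
      padicHaar ((p : Nat.Primes) : ℕ)) := fun p => by
    rw [← padicHaar_map_mul (h1 p)]
    exact (Homeomorph.mulLeft₀ _ (h1 p)).toMeasurableEquiv.sigmaFinite_map
  have hsf' : ∀ p : S, SigmaFinite ((padicHaar ((p : Nat.Primes) : ℕ)).map
      fun x => a.1 p * x) := fun p => by
    rw [padicHaar_map_mul (h1 p)]
    exact hsf p
  have hpi : (Measure.pi fun p : S => padicHaar ((p : Nat.Primes) : ℕ)).map
      (fun x p => a.1 p * x p)
      = (∏ p : S, ENNReal.ofReal ‖a.1 p‖⁻¹) •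
        Measure.pi fun p : S => padicHaar ((p : Nat.Primes) : ℕ) := by
    rw [Measure.pi_map_pi (hμ := hsf') fun p : S => (measurable_padic_mul (a.1 p)).aemeasurable]
    simp only [fun p => padicHaar_map_mul (h1 p)]
    exact pi_smul_measure _ _
  rw [e, adeleHaar, ← Measure.map_prod_map, hpi, Real.map_volume_mul_left h2,
    Measure.prod_smul_left, Measure.prod_smul_right, smul_smul]
  · congr 1
    rw [adeleModule, mul_inv, ENNReal.ofReal_mul (by positivity), ← abs_inv,
      ← Finset.prod_inv_distrib, ENNReal.ofReal_prod_of_nonneg fun _ _ => by positivity]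
  · exact measurable_pi_lambda _ fun p =>
      (measurable_padic_mul (a.1 p)).comp (measurable_pi_apply p)
  · exact measurable_const_mul a.2

/-- The diagonal embedding of `Γ` into the adeles. -/
def gamAdele (q : Gam S) : Adele S := q • (1 : Adele S)

theorem gam_smul_eq_mul (q : Gam S) (x : Adele S) : q • x = gamAdele q * x := by
  change ((q : ℚˣ) : ℚ) • x = (((q : ℚˣ) : ℚ) • (1 : Adele S)) * x
  rw [smul_one_mul]

theorem gamAdele_fst (q : Gam S) (p : S) :
    (gamAdele q).1 p = (((q : ℚˣ) : ℚ) : ℚ_[((p : Nat.Primes) : ℕ)]) := by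
  rw [gamAdele, gam_smul_fst]; simp

theorem gamAdele_snd (q : Gam S) : (gamAdele q).2 = (((q : ℚˣ) : ℚ) : ℝ) := by
  rw [gamAdele, gam_smul_snd]; simp

instance : MeasurableConstSMul (Gam S) (Adele S) where
  measurable_const_smul q := by
    have : (fun x : Adele S => q • x) = fun x => gamAdele q * x := funext (gam_smul_eq_mul q)
    rw [show ((q • ·) : Adele S → Adele S) = fun x => gamAdele q * x from this]
    exact (continuous_const_mul (gamAdele q)).measurable

theorem adeleHaar_map_smul (q : Gam S) : (adeleHaar S).map (fun x => q • x) = adeleHaar S := by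
  simp only [gam_smul_eq_mul]
  rw [adeleHaar_map_mul]
  · rw [gamAdele, adeleModule_smul]
    simp [adeleModule]
  · intro p
    rw [gamAdele_fst]
    exact_mod_cast gam_ne_zero q
  · rw [gamAdele_snd]
    exact_mod_cast gam_ne_zero q

instance : SMulInvariantMeasure (Gam S) (Adele S) (adeleHaar S) where
  measure_preimage_smul q s hs := by
    conv_rhs => rw [← adeleHaar_map_smul q]
    rw [Measure.map_apply (measurable_const_smul q) hs]

theorem measurableSet_fundDomain : MeasurableSet (fundDomain S) := by
  have : fundDomain S = (⋂ p : S, {x : Adele S | ‖x.1 p‖ = 1}) ∩ {x | 0 < x.2} := by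
    ext x
    simp [fundDomain]
  rw [this]
  refine MeasurableSet.inter (MeasurableSet.iInter fun p => ?_) ?_
  · exact ((isClosed_singleton (x := (1 : ℝ))).preimage
      (f := fun x : Adele S => ‖x.1 p‖) (by fun_prop)).measurableSet
  · exact (isOpen_lt continuous_const continuous_snd).measurableSet

theorem exists_smul_mem_fundDomain {x : Adele S} (h1 : ∀ p, x.1 p ≠ 0) (h2 : x.2 ≠ 0) :
    ∃ q : Gam S, q • x ∈ fundDomain S := by
  have hv : ∀ l : S, ∃ k : ℤ, ‖x.1 l‖ = (((l : Nat.Primes) : ℕ) : ℝ) ^ k := by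
    intro l
    obtain ⟨k, hk⟩ := Padic.padicNormE.image (h1 l)
    exact ⟨-k, by rw [hk]; push_cast; rfl⟩
  choose n hn using hv
  refine ⟨gamSign (decide (x.2 < 0)) * gamOf n, fun l => ?_, ?_⟩
  · rw [gam_smul_fst, norm_mul, norm_gamSign_mul_gamOf, hn,
      ← zpow_add₀ prime_cast_pos.ne', neg_add_cancel, zpow_zero]
  · rw [gam_smul_snd, Subgroup.coe_mul, Units.val_mul, coe_gamSign]
    have hg : (0 : ℝ) < (((gamOf n : Gam S) : ℚˣ) : ℚ) := by exact_mod_cast gamOf_pos n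
    rcases lt_or_gt_of_ne h2 with h | h
    · rw [decide_eq_true h, if_pos rfl]
      push_cast
      nlinarith
    · rw [decide_eq_false (not_lt.mpr h.le), if_neg (by simp)]
      push_cast
      nlinarith

theorem eq_one_of_smul_mem_fundDomain {x : Adele S} {q : Gam S} (hx : x ∈ fundDomain S)
    (hq : q • x ∈ fundDomain S) : q = 1 := by
  apply gam_eq_one
  · intro p
    have := hq.1 p
    rwa [gam_smul_fst, norm_mul, hx.1 p, mul_one] at this
  · have := hq.2
    rw [gam_smul_snd] at this
    exact_mod_cast pos_of_mul_pos_left this hx.2.le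

/-- Almost every element of `𝔸_S` is invertible. -/
theorem ae_adele_ne_zero : ∀ᵐ x ∂adeleHaar S, (∀ p, x.1 p ≠ 0) ∧ x.2 ≠ 0 := by
  have h1 : ∀ᵐ x ∂Measure.pi fun p : S => padicHaar ((p : Nat.Primes) : ℕ), ∀ p, x p ≠ 0 := by
    rw [ae_all_iff]
    intro p
    have : ∀ᵐ t ∂padicHaar ((p : Nat.Primes) : ℕ), t ≠ 0 := by
      simp [ae_iff]
    exact (Measure.quasiMeasurePreserving_eval
      (fun p : S => padicHaar ((p : Nat.Primes) : ℕ)) p).ae this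
  have h2 : ∀ᵐ t : ℝ, t ≠ 0 := by simp [ae_iff]
  rw [adeleHaar]
  exact (Measure.quasiMeasurePreserving_fst.ae h1).and (Measure.quasiMeasurePreserving_snd.ae h2)

theorem isFundamentalDomain_fundDomain :
    IsFundamentalDomain (Gam S) (fundDomain S) (adeleHaar S) := by
  refine IsFundamentalDomain.mk'' measurableSet_fundDomain.nullMeasurableSet ?_ ?_ ?_
  · filter_upwards [ae_adele_ne_zero] with x hx using exists_smul_mem_fundDomain hx.1 hx.2
  · intro g hg
    refine Disjoint.aedisjoint (Set.disjoint_left.mpr fun x hx hx' => hg ?_)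
    obtain ⟨y, hy, rfl⟩ := hx
    exact eq_one_of_smul_mem_fundDomain hy hx'
  · exact fun g => (measurePreserving_smul g _).quasiMeasurePreserving

/-! ### The class space and the fundamental domain -/

/-- The restriction of the Haar measure to the fundamental domain. -/
def domainMeasure (S : Finset Nat.Primes) : Measure (Adele S) :=
  (adeleHaar S).restrict (fundDomain S)

theorem ae_mem_fundDomain : ∀ᵐ x ∂domainMeasure S, x ∈ fundDomain S :=
  ae_restrict_mem measurableSet_fundDomain

theorem measurable_proj : Measurable (proj S) := measurable_quotient_mk''

theorem measurePreserving_proj : MeasurePreserving (proj S) (domainMeasure S) (classMeasure S) :=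
  ⟨measurable_proj, rfl⟩

theorem proj_eq_proj_iff {x y : Adele S} : proj S x = proj S y ↔ ∃ q : Gam S, q • y = x := by
  rw [proj, proj, Quotient.eq, MulAction.orbitRel_apply, MulAction.mem_orbit_iff]

open Classical in
/-- The representative in the fundamental domain of a class, with value `0` at the classes that do
not have one. -/
def rep (S : Finset Nat.Primes) (ξ : AdeleClass S) : Adele S :=
  if h : ∃ x ∈ fundDomain S, proj S x = ξ then h.choose else 0

theorem rep_proj {x : Adele S} (hx : x ∈ fundDomain S) : rep S (proj S x) = x := by
  have h : ∃ y ∈ fundDomain S, proj S y = proj S x := ⟨x, hx, rfl⟩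
  rw [rep, dif_pos h]
  obtain ⟨h1, h2⟩ := h.choose_spec
  obtain ⟨q, hq⟩ := proj_eq_proj_iff.mp h2
  have hq1 := eq_one_of_smul_mem_fundDomain (q := q) hx (by rw [hq]; exact h1)
  rw [← hq, hq1, one_smul]

theorem measurable_class_iff {β : Type*} [MeasurableSpace β] {f : AdeleClass S → β} :
    Measurable f ↔ Measurable fun x => f (proj S x) :=
  ⟨fun h => h.comp measurable_proj, fun h => measurable_from_quotient.mpr h⟩

theorem mem_fundDomain_image_iff (x : Adele S) :
    (∃ y ∈ fundDomain S, proj S y = proj S x) ↔ ∃ q : Gam S, q • x ∈ fundDomain S := by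
  constructor
  · rintro ⟨y, hy, h⟩
    obtain ⟨q, rfl⟩ := proj_eq_proj_iff.mp h
    exact ⟨q, hy⟩
  · rintro ⟨q, hq⟩
    exact ⟨_, hq, proj_eq_proj_iff.mpr ⟨q, rfl⟩⟩

theorem measurable_rep : Measurable (rep S) := by
  rw [measurable_class_iff]
  intro B hB
  have : (fun x => rep S (proj S x)) ⁻¹' B =
      (⋃ q : Gam S, (fun x => q • x) ⁻¹' (fundDomain S ∩ B)) ∪
        ((⋃ q : Gam S, (fun x => q • x) ⁻¹' fundDomain S)ᶜ ∩ {_x | (0 : Adele S) ∈ B}) := by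
    ext x
    simp only [Set.mem_preimage, Set.mem_union, Set.mem_iUnion, Set.mem_inter_iff,
      Set.mem_compl_iff, Set.mem_ofPred_eq]
    by_cases h : ∃ q : Gam S, q • x ∈ fundDomain S
    · obtain ⟨q, hq⟩ := h
      have hr : rep S (proj S x) = q • x := by
        rw [← rep_proj hq]
        congr 1
        exact proj_eq_proj_iff.mpr ⟨q⁻¹, inv_smul_smul q x⟩
      rw [hr]
      constructor
      · exact fun hB => Or.inl ⟨q, hq, hB⟩
      · rintro (⟨q', hq', hB'⟩ | ⟨h, -⟩)
        · have : q' * q⁻¹ = 1 := eq_one_of_smul_mem_fundDomain hq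
            (by rwa [smul_smul, inv_mul_cancel_right])
          rwa [← mul_inv_eq_one.mp this]
        · exact absurd ⟨q, hq⟩ h
    · have hr : rep S (proj S x) = 0 := by
        rw [rep, dif_neg]
        rwa [mem_fundDomain_image_iff]
      rw [hr]
      constructor
      · exact fun hB => Or.inr ⟨h, hB⟩
      · rintro (⟨q, hq, -⟩ | ⟨-, hB⟩)
        · exact absurd ⟨q, hq⟩ h
        · exact hB
  rw [this]
  refine (MeasurableSet.iUnion fun q => ?_).union (MeasurableSet.inter ?_ (.const _))
  · exact measurable_const_smul q (measurableSet_fundDomain.inter hB)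
  · exact (MeasurableSet.iUnion fun q => measurable_const_smul q measurableSet_fundDomain).compl

/-- Together with `measurePreserving_proj`, this identifies `X_S` with the fundamental domain as a
measure space. -/
theorem measurePreserving_rep : MeasurePreserving (rep S) (classMeasure S) (domainMeasure S) := by
  refine ⟨measurable_rep, ?_⟩
  rw [← measurePreserving_proj.map_eq, Measure.map_map measurable_rep measurable_proj]
  conv_rhs => rw [← Measure.map_id (μ := domainMeasure S)]
  refine Measure.map_congr ?_
  filter_upwards [ae_mem_fundDomain] with x hx using rep_proj hx

theorem ae_proj_rep : ∀ᵐ ξ ∂classMeasure S, proj S (rep S ξ) = ξ := by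
  have hm : MeasurableSet {ξ : AdeleClass S | ∃ y ∈ fundDomain S, proj S y = ξ} := by
    refine measurableSet_quotient.mpr ?_
    change MeasurableSet {x | ∃ y ∈ fundDomain S, proj S y = proj S x}
    simp only [mem_fundDomain_image_iff]
    have : {x : Adele S | ∃ q : Gam S, q • x ∈ fundDomain S}
        = ⋃ q : Gam S, (fun x => q • x) ⁻¹' fundDomain S := by
      ext x; simp
    rw [this]
    exact MeasurableSet.iUnion fun q => measurable_const_smul q measurableSet_fundDomain
  have h : ∀ᵐ ξ ∂classMeasure S, ∃ y ∈ fundDomain S, proj S y = ξ := by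
    rw [← measurePreserving_proj.map_eq, ae_map_iff measurable_proj.aemeasurable hm]
    filter_upwards [ae_mem_fundDomain] with x hx using ⟨x, hx, rfl⟩
  filter_upwards [h] with ξ hξ
  obtain ⟨y, hy, rfl⟩ := hξ
  rw [rep_proj hy]

/-- A property holds almost everywhere on `X_S` when it does on the fundamental domain, without
measurability assumptions. -/
theorem ae_class_iff {P : AdeleClass S → Prop} :
    (∀ᵐ ξ ∂classMeasure S, P ξ) ↔ ∀ᵐ x ∂domainMeasure S, P (proj S x) := by
  refine ⟨fun h => measurePreserving_proj.quasiMeasurePreserving.ae h, fun h => ?_⟩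
  filter_upwards [measurePreserving_rep.quasiMeasurePreserving.ae h, ae_proj_rep] with ξ h1 h2
  rwa [h2] at h1

theorem memLp_class_iff {f : AdeleClass S → ℂ} {r : ENNReal} :
    MemLp f r (classMeasure S) ↔ MemLp (fun x => f (proj S x)) r (domainMeasure S) := by
  refine ⟨fun h => h.comp_measurePreserving measurePreserving_proj, fun h => ?_⟩
  refine (h.comp_measurePreserving measurePreserving_rep).ae_eq ?_
  filter_upwards [ae_proj_rep] with ξ hξ
  simp only [Function.comp_apply, hξ]

end Domain

/-! ### Fourier transform of Schwartz–Bruhat functions -/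

section SchwartzBruhat

variable {S : Finset Nat.Primes}

theorem continuous_adeleChar : Continuous (adeleChar S) := by
  change Continuous fun x : Adele S =>
    (∏ p : S, padicChar ((p : Nat.Primes) : ℕ) (x.1 p)) * Real.fourierChar x.2
  refine Continuous.mul (continuous_finsetProd _ fun p _ => ?_) ?_
  · exact continuous_padicChar.comp ((continuous_apply p).comp continuous_fst)
  · exact Real.continuous_fourierChar.comp continuous_snd

theorem adeleFourier_apply (h : Adele S → ℂ) (y : Adele S) :
    adeleFourier S h y = ∫ x, (adeleChar S (-(x * y)) : ℂ) * h x ∂adeleHaar S := rfl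

theorem continuous_prod_mul {φ : (p : S) → ℚ_[((p : Nat.Primes) : ℕ)] → ℂ} {f : SchwartzMap ℝ ℂ}
    (hφ : ∀ p, IsLocallyConstant (φ p)) :
    Continuous fun x : Adele S => (∏ p, φ p (x.1 p)) * f x.2 := by
  refine Continuous.mul (continuous_finsetProd _ fun p _ => ?_) (f.continuous.comp continuous_snd)
  exact (hφ p).continuous.comp ((continuous_apply p).comp continuous_fst)

theorem integrable_prod_mul {φ : (p : S) → ℚ_[((p : Nat.Primes) : ℕ)] → ℂ} {f : ℝ → ℂ}
    (hφ : ∀ p, Integrable (φ p) (padicHaar ((p : Nat.Primes) : ℕ))) (hf : Integrable f) :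
    Integrable (fun x : Adele S => (∏ p, φ p (x.1 p)) * f x.2) (adeleHaar S) := by
  have := Integrable.fintype_prod_dep
    (μ := fun p : S => padicHaar ((p : Nat.Primes) : ℕ)) (f := φ) hφ
  exact this.mul_prod hf

theorem integral_prod_mul_eq (φ : (p : S) → ℚ_[((p : Nat.Primes) : ℕ)] → ℂ) (f : ℝ → ℂ) :
    ∫ x : Adele S, (∏ p, φ p (x.1 p)) * f x.2 ∂adeleHaar S
      = (∏ p : S, ∫ t, φ p t ∂padicHaar ((p : Nat.Primes) : ℕ)) * ∫ t, f t := by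
  rw [adeleHaar, integral_prod_mul (fun u : (p : S) → ℚ_[((p : Nat.Primes) : ℕ)] =>
    ∏ p, φ p (u p)) f, integral_fintype_prod_eq_prod]

theorem adeleFourier_prod_mul (φ : (p : S) → ℚ_[((p : Nat.Primes) : ℕ)] → ℂ)
    (f : SchwartzMap ℝ ℂ) :
    adeleFourier S (fun x => (∏ p, φ p (x.1 p)) * f x.2)
      = fun y => (∏ p : S, padicFourier ((p : Nat.Primes) : ℕ) (φ p) (y.1 p)) * (𝓕 f) y.2 := by
  ext y
  have h := integral_prod_mul_eq
    (fun (p : S) t => (padicChar ((p : Nat.Primes) : ℕ) (-(t * y.1 p)) : ℂ) * φ p t)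
    (fun t => (Real.fourierChar (-(t * y.2)) : ℂ) * f t)
  rw [adeleFourier_apply, SchwartzMap.fourier_coe, Real.fourier_real_eq]
  refine Eq.trans ?_ h
  congr 1
  ext x
  change (((∏ p : S, padicChar ((p : Nat.Primes) : ℕ) (-(x.1 p * y.1 p))) *
    Real.fourierChar (-(x.2 * y.2)) : Circle) : ℂ) * _ = _
  rw [Finset.prod_mul_distrib, Circle.coe_mul]
  have : ((∏ p : S, padicChar ((p : Nat.Primes) : ℕ) (-(x.1 p * y.1 p)) : Circle) : ℂ)
      = ∏ p : S, (padicChar ((p : Nat.Primes) : ℕ) (-(x.1 p * y.1 p)) : ℂ) :=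
    map_prod Circle.coeHom _ _
  rw [this]
  ring

/-- Induction on Schwartz–Bruhat functions: products of functions of one coordinate, sums, scalar
multiples. -/
theorem schwartzBruhat_induction {P : (Adele S → ℂ) → Prop}
    (gen : ∀ (φ : (p : S) → ℚ_[((p : Nat.Primes) : ℕ)] → ℂ) (f : SchwartzMap ℝ ℂ),
      (∀ p, IsLocallyConstant (φ p)) → (∀ p, HasCompactSupport (φ p)) →
      P fun x => (∏ p, φ p (x.1 p)) * f x.2)
    (zero : P 0) (add : ∀ h ∈ schwartzBruhat S, ∀ k ∈ schwartzBruhat S, P h → P k → P (h + k))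
    (smul : ∀ (c : ℂ), ∀ h ∈ schwartzBruhat S, P h → P (c • h))
    {h : Adele S → ℂ} (hh : h ∈ schwartzBruhat S) : P h := by
  refine Submodule.span_induction (p := fun h _ => P h) ?_ zero (fun h k hh hk => add h hh k hk)
    (fun c h hh => smul c h hh) hh
  rintro _ ⟨φ, f, hφ, rfl⟩
  exact gen φ f (fun p => (hφ p).1) fun p => (hφ p).2

theorem prod_mul_mem_schwartzBruhat {φ : (p : S) → ℚ_[((p : Nat.Primes) : ℕ)] → ℂ}
    (f : SchwartzMap ℝ ℂ) (h1 : ∀ p, IsLocallyConstant (φ p)) (h2 : ∀ p, HasCompactSupport (φ p)) :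
    (fun x : Adele S => (∏ p, φ p (x.1 p)) * f x.2) ∈ schwartzBruhat S :=
  Submodule.subset_span ⟨φ, f, fun p => ⟨h1 p, h2 p⟩, rfl⟩

theorem continuous_of_mem {h : Adele S → ℂ} (hh : h ∈ schwartzBruhat S) : Continuous h := by
  refine schwartzBruhat_induction (P := Continuous) (fun φ f h1 _ => continuous_prod_mul h1)
    continuous_zero (fun _ _ _ _ => Continuous.add) (fun c _ _ hc => hc.const_smul c) hh

theorem integrable_of_mem {h : Adele S → ℂ} (hh : h ∈ schwartzBruhat S) :
    Integrable h (adeleHaar S) := by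
  refine schwartzBruhat_induction (P := fun h => Integrable h (adeleHaar S)) (fun φ f h1 h2 => ?_)
    (integrable_zero _ _ _) (fun _ _ _ _ => Integrable.add) (fun c _ _ hc => hc.smul c) hh
  exact integrable_prod_mul (fun p => integrable_of_compactSupport (h1 p) (h2 p)) f.integrable

theorem adeleFourier_add {h k : Adele S → ℂ} (hh : Integrable h (adeleHaar S))
    (hk : Integrable k (adeleHaar S)) :
    adeleFourier S (h + k) = adeleFourier S h + adeleFourier S k :=
  VectorFourier.fourierIntegral_add (L := LinearMap.mul (Adele S) (Adele S)) continuous_adeleChar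
    (by exact continuous_mul) hh hk

theorem adeleFourier_smul (c : ℂ) (h : Adele S → ℂ) :
    adeleFourier S (c • h) = c • adeleFourier S h :=
  Fourier.fourierIntegral_const_smul _ _ _ _

theorem adeleFourier_zero : adeleFourier S 0 = 0 := by
  ext y
  rw [adeleFourier_apply]
  simp

/-- The Schwartz–Bruhat space is stable under the Fourier transform. -/
theorem adeleFourier_mem {h : Adele S → ℂ} (hh : h ∈ schwartzBruhat S) :
    adeleFourier S h ∈ schwartzBruhat S := by
  refine schwartzBruhat_induction (P := fun h => adeleFourier S h ∈ schwartzBruhat S)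
    (fun φ f h1 h2 => ?_) ?_ (fun h hh k hk h1 h2 => ?_) (fun c h _ hc => ?_) hh
  · rw [adeleFourier_prod_mul]
    choose n hn using fun p => exists_hasLevel (h1 p) (h2 p)
    exact prod_mul_mem_schwartzBruhat _ (fun p => (hn p).padicFourier.isLocallyConstant)
      fun p => (hn p).padicFourier.hasCompactSupport
  · rw [adeleFourier_zero]
    exact Submodule.zero_mem _
  · rw [adeleFourier_add (integrable_of_mem hh) (integrable_of_mem hk)]
    exact Submodule.add_mem _ h1 h2
  · rw [adeleFourier_smul]
    exact Submodule.smul_mem _ _ hc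

/-- Fourier inversion on the adeles. -/
theorem adeleFourier_adeleFourier {h : Adele S → ℂ} (hh : h ∈ schwartzBruhat S) :
    adeleFourier S (adeleFourier S h) = fun x => h (-x) := by
  refine schwartzBruhat_induction
    (P := fun h => adeleFourier S (adeleFourier S h) = fun x => h (-x))
    (fun φ f h1 h2 => ?_) ?_ (fun h hh k hk h1 h2 => ?_) (fun c h _ hc => ?_) hh
  · rw [adeleFourier_prod_mul, adeleFourier_prod_mul]
    ext x
    have hf : (𝓕 (𝓕 f) : SchwartzMap ℝ ℂ) x.2 = f (-x.2) := by
      rw [SchwartzMap.fourier_coe]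
      have h3 := Real.fourierInv_eq_fourier_neg (𝓕 f : SchwartzMap ℝ ℂ) (-x.2)
      rw [neg_neg] at h3
      rw [← h3, ← SchwartzMap.fourierInv_coe, FourierTransform.fourierInv_fourier_eq]
    rw [hf]
    choose n hn using fun p => exists_hasLevel (h1 p) (h2 p)
    simp only [fun p => (hn p).padicFourier_padicFourier (x.1 p)]
    rfl
  · rw [adeleFourier_zero, adeleFourier_zero]
    rfl
  · rw [adeleFourier_add (integrable_of_mem hh) (integrable_of_mem hk),
      adeleFourier_add (integrable_of_mem (adeleFourier_mem hh))
        (integrable_of_mem (adeleFourier_mem hk)), h1, h2]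
    rfl
  · rw [adeleFourier_smul, adeleFourier_smul, hc]
    rfl

open ComplexConjugate in
/-- Plancherel's formula on the adeles. -/
theorem integral_conj_adeleFourier_mul {g h : Adele S → ℂ} (hg : Integrable g (adeleHaar S))
    (hh : h ∈ schwartzBruhat S) :
    ∫ y, conj (adeleFourier S g y) * adeleFourier S h y ∂adeleHaar S
      = ∫ x, conj (g x) * h x ∂adeleHaar S := by
  have key := VectorFourier.integral_sesq_fourierIntegral_eq_neg_flip (μ := adeleHaar S)
    (ν := adeleHaar S) (L := LinearMap.mul (Adele S) (Adele S)) (innerSL ℂ (E := ℂ))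
    continuous_adeleChar (by exact continuous_mul) hg (integrable_of_mem (adeleFourier_mem hh))
  have e : ∀ x, VectorFourier.fourierIntegral (adeleChar S) (adeleHaar S)
      (-(LinearMap.mul (Adele S) (Adele S)).flip) (adeleFourier S h) x = h x := by
    intro x
    have := congrFun (adeleFourier_adeleFourier hh) (-x)
    rw [neg_neg] at this
    rw [← this, adeleFourier_apply, VectorFourier.fourierIntegral]
    congr 1
    ext v
    rw [LinearMap.flip_mul, LinearMap.neg_apply, LinearMap.neg_apply, LinearMap.mul_apply', mul_neg]
    rfl
  simp only [e, innerSL_apply_apply, RCLike.inner_apply'] at key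
  exact key

/-- The measure is invariant under `Γ`, so `ℱ` turns the translate by `γ` into that by `γ⁻¹`. -/
theorem adeleFourier_comp_smul (q : Gam S) (h : Adele S → ℂ) (y : Adele S) :
    adeleFourier S (fun x => h (q • x)) y = adeleFourier S h (q⁻¹ • y) := by
  rw [adeleFourier_apply, adeleFourier_apply,
    ← integral_smul_eq_self (μ := adeleHaar S) (g := q)
      (fun x => (adeleChar S (-(x * q⁻¹ • y)) : ℂ) * h x)]
  congr 1
  ext x
  have : q • x * q⁻¹ • y = x * y := by
    rw [gam_smul_eq_mul q x, gam_smul_eq_mul q⁻¹ y, mul_mul_mul_comm, ← gam_smul_eq_mul, gamAdele,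
      smul_smul, mul_inv_cancel, one_smul, one_mul]
  rw [this]

theorem integrable_comp_smul (q : Gam S) {h : Adele S → ℂ} (hh : Integrable h (adeleHaar S)) :
    Integrable (fun x => h (q • x)) (adeleHaar S) :=
  (measurePreserving_smul q (adeleHaar S)).integrable_comp_of_integrable hh

end SchwartzBruhat

/-! ### Summation over `Γ` -/

section Summation

variable {S : Finset Nat.Primes}

/-- Schwartz–Bruhat functions are supported in a product of balls of `∏ ℚ_p` and decay like
`(1 + t²)⁻¹` in the real coordinate. -/
theorem exists_decay {h : Adele S → ℂ} (hh : h ∈ schwartzBruhat S) :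
    ∃ (C : ℝ) (N : ℕ), 0 ≤ C ∧ ∀ x, ‖h x‖ ≤ C / (1 + x.2 ^ 2) ∧
      ∀ p : S, (((p : Nat.Primes) : ℕ) : ℝ) ^ N < ‖x.1 p‖ → h x = 0 := by
  refine schwartzBruhat_induction (P := fun h => ∃ (C : ℝ) (N : ℕ), 0 ≤ C ∧
    ∀ x, ‖h x‖ ≤ C / (1 + x.2 ^ 2) ∧
      ∀ p : S, (((p : Nat.Primes) : ℕ) : ℝ) ^ N < ‖x.1 p‖ → h x = 0) ?_ ?_ ?_ ?_ hh
  · intro φ f h1 h2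
    obtain ⟨A, hA⟩ := f.decay 0 0
    obtain ⟨B, hB⟩ := f.decay 2 0
    simp only [pow_zero, one_mul, norm_iteratedFDeriv_zero, Real.norm_eq_abs, sq_abs] at hA hB
    choose M hM using fun p => (h2 p).exists_bound_of_continuous (h1 p).continuous
    choose n hn using fun p => exists_hasLevel (h1 p) (h2 p)
    have hM0 : 0 ≤ ∏ p : S, M p := Finset.prod_nonneg fun p _ => (norm_nonneg _).trans (hM p 0)
    have hAB : 0 ≤ A + B := by
      have := hA.2 0
      have := hB.2 0
      have := norm_nonneg (f 0)
      norm_num at *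
      linarith
    refine ⟨(∏ p : S, M p) * (A + B), ∑ p : S, n p, by positivity, fun x => ⟨?_, ?_⟩⟩
    · rw [norm_mul, norm_prod, mul_div_assoc]
      refine mul_le_mul (Finset.prod_le_prod (fun _ _ => norm_nonneg _) fun p _ => hM p _) ?_
        (norm_nonneg _) hM0
      rw [le_div_iff₀ (by positivity)]
      have := hA.2 x.2
      have := hB.2 x.2
      linarith
    · intro p hp
      have : φ p (x.1 p) = 0 := by
        refine (hn p).support _ (lt_of_le_of_lt ?_ hp)
        exact pow_le_pow_right₀ one_lt_prime_cast.le
          (Finset.single_le_sum (f := n) (fun _ _ => Nat.zero_le _) (Finset.mem_univ p))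
      have h0 : ∏ p, φ p (x.1 p) = 0 := Finset.prod_eq_zero (Finset.mem_univ p) this
      exact mul_eq_zero_of_left h0 _
  · exact ⟨0, 0, le_rfl, fun x => ⟨by simp, fun _ _ => rfl⟩⟩
  · rintro h - k - ⟨C, N, hC, h1⟩ ⟨D, M, hD, h2⟩
    refine ⟨C + D, max N M, by positivity, fun x => ⟨?_, fun p hp => ?_⟩⟩
    · rw [add_div]
      exact (norm_add_le _ _).trans (add_le_add (h1 x).1 (h2 x).1)
    · have hN := pow_le_pow_right₀ (one_lt_prime_cast (p := ((p : Nat.Primes) : ℕ))).le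
        (le_max_left N M)
      have hM := pow_le_pow_right₀ (one_lt_prime_cast (p := ((p : Nat.Primes) : ℕ))).le
        (le_max_right N M)
      rw [Pi.add_apply, (h1 x).2 p (hN.trans_lt hp), (h2 x).2 p (hM.trans_lt hp), add_zero]
  · rintro c h - ⟨C, N, hC, h1⟩
    refine ⟨‖c‖ * C, N, by positivity, fun x => ⟨?_, fun p hp => ?_⟩⟩
    · rw [Pi.smul_apply, norm_smul, mul_div_assoc]
      exact mul_le_mul_of_nonneg_left (h1 x).1 (norm_nonneg _)
    · rw [Pi.smul_apply, (h1 x).2 p hp, smul_zero]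

theorem summable_fintype_prod {ι κ : Type*} [Fintype ι] {g : ι → κ → ℝ}
    (h0 : ∀ i k, 0 ≤ g i k) (h : ∀ i, Summable (g i)) :
    Summable fun n : ι → κ => ∏ i, g i (n i) := by
  classical
  refine summable_of_sum_le (c := ∏ i, ∑' k, g i k) (fun n => Finset.prod_nonneg fun i _ => h0 _ _)
    fun u => ?_
  calc ∑ n ∈ u, ∏ i, g i (n i)
      ≤ ∑ n ∈ Fintype.piFinset fun i => u.image fun n => n i, ∏ i, g i (n i) := by
        refine Finset.sum_le_sum_of_subset_of_nonneg (fun n hn => ?_)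
          fun n _ _ => Finset.prod_nonneg fun i _ => h0 _ _
        exact Fintype.mem_piFinset.mpr fun i => Finset.mem_image_of_mem _ hn
    _ = ∏ i, ∑ k ∈ u.image fun n => n i, g i k := (Finset.prod_univ_sum _ _).symm
    _ ≤ _ := Finset.prod_le_prod (fun i _ => Finset.sum_nonneg fun k _ => h0 _ _)
        fun i _ => (h i).sum_le_tsum _ fun k _ => h0 _ _

theorem summable_truncated_geometric {p a : ℝ} (hp : 1 < p) (ha : 0 < a) (N : ℕ) :
    Summable fun n : ℤ => if -(N : ℤ) ≤ n then (p ^ n) ^ (-a) else 0 := by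
  have hinj : Function.Injective fun k : ℕ => (k : ℤ) - N := fun k l h => by
    simp only at h
    omega
  rw [← hinj.summable_iff]
  · have hr : p ^ (-a) < 1 := Real.rpow_lt_one_of_one_lt_of_neg hp (by linarith)
    have hp0 : 0 < p := one_pos.trans hp
    refine ((summable_geometric_of_lt_one (Real.rpow_nonneg hp0.le _) hr).mul_left
      ((p ^ (-(N : ℤ))) ^ (-a))).congr fun k => ?_
    simp only [Function.comp_apply]
    rw [if_pos (by omega), sub_eq_add_neg, zpow_add₀ hp0.ne', mul_comm (p ^ (k : ℤ)),
      Real.mul_rpow (by positivity) (by positivity)]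
    congr 1
    rw [zpow_natCast, ← Real.rpow_natCast, ← Real.rpow_natCast, ← Real.rpow_mul hp0.le,
      ← Real.rpow_mul hp0.le, mul_comm]
  · intro n hn
    rw [if_neg]
    intro hle
    exact hn ⟨(n + N).toNat, by simp only; omega⟩

/-- The series defining the class of a Schwartz–Bruhat function is `O(t ^ (-a))` on the fundamental
domain. The bound `(1 + s²)⁻¹ ≤ s ^ (-a)` makes the sum over `Γ₊` a product of geometric series, as
the exponent of each prime is bounded below on the support. -/
theorem exists_summable_bound {h : Adele S → ℂ} (hh : h ∈ schwartzBruhat S) {a : ℝ} (ha : 0 < a)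
    (ha2 : a ≤ 2) : ∃ C : ℝ, ∀ x ∈ fundDomain S, Summable (fun q : Gam S => ‖h (q • x)‖) ∧
      ∑' q : Gam S, ‖h (q • x)‖ ≤ C * x.2 ^ (-a) := by
  obtain ⟨C, N, hC, hd⟩ := exists_decay hh
  set g : S → ℤ → ℝ := fun p n =>
    if -(N : ℤ) ≤ n then ((((p : Nat.Primes) : ℕ) : ℝ) ^ n) ^ (-a) else 0 with hg
  have hg0 : ∀ p n, 0 ≤ g p n := fun p n => by
    simp only [hg]
    split_ifs
    · exact Real.rpow_nonneg (zpow_nonneg (Nat.cast_nonneg _) _) _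
    · exact le_rfl
  have hs : Summable fun n : S → ℤ => ∏ p, g p (n p) :=
    summable_fintype_prod hg0 fun p => summable_truncated_geometric one_lt_prime_cast ha N
  have hs2 : Summable fun bn : Bool × (S → ℤ) => ∏ p, g p (bn.2 p) := by
    have h2 := Summable.mul_of_nonneg (f := fun _ : Bool => (1 : ℝ)) (Summable.of_finite) hs
      (fun _ => zero_le_one) fun n => Finset.prod_nonneg fun p _ => hg0 _ _
    simpa using h2
  have hbound : ∀ x ∈ fundDomain S, ∀ bn : Bool × (S → ℤ),
      ‖h (gamEquiv S bn • x)‖ ≤ (C * x.2 ^ (-a)) * ∏ p, g p (bn.2 p) := by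
    rintro x hx ⟨b, n⟩
    rw [gamEquiv_apply]
    by_cases hn : ∀ p, -(N : ℤ) ≤ n p
    · have e : ∏ p, g p (n p) = (((((gamOf n : Gam S) : ℚˣ) : ℚ) : ℝ)) ^ (-a) := by
        simp only [hg, if_pos (hn _)]
        rw [coe_gamOf, Rat.cast_prod, ← Real.finsetProd_rpow]
        · simp
        · intro p _
          rw [Rat.cast_zpow, Rat.cast_natCast]
          exact zpow_nonneg (Nat.cast_nonneg _) _
      simp only [e]
      set s : ℝ := ((((gamOf n : Gam S) : ℚˣ) : ℚ) : ℝ) with hs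
      have hs0 : 0 < s := Rat.cast_pos.mpr (gamOf_pos n)
      refine ((hd _).1).trans ?_
      rw [gam_smul_snd, Subgroup.coe_mul, Units.val_mul, Rat.cast_mul, coe_gamSign, ← hs]
      have h1 : ((((if b then -1 else 1 : ℚ) : ℚ) : ℝ) * s * x.2) ^ 2 = (x.2 * s) ^ 2 := by
        cases b <;> simp <;> ring
      rw [h1, mul_assoc, ← Real.mul_rpow hx.2.le hs0.le, div_eq_mul_inv]
      refine mul_le_mul_of_nonneg_left ?_ hC
      have hpos : 0 < x.2 * s := mul_pos hx.2 hs0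
      rw [Real.rpow_neg hpos.le]
      refine inv_anti₀ (Real.rpow_pos_of_pos hpos _) ?_
      rcases le_total (x.2 * s) 1 with hle | hle
      · exact (Real.rpow_le_one hpos.le hle ha.le).trans (by nlinarith [sq_nonneg (x.2 * s)])
      · refine (Real.rpow_le_rpow_of_exponent_le hle ha2).trans ?_
        rw [Real.rpow_two]
        linarith
    · push Not at hn
      obtain ⟨p, hp⟩ := hn
      have : h ((gamSign b * gamOf n) • x) = 0 := by
        refine (hd _).2 p ?_
        rw [gam_smul_fst, norm_mul, norm_gamSign_mul_gamOf, hx.1 p, mul_one, ← zpow_natCast]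
        exact zpow_lt_zpow_right₀ one_lt_prime_cast (by omega)
      rw [this, norm_zero]
      exact mul_nonneg (mul_nonneg hC (Real.rpow_nonneg hx.2.le _))
        (Finset.prod_nonneg fun p _ => hg0 _ _)
  refine ⟨C * ∑' bn : Bool × (S → ℤ), ∏ p, g p (bn.2 p), fun x hx => ?_⟩
  have hsx : Summable fun bn : Bool × (S → ℤ) => ‖h (gamEquiv S bn • x)‖ :=
    Summable.of_nonneg_of_le (fun _ => norm_nonneg _) (hbound x hx) (hs2.mul_left _)
  refine ⟨(gamEquiv S).summable_iff.mp hsx, ?_⟩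
  rw [← (gamEquiv S).tsum_eq]
  calc _ ≤ ∑' bn : Bool × (S → ℤ), (C * x.2 ^ (-a)) * ∏ p, g p (bn.2 p) :=
        hsx.tsum_le_tsum (hbound x hx) (hs2.mul_left _)
    _ = _ := by rw [tsum_mul_left]; ring

/-- The maximal compact subgroup `∏ ℤ_p^×`, as a subset of `∏ ℚ_p`. -/
def unitSet (S : Finset Nat.Primes) : Set ((p : S) → ℚ_[((p : Nat.Primes) : ℕ)]) :=
  {u | ∀ p, ‖u p‖ = 1}

/-- The restriction to `∏ ℤ_p^×` of the Haar measure of `∏ ℚ_p`. -/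
def unitMeasure (S : Finset Nat.Primes) : Measure ((p : S) → ℚ_[((p : Nat.Primes) : ℕ)]) :=
  (Measure.pi fun p : S => padicHaar ((p : Nat.Primes) : ℕ)).restrict (unitSet S)

theorem unitSet_eq_pi : unitSet S = Set.univ.pi fun p : S =>
    {t : ℚ_[((p : Nat.Primes) : ℕ)] | ‖t‖ = 1} := by
  ext u; simp [unitSet]

theorem measurableSet_unitSet : MeasurableSet (unitSet S) := by
  rw [unitSet_eq_pi]
  exact MeasurableSet.univ_pi fun p =>
    ((isClosed_singleton (x := (1 : ℝ))).preimage continuous_norm).measurableSet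

instance : SigmaFinite (unitMeasure S) := by unfold unitMeasure; infer_instance

instance : IsFiniteMeasure (unitMeasure S) := by
  refine ⟨?_⟩
  rw [unitMeasure, Measure.restrict_apply_univ, unitSet_eq_pi, Measure.pi_pi]
  refine ENNReal.prod_lt_top fun p _ => lt_of_le_of_lt (measure_mono ?_)
    (isCompact_closedBall (0 : ℚ_[((p : Nat.Primes) : ℕ)]) 1).measure_lt_top
  intro t ht
  simpa using (le_of_eq ht)

theorem unitMeasure_univ_ne_zero : unitMeasure S Set.univ ≠ 0 := by
  rw [unitMeasure, Measure.restrict_apply_univ, unitSet_eq_pi, Measure.pi_pi]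
  refine Finset.prod_ne_zero_iff.mpr fun p _ => ne_of_gt ?_
  have hopen : IsOpen {t : ℚ_[((p : Nat.Primes) : ℕ)] | ‖t‖ = 1} := by
    have : {t : ℚ_[((p : Nat.Primes) : ℕ)] | ‖t‖ = 1} = Metric.sphere 0 1 := by
      ext t; simp
    rw [this]
    exact IsUltrametricDist.isOpen_sphere 0 one_ne_zero
  exact hopen.measure_pos _ ⟨1, by simp⟩

theorem domainMeasure_eq :
    domainMeasure S = (unitMeasure S).prod (volume.restrict (Set.Ioi (0 : ℝ))) := by
  rw [unitMeasure, Measure.prod_restrict, domainMeasure, adeleHaar]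
  congr 1

/-- A square integrable function on `(0, ∞)` a multiple of which dominates the class of any given
Schwartz–Bruhat function. -/
def classMajorant (t : ℝ) : ℝ := if t ≤ 1 then t ^ (-(1 / 4) : ℝ) else t ^ (-1 : ℝ)

theorem memLp_classMajorant : MemLp classMajorant 2 (volume.restrict (Set.Ioi (0 : ℝ))) := by
  have hm : Measurable classMajorant :=
    Measurable.ite measurableSet_Iic (by fun_prop) (by fun_prop)
  rw [memLp_two_iff_integrable_sq hm.aestronglyMeasurable]
  change IntegrableOn (fun t => classMajorant t ^ 2) (Set.Ioi 0)
  rw [← Set.Ioc_union_Ioi_eq_Ioi (zero_le_one (α := ℝ))]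
  refine IntegrableOn.union ?_ ?_
  · have h1 : IntegrableOn (fun t : ℝ => t ^ (-(1 / 2) : ℝ)) (Set.Ioc 0 1) :=
      (intervalIntegrable_iff_integrableOn_Ioc_of_le zero_le_one).mp
        (intervalIntegral.intervalIntegrable_rpow' (by norm_num))
    refine h1.congr_fun (fun t ht => ?_) measurableSet_Ioc
    simp only [classMajorant]
    rw [if_pos ht.2, ← Real.rpow_natCast, ← Real.rpow_mul ht.1.le]
    norm_num
  · have h1 : IntegrableOn (fun t : ℝ => t ^ (-2 : ℝ)) (Set.Ioi 1) :=
      integrableOn_Ioi_rpow_of_lt (by norm_num) one_pos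
    refine h1.congr_fun (fun t ht => ?_) measurableSet_Ioi
    simp only [classMajorant]
    rw [if_neg (not_le.mpr ht), ← Real.rpow_natCast, ← Real.rpow_mul (one_pos.trans ht).le]
    norm_num

theorem exists_class_bound {h : Adele S → ℂ} (hh : h ∈ schwartzBruhat S) :
    ∃ C : ℝ, ∀ x ∈ fundDomain S, Summable (fun q : Gam S => ‖h (q • x)‖) ∧
      ∑' q : Gam S, ‖h (q • x)‖ ≤ C * classMajorant x.2 := by
  obtain ⟨C, hC⟩ := exists_summable_bound hh (a := 1 / 4) (by norm_num) (by norm_num)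
  obtain ⟨D, hD⟩ := exists_summable_bound hh (a := 1) (by norm_num) (by norm_num)
  refine ⟨max C D, fun x hx => ⟨(hC x hx).1, ?_⟩⟩
  rw [classMajorant]
  split_ifs
  · exact (hC x hx).2.trans (mul_le_mul_of_nonneg_right (le_max_left _ _)
      (Real.rpow_nonneg hx.2.le _))
  · exact (hD x hx).2.trans (mul_le_mul_of_nonneg_right (le_max_right _ _)
      (Real.rpow_nonneg hx.2.le _))

theorem memLp_tsum_norm {h : Adele S → ℂ} (hh : h ∈ schwartzBruhat S) :
    MemLp (fun x => ∑' q : Gam S, ‖h (q • x)‖) 2 (domainMeasure S) := by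
  obtain ⟨C, hC⟩ := exists_class_bound hh
  have hm : AEStronglyMeasurable (fun x => ∑' q : Gam S, ‖h (q • x)‖) (domainMeasure S) := by
    refine aestronglyMeasurable_of_tendsto_ae Filter.atTop
      (f := fun (u : Finset (Gam S)) x => ∑ q ∈ u, ‖h (q • x)‖) (fun u => ?_) ?_
    · refine Finset.aestronglyMeasurable_fun_sum _ fun q _ => ?_
      exact ((continuous_of_mem hh).measurable.comp
        (measurable_const_smul q)).norm.aestronglyMeasurable
    · filter_upwards [ae_mem_fundDomain] with x hx using (hC x hx).1.hasSum
  have hG : MemLp (fun x : Adele S => C * classMajorant x.2) 2 (domainMeasure S) := by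
    rw [domainMeasure_eq]
    exact (memLp_classMajorant.comp_snd (unitMeasure S)).const_mul C
  refine hG.of_le hm ?_
  filter_upwards [ae_mem_fundDomain] with x hx
  rw [Real.norm_of_nonneg (tsum_nonneg fun _ => norm_nonneg _)]
  exact (hC x hx).2.trans (le_abs_self _)

theorem toClass_proj (h : Adele S → ℂ) (x : Adele S) :
    toClass S h (proj S x) = (1 / 2 : ℂ) * ∑' q : Gam S, h (q • x) := rfl

theorem summable_of_mem {h : Adele S → ℂ} (hh : h ∈ schwartzBruhat S) {x : Adele S}
    (hx : x ∈ fundDomain S) : Summable fun q : Gam S => h (q • x) := by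
  obtain ⟨C, hC⟩ := exists_class_bound hh
  exact (hC x hx).1.of_norm

theorem memLp_tsum {h : Adele S → ℂ} (hh : h ∈ schwartzBruhat S) :
    MemLp (fun x => ∑' q : Gam S, h (q • x)) 2 (domainMeasure S) := by
  refine (memLp_tsum_norm hh).of_le ?_ ?_
  · refine aestronglyMeasurable_of_tendsto_ae Filter.atTop
      (f := fun (u : Finset (Gam S)) x => ∑ q ∈ u, h (q • x)) (fun u => ?_) ?_
    · refine Finset.aestronglyMeasurable_fun_sum _ fun q _ => ?_
      exact ((continuous_of_mem hh).measurable.comp (measurable_const_smul q)).aestronglyMeasurable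
    · filter_upwards [ae_mem_fundDomain] with x hx using (summable_of_mem hh hx).hasSum
  · obtain ⟨C, hC⟩ := exists_class_bound hh
    filter_upwards [ae_mem_fundDomain] with x hx
    rw [Real.norm_of_nonneg (tsum_nonneg fun _ => norm_nonneg _)]
    exact norm_tsum_le_tsum_norm (hC x hx).1

theorem memLp_toClass {h : Adele S → ℂ} (hh : h ∈ schwartzBruhat S) :
    MemLp (toClass S h) 2 (classMeasure S) := by
  rw [memLp_class_iff]
  exact (memLp_tsum hh).const_mul _

end Summation

/-! ### The norm of a class -/

section Norm

variable {S : Finset Nat.Primes}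

open ComplexConjugate
open scoped ENNReal

/-- The square integrability of `∑_γ |h (γ x)|` justifies the exchanges of sum and integral in the
unfolding. -/
theorem lintegral_tsum_enorm_sq_lt_top {h : Adele S → ℂ} (hh : h ∈ schwartzBruhat S) :
    ∫⁻ x, (∑' q : Gam S, ‖h (q • x)‖ₑ) ^ 2 ∂domainMeasure S < ∞ := by
  have h1 := eLpNorm_lt_top_iff_lintegral_rpow_enorm_lt_top (p := 2) two_ne_zero
    ENNReal.ofNat_ne_top |>.mp (memLp_tsum_norm hh).eLpNorm_lt_top
  refine lt_of_le_of_lt (le_of_eq (lintegral_congr_ae ?_)) h1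
  obtain ⟨C, hC⟩ := exists_class_bound hh
  filter_upwards [ae_mem_fundDomain] with x hx
  have e : ∑' q : Gam S, ‖h (q • x)‖ₑ = ‖∑' q : Gam S, ‖h (q • x)‖‖ₑ := by
    rw [Real.enorm_of_nonneg (tsum_nonneg fun _ => norm_nonneg _),
      ENNReal.ofReal_tsum_of_nonneg (fun _ => norm_nonneg _) (hC x hx).1]
    simp only [ofReal_norm]
  rw [e]
  simp

theorem tsum_lintegral_enorm_mul_ne_top {h : Adele S → ℂ} (hh : h ∈ schwartzBruhat S) :
    ∑' ab : Gam S × Gam S, ∫⁻ x, ‖conj (h (ab.1 • x)) * h (ab.2 • x)‖ₑ ∂domainMeasure S ≠ ∞ := by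
  have hm : ∀ q : Gam S, Measurable fun x => h (q • x) := fun q =>
    (continuous_of_mem hh).measurable.comp (measurable_const_smul q)
  rw [← lintegral_tsum]
  · refine ne_of_lt (lt_of_le_of_lt (le_of_eq (lintegral_congr fun x => ?_))
      (lintegral_tsum_enorm_sq_lt_top hh))
    simp only [enorm_mul, RCLike.enorm_conj]
    rw [ENNReal.tsum_prod (f := fun a b : Gam S => ‖h (a • x)‖ₑ * ‖h (b • x)‖ₑ), sq,
      ← ENNReal.tsum_mul_right]
    simp only [ENNReal.tsum_mul_left]
  · intro ab
    exact ((Complex.continuous_conj.measurable.comp (hm ab.1)).mul (hm ab.2)).enorm.aemeasurable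

/-- Unfolding: the square of the norm of the class of `h` is a sum of inner products on `𝔸_S`
between `h` and its translates under `Γ`. -/
theorem integral_conj_tsum_mul_tsum {h : Adele S → ℂ} (hh : h ∈ schwartzBruhat S) :
    ∫ x, conj (∑' q : Gam S, h (q • x)) * ∑' q : Gam S, h (q • x) ∂domainMeasure S
      = ∑' d : Gam S, ∫ x, conj (h (d • x)) * h x ∂adeleHaar S := by
  have hm : ∀ q : Gam S, Measurable fun x => h (q • x) := fun q =>
    (continuous_of_mem hh).measurable.comp (measurable_const_smul q)
  have hF : ∀ ab : Gam S × Gam S, AEStronglyMeasurable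
      (fun x => conj (h (ab.1 • x)) * h (ab.2 • x)) (domainMeasure S) := fun ab =>
    ((Complex.continuous_conj.measurable.comp (hm ab.1)).mul (hm ab.2)).aestronglyMeasurable
  have hfin := tsum_lintegral_enorm_mul_ne_top hh
  obtain ⟨C, hC⟩ := exists_class_bound hh
  have hI : ∀ d : Gam S, Integrable (fun x => conj (h (d • x)) * h x) (adeleHaar S) := by
    intro d
    obtain ⟨D, N, hD, hd⟩ := exists_decay hh
    refine (integrable_of_mem hh).bdd_mul (c := D)
      (Complex.continuous_conj.measurable.comp (hm d)).aestronglyMeasurable ?_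
    refine Filter.Eventually.of_forall fun x => ?_
    rw [RCLike.norm_conj]
    refine (hd _).1.trans (div_le_self hD ?_)
    nlinarith [sq_nonneg (d • x).2]
  have hsum : Summable fun ab : Gam S × Gam S =>
      ∫ x, conj (h (ab.1 • x)) * h (ab.2 • x) ∂domainMeasure S := by
    refine Summable.of_norm_bounded (ENNReal.summable_toReal hfin) fun ab => ?_
    rw [← toReal_enorm]
    exact ENNReal.toReal_mono (ENNReal.ne_top_of_tsum_ne_top hfin ab)
      (enorm_integral_le_lintegral_enorm _)
  -- the double sum over `(a, b)` is rearranged as a sum over `d = a b⁻¹` of sums over `c = b`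
  let e : Gam S × Gam S ≃ Gam S × Gam S :=
    { toFun := fun ab => (ab.1 * ab.2, ab.2)
      invFun := fun ab => (ab.1 * ab.2⁻¹, ab.2)
      left_inv := fun ab => by simp
      right_inv := fun ab => by simp }
  calc _ = ∫ x, ∑' ab : Gam S × Gam S, conj (h (ab.1 • x)) * h (ab.2 • x) ∂domainMeasure S := by
        refine integral_congr_ae ?_
        filter_upwards [ae_mem_fundDomain] with x hx
        have hn := (hC x hx).1
        rw [Complex.conj_tsum, tsum_mul_tsum_of_summable_norm _ hn]
        simpa only [RCLike.norm_conj] using hn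
    _ = ∑' ab : Gam S × Gam S, ∫ x, conj (h (ab.1 • x)) * h (ab.2 • x) ∂domainMeasure S :=
        integral_tsum hF hfin
    _ = ∑' ab : Gam S × Gam S,
        ∫ x, conj (h ((ab.1 * ab.2) • x)) * h (ab.2 • x) ∂domainMeasure S :=
        (e.tsum_eq fun ab : Gam S × Gam S =>
          ∫ x, conj (h (ab.1 • x)) * h (ab.2 • x) ∂domainMeasure S).symm
    _ = ∑' d : Gam S, ∑' c : Gam S,
        ∫ x, conj (h ((d * c) • x)) * h (c • x) ∂domainMeasure S :=
        (e.summable_iff.mpr hsum).tsum_prod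
    _ = _ := by
        refine tsum_congr fun d => ?_
        rw [isFundamentalDomain_fundDomain.integral_eq_tsum'' _ (hI d)]
        simp only [mul_smul]
        rfl

/-- The class of `ℱ h` has the same norm as the class of `h`: by Plancherel's formula, `ℱ` permutes
the terms of the unfolded norm. -/
theorem integral_conj_tsum_adeleFourier {h : Adele S → ℂ} (hh : h ∈ schwartzBruhat S) :
    ∫ x, conj (∑' q : Gam S, adeleFourier S h (q • x)) * ∑' q : Gam S, adeleFourier S h (q • x)
        ∂domainMeasure S
      = ∫ x, conj (∑' q : Gam S, h (q • x)) * ∑' q : Gam S, h (q • x) ∂domainMeasure S := by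
  rw [integral_conj_tsum_mul_tsum hh, integral_conj_tsum_mul_tsum (adeleFourier_mem hh),
    ← (Equiv.inv (Gam S)).tsum_eq]
  refine tsum_congr fun d => ?_
  rw [← integral_conj_adeleFourier_mul (integrable_comp_smul d (integrable_of_mem hh)) hh]
  simp only [adeleFourier_comp_smul, Equiv.inv_apply]

/-- The linear map `h ↦ [h]` from the Schwartz–Bruhat space to `L²(X_S)`. -/
def classMap (S : Finset Nat.Primes) : schwartzBruhat S →ₗ[ℂ] L2Class S where
  toFun h := (memLp_toClass h.2).toLp _
  map_add' h k := by
    rw [← MemLp.toLp_add, MemLp.toLp_eq_toLp_iff]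
    refine ae_class_iff.mpr ?_
    filter_upwards [ae_mem_fundDomain] with x hx
    rw [Pi.add_apply, toClass_proj, toClass_proj, toClass_proj, ← mul_add,
      ← (summable_of_mem h.2 hx).tsum_add (summable_of_mem k.2 hx)]
    rfl
  map_smul' c h := by
    rw [RingHom.id_apply, ← MemLp.toLp_const_smul, MemLp.toLp_eq_toLp_iff]
    refine ae_class_iff.mpr (Filter.Eventually.of_forall fun x => ?_)
    have : ∑' q : Gam S, ((c • h : schwartzBruhat S) : Adele S → ℂ) (q • x)
        = c * ∑' q : Gam S, (h : Adele S → ℂ) (q • x) := by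
      rw [← tsum_mul_left]
      rfl
    rw [Pi.smul_apply, toClass_proj, toClass_proj, smul_eq_mul, mul_left_comm, this]

theorem coeFn_classMap (h : schwartzBruhat S) :
    classMap S h =ᵐ[classMeasure S] toClass S h :=
  (memLp_toClass h.2).coeFn_toLp

theorem inner_classMap (h : schwartzBruhat S) :
    inner ℂ (classMap S h) (classMap S h) = (1 / 4 : ℂ) *
      ∫ x, conj (∑' q : Gam S, (h : Adele S → ℂ) (q • x)) *
        ∑' q : Gam S, (h : Adele S → ℂ) (q • x) ∂domainMeasure S := by
  have hm := (memLp_toClass h.2).aestronglyMeasurable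
  have h1 : inner ℂ (classMap S h) (classMap S h)
      = ∫ ξ, conj (toClass S h ξ) * toClass S h ξ ∂classMeasure S := by
    rw [L2.inner_def]
    refine integral_congr_ae ?_
    filter_upwards [coeFn_classMap h] with ξ hξ
    rw [hξ, RCLike.inner_apply']
  rw [h1]
  have h2 := integral_map (μ := domainMeasure S) (φ := proj S) (f := fun ξ =>
    conj (toClass S h ξ) * toClass S h ξ) measurable_proj.aemeasurable
    ((Complex.continuous_conj.comp_aestronglyMeasurable hm).mul hm)
  rw [measurePreserving_proj.map_eq] at h2
  rw [h2, ← integral_const_mul]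
  congr 1
  ext x
  simp only [toClass_proj, map_mul, map_div₀, map_one, Complex.conj_ofNat]
  ring

/-- The Fourier transform of the Schwartz–Bruhat space. -/
def schwartzBruhatFourier (S : Finset Nat.Primes) : schwartzBruhat S →ₗ[ℂ] schwartzBruhat S where
  toFun h := ⟨adeleFourier S h, adeleFourier_mem h.2⟩
  map_add' h k := Subtype.ext (adeleFourier_add (integrable_of_mem h.2) (integrable_of_mem k.2))
  map_smul' c h := Subtype.ext (adeleFourier_smul c h.1)

theorem norm_classMap_fourier (h : schwartzBruhat S) :
    ‖classMap S (schwartzBruhatFourier S h)‖ = ‖classMap S h‖ := by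
  have : inner ℂ (classMap S (schwartzBruhatFourier S h)) (classMap S (schwartzBruhatFourier S h))
      = inner ℂ (classMap S h) (classMap S h) := by
    rw [inner_classMap, inner_classMap, ← integral_conj_tsum_adeleFourier h.2]
    rfl
  rw [inner_self_eq_norm_sq_to_K, inner_self_eq_norm_sq_to_K] at this
  refine (pow_left_inj₀ (norm_nonneg _) (norm_nonneg _) two_ne_zero).mp ?_
  exact_mod_cast this

end Norm

/-! ### Density of the classes of Schwartz–Bruhat functions -/

section Density

variable {S : Finset Nat.Primes}

open ComplexConjugate
open scoped ContDiff

/-- An integrable function whose integrals vanish on a generating `π`-system has vanishing integral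
on every measurable set. -/
theorem setIntegral_eq_zero_of_isPiSystem {α : Type*} [m : MeasurableSpace α] {μ : Measure α}
    {f : α → ℂ} (hf : Integrable f μ) {C : Set (Set α)} (hC : IsPiSystem C)
    (hgen : m = MeasurableSpace.generateFrom C) (huniv : Set.univ ∈ C)
    (h : ∀ s ∈ C, ∫ x in s, f x ∂μ = 0) {s : Set α} (hs : MeasurableSet s) :
    ∫ x in s, f x ∂μ = 0 := by
  refine MeasurableSpace.induction_on_inter (C := fun s _ => ∫ x in s, f x ∂μ = 0) hgen hC ?_ h
    (fun t ht h0 => ?_) (fun u hd hu h0 => ?_) s hs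
  · simp
  · have h1 := integral_add_compl ht hf
    have h2 := h _ huniv
    rw [setIntegral_univ] at h2
    rwa [h0, h2, zero_add] at h1
  · rw [integral_iUnion hu hd hf.integrableOn]
    simp [h0]

/-- The boxes with clopen sides. -/
def clopenBoxes (S : Finset Nat.Primes) : Set (Set ((p : S) → ℚ_[((p : Nat.Primes) : ℕ)])) :=
  Set.univ.pi '' Set.univ.pi fun _ => {B | IsClopen B}

theorem isPiSystem_clopenBoxes : IsPiSystem (clopenBoxes S) :=
  IsPiSystem.pi fun _ _ hA _ hB _ => IsClopen.inter hA hB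

theorem generateFrom_clopenBoxes :
    MeasurableSpace.pi = MeasurableSpace.generateFrom (clopenBoxes S) := by
  rw [clopenBoxes, ← generateFrom_pi_eq]
  · congr 1
    ext p : 1
    exact loc_compact_Haus_tot_disc_of_zero_dim.borel_eq_generateFrom
  · exact fun _ => ⟨fun _ => Set.univ, fun _ => isClopen_univ, Set.iUnion_const _⟩

theorem univ_mem_clopenBoxes : Set.univ ∈ clopenBoxes S :=
  ⟨fun _ => Set.univ, fun _ _ => isClopen_univ, by simp⟩

/-- A square integrable function on `∏ ℤ_p^× × (0, ∞)` that is orthogonal to the products of the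
indicator functions of clopen boxes and the test functions is zero. -/
theorem ae_eq_zero_of_forall_box {g : Adele S → ℂ} (hg : MemLp g 2 (domainMeasure S))
    (h : ∀ A ∈ clopenBoxes S, ∀ f : ℝ → ℝ, ContDiff ℝ ∞ f → HasCompactSupport f →
      tsupport f ⊆ Set.Ioi 0 → ∫ x, A.indicator (fun _ => f x.2 • g x) x.1 ∂domainMeasure S = 0) :
    g =ᵐ[domainMeasure S] 0 := by
  set ν := unitMeasure S with hν
  set ρ : Measure ℝ := volume.restrict (Set.Ioi (0 : ℝ)) with hρ
  rw [domainMeasure_eq] at hg h ⊢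
  have hfg : ∀ f : ℝ → ℝ, ContDiff ℝ ∞ f → HasCompactSupport f →
      Integrable (fun x : Adele S => f x.2 • g x) (ν.prod ρ) := by
    intro f hf hf'
    have h1 : MemLp f 2 ρ := (hf.continuous.memLp_of_hasCompactSupport hf')
    have h2 : MemLp (fun x : Adele S => f x.2) 2 (ν.prod ρ) := h1.comp_snd ν
    have h3 : MemLp (fun x : Adele S => (f x.2 : ℂ)) 2 (ν.prod ρ) := h2.ofReal
    simp only [Complex.real_smul]
    exact h3.integrable_mul hg
  have hind : ∀ A : Set ((p : S) → ℚ_[((p : Nat.Primes) : ℕ)]), MeasurableSet A →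
      ∀ F : Adele S → ℂ, ∀ μ : Measure (Adele S),
      ∫ x, A.indicator (fun _ => F x) x.1 ∂μ = ∫ x in Prod.fst ⁻¹' A, F x ∂μ := by
    intro A hA F μ
    rw [← integral_indicator (measurable_fst hA)]
    rfl
  have hswap : ∀ A : Set ((p : S) → ℚ_[((p : Nat.Primes) : ℕ)]), ∀ F : Adele S → ℂ, ∀ τ : Measure ℝ,
      SFinite τ → Integrable F (ν.prod τ) →
      ∫ x in Prod.fst ⁻¹' A, F x ∂(ν.prod τ) = ∫ u in A, (∫ t, F (u, t) ∂τ) ∂ν ∧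
      ∫ x in Prod.fst ⁻¹' A, F x ∂(ν.prod τ) = ∫ t, (∫ u in A, F (u, t) ∂ν) ∂τ := by
    intro A F τ _ hF
    have e : (Prod.fst ⁻¹' A : Set (Adele S)) = A ×ˢ Set.univ := by ext; simp
    have hF' : Integrable F ((ν.restrict A).prod τ) := by
      have := hF.integrableOn (s := A ×ˢ Set.univ)
      rwa [IntegrableOn, ← Measure.prod_restrict, Measure.restrict_univ] at this
    rw [e, ← Measure.prod_restrict, Measure.restrict_univ]
    exact ⟨integral_prod _ hF', integral_prod_symm _ hF'⟩
  have key : ∀ A, MeasurableSet A → ∀ f : ℝ → ℝ, ContDiff ℝ ∞ f → HasCompactSupport f →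
      tsupport f ⊆ Set.Ioi 0 → ∫ t, f t • (∫ u in A, g (u, t) ∂ν) = 0 := by
    intro A hA f hf hf' hf''
    have hi := hfg f hf hf'
    have h0 : ∫ u in A, (∫ t, f t • g (u, t) ∂ρ) ∂ν = 0 := by
      refine setIntegral_eq_zero_of_isPiSystem (f := fun u => ∫ t, f t • g (u, t) ∂ρ)
        hi.integral_prod_left isPiSystem_clopenBoxes generateFrom_clopenBoxes
        univ_mem_clopenBoxes (fun B hB => ?_) hA
      have hBm : MeasurableSet B := by
        rw [generateFrom_clopenBoxes]
        exact MeasurableSpace.measurableSet_generateFrom hB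
      rw [← ((hswap B _ ρ inferInstance hi).1), ← hind B hBm, h B hB f hf hf' hf'']
    rw [← ((hswap A _ ρ inferInstance hi).1), (hswap A _ ρ inferInstance hi).2] at h0
    simp only [integral_smul] at h0
    rw [← h0, hρ, setIntegral_eq_integral_of_forall_compl_eq_zero]
    intro t ht
    have : f t = 0 := by
      by_contra hne
      exact ht (hf'' (subset_tsupport _ hne))
    rw [this, zero_smul]
  have hint : ∀ k : Set ℝ, k ⊆ Set.Ioi 0 → MeasurableSet k → volume k ≠ ⊤ →
      Integrable g (ν.prod (volume.restrict k)) := by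
    intro k hk hkm hkv
    have h1 : MemLp g 2 (ν.prod (volume.restrict k)) := by
      refine hg.mono_measure ?_
      rw [show volume.restrict k = ρ.restrict k by
        rw [hρ, Measure.restrict_restrict hkm, Set.inter_eq_left.mpr hk]]
      calc ν.prod (ρ.restrict k) = (ν.prod ρ).restrict (Set.univ ×ˢ k) := by
            rw [← Measure.prod_restrict, Measure.restrict_univ]
        _ ≤ _ := Measure.restrict_le_self
    have : IsFiniteMeasure (volume.restrict k) := ⟨by simpa using hkv.lt_top⟩
    exact h1.integrable one_le_two
  -- for each measurable `A` the partial integral over `A` vanishes at almost every `t`; the null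
  -- set depends on `A`, which is why integrals over products `A ×ˢ E` are used next
  have hGA : ∀ A, MeasurableSet A → ∀ᵐ t, t ∈ Set.Ioi (0 : ℝ) → ∫ u in A, g (u, t) ∂ν = 0 := by
    intro A hA
    refine isOpen_Ioi.ae_eq_zero_of_integral_contDiff_smul_eq_zero ?_ (key A hA)
    rw [locallyIntegrableOn_iff isOpen_Ioi.isLocallyClosed]
    intro k hk hkc
    have h1 := hint k hk hkc.measurableSet hkc.measure_lt_top.ne
    have h2 : Integrable g ((ν.restrict A).prod (volume.restrict k)) := by
      have := h1.integrableOn (s := A ×ˢ Set.univ)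
      rwa [IntegrableOn, ← Measure.prod_restrict, Measure.restrict_univ] at this
    exact h2.integral_prod_right
  -- on the strips `t ≤ n`, of finite measure, `g` is integrable
  have hn : ∀ n : ℕ, ∀ᵐ x : Adele S ∂(ν.prod ρ), x.2 ≤ (n : ℝ) → g x = 0 := by
    intro n
    have hi := hint (Set.Ioc 0 n) Set.Ioc_subset_Ioi_self measurableSet_Ioc measure_Ioc_lt_top.ne
    have hz : g =ᵐ[ν.prod (volume.restrict (Set.Ioc (0 : ℝ) n))] 0 := by
      refine hi.ae_eq_zero_of_forall_setIntegral_eq_zero fun s hs _ => ?_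
      refine setIntegral_eq_zero_of_isPiSystem hi isPiSystem_prod generateFrom_prod.symm
        ⟨Set.univ, by simp, Set.univ, by simp, Set.univ_prod_univ⟩ ?_ hs
      rintro _ ⟨A, hA, E, hE, rfl⟩
      have hi2 : Integrable g
          ((ν.restrict A).prod ((volume.restrict (Set.Ioc (0 : ℝ) n)).restrict E)) := by
        have := hi.integrableOn (s := A ×ˢ E)
        rwa [IntegrableOn, ← Measure.prod_restrict] at this
      rw [← Measure.prod_restrict, integral_prod_symm _ hi2]
      refine integral_eq_zero_of_ae (ae_restrict_of_ae ?_)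
      refine (ae_restrict_iff' measurableSet_Ioc).mpr ?_
      filter_upwards [hGA A hA] with t ht htn using ht htn.1
    have e : ν.prod (volume.restrict (Set.Ioc (0 : ℝ) n))
        = (ν.prod ρ).restrict (Prod.snd ⁻¹' Set.Iic (n : ℝ)) := by
      have e1 : (Prod.snd ⁻¹' Set.Iic (n : ℝ) : Set (Adele S)) = Set.univ ×ˢ Set.Iic (n : ℝ) := by
        ext; simp
      rw [e1, ← Measure.prod_restrict, Measure.restrict_univ, hρ,
        Measure.restrict_restrict measurableSet_Iic, Set.inter_comm, Set.Ioi_inter_Iic]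
    rw [e, Filter.EventuallyEq, ae_restrict_iff' (measurable_snd measurableSet_Iic)] at hz
    exact hz
  filter_upwards [ae_all_iff.mpr hn] with x hx
  obtain ⟨n, hn⟩ := exists_nat_ge x.2
  exact hx n hn

theorem tsum_smul_eq_self {h : Adele S → ℂ} (hs : ∀ x, x ∉ fundDomain S → h x = 0) {x : Adele S}
    (hx : x ∈ fundDomain S) : ∑' q : Gam S, h (q • x) = h x := by
  rw [tsum_eq_single 1, one_smul]
  intro q hq
  exact hs _ fun hmem => hq (eq_one_of_smul_mem_fundDomain hx hmem)

/-- The classes of the Schwartz–Bruhat functions are dense in `L²(X_S)`: those supported in the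
fundamental domain are already total. -/
theorem denseRange_classMap : DenseRange (classMap S) := by
  have hd : (LinearMap.range (classMap S)).topologicalClosure = ⊤ := by
    rw [Submodule.topologicalClosure_eq_top_iff, Submodule.eq_bot_iff]
    intro g hg
    have hg2 : MemLp (fun x => g (proj S x)) 2 (domainMeasure S) := memLp_class_iff.mp (Lp.memLp g)
    have hz : (fun x => g (proj S x)) =ᵐ[domainMeasure S] 0 := by
      refine ae_eq_zero_of_forall_box hg2 ?_
      rintro _ ⟨B, hB, rfl⟩ f hf hf' hf''
      have hfc : HasCompactSupport fun t => (f t : ℂ) := hf'.comp_left Complex.ofReal_zero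
      have hfs : ContDiff ℝ ∞ fun t => (f t : ℂ) := Complex.ofRealCLM.contDiff.comp hf
      set φ : (p : S) → ℚ_[((p : Nat.Primes) : ℕ)] → ℂ := fun p =>
        (B p ∩ {t | ‖t‖ = 1}).indicator fun _ => 1 with hφ
      have hsph : ∀ p : S, {t : ℚ_[((p : Nat.Primes) : ℕ)] | ‖t‖ = 1} = Metric.sphere 0 1 :=
        fun p => by ext; simp
      have hcl : ∀ p : S, IsClopen (B p ∩ {t : ℚ_[((p : Nat.Primes) : ℕ)] | ‖t‖ = 1}) := by
        intro p
        refine (hB p (Set.mem_univ p)).inter ?_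
        rw [hsph]
        exact IsUltrametricDist.isClopen_sphere 0 one_ne_zero
      have h1 : ∀ p, IsLocallyConstant (φ p) := fun p =>
        ((LocallyConstant.const _ (1 : ℂ)).indicator (hcl p)).isLocallyConstant
      have h2 : ∀ p, HasCompactSupport (φ p) := fun p =>
        HasCompactSupport.intro (isCompact_sphere 0 1) fun t ht => by
          refine Set.indicator_of_notMem (fun hmem => ht ?_) _
          rw [← hsph]
          exact hmem.2
      set h : schwartzBruhat S := ⟨_, prod_mul_mem_schwartzBruhat (hfc.toSchwartzMap hfs) h1 h2⟩
        with hh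
      have hval : ∀ x : Adele S, (h : Adele S → ℂ) x = (∏ p, φ p (x.1 p)) * (f x.2 : ℂ) :=
        fun _ => rfl
      have hsupp : ∀ x, x ∉ fundDomain S → (h : Adele S → ℂ) x = 0 := by
        intro x hx
        by_contra hne
        apply hx
        rw [hval] at hne
        obtain ⟨hne1, hne2⟩ := mul_ne_zero_iff.mp hne
        rw [Finset.prod_ne_zero_iff] at hne1
        refine ⟨fun p => (Set.mem_of_indicator_ne_zero (hne1 p (Finset.mem_univ p))).2, ?_⟩
        exact hf'' (subset_tsupport _ fun h0 => hne2 (by rw [h0, Complex.ofReal_zero]))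
      have hin := hg (classMap S h) (LinearMap.mem_range_self _ h)
      rw [L2.inner_def] at hin
      have e1 : ∫ ξ, inner ℂ (classMap S h ξ) (g ξ) ∂classMeasure S
          = ∫ ξ, conj (toClass S h ξ) * g ξ ∂classMeasure S := by
        refine integral_congr_ae ?_
        filter_upwards [coeFn_classMap h] with ξ hξ
        rw [hξ, RCLike.inner_apply']
      have e2 := integral_map (μ := domainMeasure S) (φ := proj S) (f := fun ξ =>
        conj (toClass S h ξ) * g ξ) measurable_proj.aemeasurable
        ((Complex.continuous_conj.comp_aestronglyMeasurable
          (memLp_toClass h.2).aestronglyMeasurable).mul (Lp.memLp g).aestronglyMeasurable)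
      rw [measurePreserving_proj.map_eq] at e2
      rw [e1, e2] at hin
      have e3 : ∫ x, conj (toClass S h (proj S x)) * g (proj S x) ∂domainMeasure S
          = (1 / 2 : ℂ) * ∫ x, (Set.univ.pi B).indicator
            (fun _ => f x.2 • g (proj S x)) x.1 ∂domainMeasure S := by
        rw [← integral_const_mul]
        refine integral_congr_ae ?_
        filter_upwards [ae_mem_fundDomain] with x hx
        rw [toClass_proj, tsum_smul_eq_self hsupp hx, hval]
        by_cases hxB : x.1 ∈ Set.univ.pi B
        · have hp : ∏ p, φ p (x.1 p) = 1 := by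
            refine Finset.prod_eq_one fun p _ => ?_
            exact Set.indicator_of_mem (show x.1 p ∈ B p ∩ {t | ‖t‖ = 1} from
              ⟨hxB p (Set.mem_univ p), hx.1 p⟩) _
          rw [Set.indicator_of_mem hxB, hp]
          simp only [map_mul, map_div₀, map_one, Complex.conj_ofNat, Complex.conj_ofReal, one_mul,
            Complex.real_smul]
          ring
        · have hp : ∏ p, φ p (x.1 p) = 0 := by
            rw [Set.mem_univ_pi] at hxB
            push Not at hxB
            obtain ⟨p, hp⟩ := hxB
            exact Finset.prod_eq_zero (Finset.mem_univ p)
              (Set.indicator_of_notMem (fun hmem => hp hmem.1) _)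
          rw [Set.indicator_of_notMem hxB, hp]
          simp
      rw [e3] at hin
      simpa using hin
    rw [Lp.eq_zero_iff_ae_eq_zero]
    exact ae_class_iff.mpr hz
  have := (LinearMap.range (classMap S)).dense_iff_topologicalClosure_eq_top.mpr hd
  exact this

/-! ### The Fourier transform of `L²(X_S)` -/

/-- The Fourier transform of `L²(X_S)`: the extension by continuity of `[h] ↦ [ℱ h]`. -/
def classFourier (S : Finset Nat.Primes) : L2Class S →L[ℂ] L2Class S :=
  (classMap S ∘ₗ schwartzBruhatFourier S).extendOfNorm (classMap S)

theorem classFourier_classMap (h : schwartzBruhat S) :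
    classFourier S (classMap S h) = classMap S (schwartzBruhatFourier S h) :=
  LinearMap.extendOfNorm_eq denseRange_classMap
    ⟨1, fun h => by rw [one_mul]; exact (norm_classMap_fourier h).le⟩ h

theorem eq_classMap {h : Adele S → ℂ} (hh : h ∈ schwartzBruhat S) {φ : L2Class S}
    (hφ : φ =ᵐ[classMeasure S] toClass S h) : φ = classMap S ⟨h, hh⟩ :=
  Lp.ext (hφ.trans (coeFn_classMap ⟨h, hh⟩).symm)

theorem isSemilocalFourier_classFourier : IsSemilocalFourier S (classFourier S) := by
  intro h hh φ hφ
  rw [eq_classMap hh hφ, classFourier_classMap]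
  exact coeFn_classMap _

theorem IsSemilocalFourier.eq_classFourier {G : L2Class S →L[ℂ] L2Class S}
    (hG : IsSemilocalFourier S G) : G = classFourier S := by
  refine ContinuousLinearMap.coeFn_injective (denseRange_classMap.equalizer G.continuous
    (classFourier S).continuous (funext fun h => ?_))
  simp only [Function.comp_apply]
  rw [classFourier_classMap]
  exact eq_classMap (adeleFourier_mem h.2) (hG h h.2 _ (coeFn_classMap h))

end Density

/-! ### Composition operators on `L²` -/

section Composition

open scoped ENNReal NNReal

variable {X Y : Type*} [MeasurableSpace X] [MeasurableSpace Y] {μ : Measure X} {ν : Measure Y}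
  {m : X → Y} {c : ℝ≥0}

theorem quasiMeasurePreserving_of_map_le (hm : Measurable m) (h : μ.map m ≤ c • ν) :
    Measure.QuasiMeasurePreserving m μ ν :=
  ⟨hm, (Measure.absolutelyContinuous_of_le h).trans Measure.smul_absolutelyContinuous⟩

theorem eLpNorm_comp_le (hm : Measurable m) (h : μ.map m ≤ c • ν) {f : Y → ℂ}
    (hf : AEStronglyMeasurable f ν) :
    eLpNorm (f ∘ m) 2 μ ≤ ENNReal.ofReal √c * eLpNorm f 2 ν := by
  rw [← eLpNorm_map_measure
    (hf.mono_ac (quasiMeasurePreserving_of_map_le hm h).absolutelyContinuous) hm.aemeasurable]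
  refine (eLpNorm_mono_measure f h).trans (le_of_eq ?_)
  rw [show c • ν = (c : ℝ≥0∞) • ν from rfl,
    eLpNorm_smul_measure_of_ne_top ENNReal.ofNat_ne_top, smul_eq_mul]
  congr 1
  have h2 : ENNReal.ofReal (c : ℝ) ^ (1 / 2 : ℝ) = ENNReal.ofReal ((c : ℝ) ^ (1 / 2 : ℝ)) :=
    ENNReal.ofReal_rpow_of_nonneg c.2 (by norm_num)
  rw [Real.sqrt_eq_rpow, ← h2, ENNReal.ofReal_coe_nnreal]
  norm_num

theorem memLp_comp (hm : Measurable m) (h : μ.map m ≤ c • ν) {f : Y → ℂ} (hf : MemLp f 2 ν) :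
    MemLp (f ∘ m) 2 μ :=
  ⟨hf.1.comp_quasiMeasurePreserving (quasiMeasurePreserving_of_map_le hm h),
    (eLpNorm_comp_le hm h hf.1).trans_lt (ENNReal.mul_lt_top ENNReal.ofReal_lt_top hf.2)⟩

/-- The operator `f ↦ f ∘ m` from `L²(ν)` to `L²(μ)`, for a map `m` with `m_* μ ≤ c ν`. -/
def compL2 (hm : Measurable m) (h : μ.map m ≤ c • ν) : Lp ℂ 2 ν →L[ℂ] Lp ℂ 2 μ :=
  LinearMap.mkContinuous
    { toFun := fun f => (memLp_comp hm h (Lp.memLp f)).toLp _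
      map_add' := fun f g => by
        rw [← MemLp.toLp_add, MemLp.toLp_eq_toLp_iff]
        exact (quasiMeasurePreserving_of_map_le hm h).ae_eq_comp (Lp.coeFn_add f g)
      map_smul' := fun a f => by
        rw [RingHom.id_apply, ← MemLp.toLp_const_smul, MemLp.toLp_eq_toLp_iff]
        exact (quasiMeasurePreserving_of_map_le hm h).ae_eq_comp (Lp.coeFn_smul a f) }
    √c fun f => by
      change ‖(memLp_comp hm h (Lp.memLp f)).toLp _‖ ≤ _
      rw [Lp.norm_toLp, Lp.norm_def, ← ENNReal.toReal_ofReal (Real.sqrt_nonneg c),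
        ← ENNReal.toReal_mul]
      exact ENNReal.toReal_mono (ENNReal.mul_ne_top ENNReal.ofReal_ne_top (Lp.eLpNorm_ne_top f))
        (eLpNorm_comp_le hm h (Lp.aestronglyMeasurable f))

theorem coeFn_compL2 (hm : Measurable m) (h : μ.map m ≤ c • ν) (f : Lp ℂ 2 ν) :
    compL2 hm h f =ᵐ[μ] f ∘ m :=
  (memLp_comp hm h (Lp.memLp f)).coeFn_toLp

theorem norm_compL2_le (hm : Measurable m) (h : μ.map m ≤ c • ν) : ‖compL2 hm h‖ ≤ √c :=
  LinearMap.mkContinuous_norm_le _ (Real.sqrt_nonneg _) _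

end Composition

/-- If `‖K‖ < 1` then `1 - K` is invertible; its inverse preserves the closed subspaces that `K`
preserves, being the sum of the Neumann series. -/
theorem exists_equiv_one_sub {E : Type*} [NormedAddCommGroup E] [NormedSpace ℂ E] [CompleteSpace E]
    {K : E →L[ℂ] E} (hK : ‖K‖ < 1) :
    ∃ A : E ≃L[ℂ] E, (∀ f, A f = f - K f) ∧ ∀ W : Submodule ℂ E, IsClosed (W : Set E) →
      (∀ f ∈ W, K f ∈ W) → ∀ f, A f ∈ W ↔ f ∈ W := by
  refine ⟨ContinuousLinearEquiv.unitsEquiv ℂ E (Units.oneSub K hK), fun f => rfl, ?_⟩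
  intro W hW hKW f
  refine ⟨fun hf => ?_, fun hf => W.sub_mem hf (hKW f hf)⟩
  have hpow : ∀ n : ℕ, ∀ g ∈ W, (K ^ n) g ∈ W := by
    intro n
    induction n with
    | zero => exact fun g hg => hg
    | succ n ih =>
      intro g hg
      rw [pow_succ]
      exact ih _ (hKW g hg)
  have h2 := (summable_geometric_of_norm_lt_one hK).hasSum.mapL
    (ContinuousLinearMap.apply ℂ E ((1 - K) f))
  have h3 : (ContinuousLinearMap.apply ℂ E ((1 - K) f)) (∑' n : ℕ, K ^ n) = f := by
    change ((∑' n : ℕ, K ^ n) * (1 - K)) f = f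
    rw [geom_series_mul_neg K hK]
    rfl
  rw [h3] at h2
  exact hW.mem_of_tendsto h2 (Filter.Eventually.of_forall fun s =>
    W.sum_mem fun n _ => hpow n _ hf)

/-! ### The subspaces of `L²(ℝ)` -/

theorem map_id_restrict_le {X : Type*} [MeasurableSpace X] (ν : Measure X) (s : Set X) :
    (ν.restrict s).map id ≤ (1 : NNReal) • ν := by
  rw [Measure.map_id, one_smul]
  exact Measure.restrict_le_self

theorem vanishingOn_eq_ker {X : Type*} [MeasurableSpace X] {ν : Measure X} {s : Set X}
    (hs : MeasurableSet s) :
    vanishingOn ν s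
      = LinearMap.ker (compL2 measurable_id (map_id_restrict_le ν s)).toLinearMap := by
  ext f
  rw [LinearMap.mem_ker]
  change (∀ᵐ x ∂ν, x ∈ s → f x = 0) ↔ compL2 measurable_id (map_id_restrict_le ν s) f = 0
  rw [Lp.eq_zero_iff_ae_eq_zero, ← ae_restrict_iff' hs]
  have h := coeFn_compL2 measurable_id (map_id_restrict_le ν s) f
  constructor
  · intro h1
    filter_upwards [h, h1] with x hx hx1
    rw [hx]
    exact hx1
  · intro h1
    filter_upwards [h, h1] with x hx hx1
    rw [hx] at hx1
    exact hx1

theorem isClosed_vanishingOn {X : Type*} [MeasurableSpace X] {ν : Measure X} {s : Set X}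
    (hs : MeasurableSet s) : IsClosed (vanishingOn ν s : Set (Lp ℂ 2 ν)) := by
  rw [vanishingOn_eq_ker hs]
  exact ContinuousLinearMap.isClosed_ker _

theorem map_neg_volume_le :
    (volume : Measure ℝ).map (fun t => -t) ≤ (1 : NNReal) • (volume : Measure ℝ) := by
  rw [one_smul]
  exact (Measure.measurePreserving_neg (volume : Measure ℝ)).map_eq.le

/-- The operator `f ↦ f (- ·)` of `L²(ℝ)`. -/
def reflection : Lp ℂ 2 (volume : Measure ℝ) →L[ℂ] Lp ℂ 2 (volume : Measure ℝ) :=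
  compL2 measurable_neg map_neg_volume_le

theorem coeFn_reflection (f : Lp ℂ 2 (volume : Measure ℝ)) :
    ∀ᵐ t : ℝ, reflection f t = f (-t) :=
  coeFn_compL2 measurable_neg map_neg_volume_le f

theorem mem_evenL2_iff {f : Lp ℂ 2 (volume : Measure ℝ)} : f ∈ evenL2 ↔ reflection f = f := by
  change (∀ᵐ t : ℝ, f (-t) = f t) ↔ _
  constructor
  · intro h
    refine Lp.ext ?_
    filter_upwards [coeFn_reflection f, h] with t h1 h2 using h1.trans h2
  · intro h
    filter_upwards [coeFn_reflection f] with t h1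
    rw [← h1, h]

theorem isClosed_evenL2 : IsClosed (evenL2 : Set (Lp ℂ 2 (volume : Measure ℝ))) := by
  have : (evenL2 : Set (Lp ℂ 2 (volume : Measure ℝ))) = {f | reflection f = f} :=
    Set.ext fun f => mem_evenL2_iff
  rw [this]
  exact isClosed_eq reflection.continuous continuous_id

theorem map_dilation_le {a : NNReal} (ha : a ≠ 0) :
    (volume : Measure ℝ).map (fun t => (a : ℝ)⁻¹ * t) ≤ a • (volume : Measure ℝ) := by
  rw [Real.map_volume_mul_left (inv_ne_zero (NNReal.coe_ne_zero.mpr ha)), inv_inv,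
    NNReal.abs_eq, ENNReal.ofReal_coe_nnreal]
  exact le_rfl

/-- The operator `f ↦ f (a⁻¹ ·)` of `L²(ℝ)`. -/
def dilation {a : NNReal} (ha : a ≠ 0) :
    Lp ℂ 2 (volume : Measure ℝ) →L[ℂ] Lp ℂ 2 (volume : Measure ℝ) :=
  compL2 (measurable_const_mul _) (map_dilation_le ha)

theorem coeFn_dilation {a : NNReal} (ha : a ≠ 0) (f : Lp ℂ 2 (volume : Measure ℝ)) :
    ∀ᵐ t : ℝ, dilation ha f t = f ((a : ℝ)⁻¹ * t) :=
  coeFn_compL2 _ (map_dilation_le ha) f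

theorem ae_of_ae_const_mul {P : ℝ → Prop} (h : ∀ᵐ t : ℝ, P t) {a : ℝ} (ha : a ≠ 0) :
    ∀ᵐ t : ℝ, P (a * t) := by
  have hq : Measure.QuasiMeasurePreserving (fun t : ℝ => a * t) volume volume :=
    ⟨measurable_const_mul a, by
      rw [Real.map_volume_mul_left ha]
      exact Measure.smul_absolutelyContinuous⟩
  exact hq.ae h

theorem dilation_mem_evenL2 {a : NNReal} (ha : a ≠ 0) {f : Lp ℂ 2 (volume : Measure ℝ)}
    (hf : f ∈ evenL2) : dilation ha f ∈ evenL2 := by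
  have ha' : (a : ℝ)⁻¹ ≠ 0 := inv_ne_zero (NNReal.coe_ne_zero.mpr ha)
  have h := coeFn_dilation ha f
  have h' := ae_of_ae_const_mul h (neg_ne_zero.mpr one_ne_zero)
  have hf' : ∀ᵐ t : ℝ, f (-t) = f t := hf
  change ∀ᵐ t : ℝ, _
  filter_upwards [h, h', ae_of_ae_const_mul hf' ha'] with t h1 h2 h3
  rw [h1, ← h3, ← neg_one_mul t, h2]
  congr 1
  ring

theorem dilation_mem_vanishingOn {a : NNReal} (ha : 1 ≤ a) {lam : ℝ}
    {f : Lp ℂ 2 (volume : Measure ℝ)} (hf : f ∈ vanishingOn volume {x : ℝ | |x| < lam}) :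
    dilation (zero_lt_one.trans_le ha).ne' f ∈ vanishingOn volume {x : ℝ | |x| < lam} := by
  have ha0 := (zero_lt_one.trans_le ha).ne'
  have ha' : (a : ℝ)⁻¹ ≠ 0 := inv_ne_zero (NNReal.coe_ne_zero.mpr ha0)
  have hf' : ∀ᵐ t : ℝ, |t| < lam → f t = 0 := hf
  change ∀ᵐ t : ℝ, |t| < lam → _
  filter_upwards [coeFn_dilation ha0 f, ae_of_ae_const_mul hf' ha'] with t h1 h2 ht
  rw [h1]
  refine h2 (lt_of_le_of_lt ?_ ht)
  rw [abs_mul, abs_inv, NNReal.abs_eq]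
  exact mul_le_of_le_one_left (abs_nonneg t) (inv_le_one_of_one_le₀ ha)

/-- The sum `∑_T (∏_{p ∈ T} (- p⁻¹)) f (t / ∏_{p ∈ T} p)` over the sets `T` of primes in `S`: the
result of the product over `S` of the operators that send `f` to `f - p⁻¹ f (p⁻¹ ·)`. -/
def eulerSum (S : Finset Nat.Primes) (f : ℝ → ℂ) (t : ℝ) : ℂ :=
  ∑ T ∈ S.powerset, (∏ p ∈ T, -((p : ℕ) : ℂ)⁻¹) * f ((∏ p ∈ T, ((p : ℕ) : ℝ)⁻¹) * t)

theorem prod_inv_ne_zero (T : Finset Nat.Primes) : ∏ p ∈ T, ((p : ℕ) : ℝ)⁻¹ ≠ 0 :=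
  Finset.prod_ne_zero_iff.mpr fun p _ => inv_ne_zero (Nat.cast_ne_zero.mpr p.2.ne_zero)

theorem eulerSum_congr_ae (S : Finset Nat.Primes) {f g : ℝ → ℂ} (h : f =ᵐ[volume] g) :
    eulerSum S f =ᵐ[volume] eulerSum S g := by
  have h' : ∀ᵐ t : ℝ, ∀ T : Finset Nat.Primes, f ((∏ p ∈ T, ((p : ℕ) : ℝ)⁻¹) * t)
      = g ((∏ p ∈ T, ((p : ℕ) : ℝ)⁻¹) * t) :=
    ae_all_iff.mpr fun T => ae_of_ae_const_mul h (prod_inv_ne_zero T)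
  filter_upwards [h'] with t ht
  exact Finset.sum_congr rfl fun T _ => by rw [ht]

theorem eulerSum_insert {S : Finset Nat.Primes} {q : Nat.Primes} (hq : q ∉ S) (f : ℝ → ℂ) (t : ℝ) :
    eulerSum (insert q S) f t
      = eulerSum S f t - ((q : ℕ) : ℂ)⁻¹ * eulerSum S f (((q : ℕ) : ℝ)⁻¹ * t) := by
  unfold eulerSum
  rw [Finset.sum_powerset_insert hq, Finset.mul_sum, sub_eq_add_neg, ← Finset.sum_neg_distrib]
  congr 1
  refine Finset.sum_congr rfl fun T hT => ?_
  have hqT : q ∉ T := fun h => hq (Finset.mem_powerset.mp hT h)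
  rw [Finset.prod_insert hqT, Finset.prod_insert hqT]
  rw [show (((q : ℕ) : ℝ)⁻¹ * ∏ p ∈ T, ((p : ℕ) : ℝ)⁻¹) * t
    = (∏ p ∈ T, ((p : ℕ) : ℝ)⁻¹) * (((q : ℕ) : ℝ)⁻¹ * t) by ring]
  ring

/-- The operator `∏_{p ∈ S} (1 - p⁻¹ D_p)`, where `D_p f = f (p⁻¹ ·)`, is invertible on `L²(ℝ)`
because `‖p⁻¹ D_p‖ ≤ p ^ (-1/2) < 1`. It and its inverse preserve the even functions and the
functions that vanish on a given interval around `0`. -/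
theorem exists_eulerEquiv (S : Finset Nat.Primes) :
    ∃ A : Lp ℂ 2 (volume : Measure ℝ) ≃L[ℂ] Lp ℂ 2 (volume : Measure ℝ),
      (∀ f, A f =ᵐ[volume] eulerSum S f) ∧ (∀ f, A f ∈ evenL2 ↔ f ∈ evenL2) ∧
      ∀ lam : ℝ, ∀ f, A f ∈ vanishingOn volume {x : ℝ | |x| < lam} ↔
        f ∈ vanishingOn volume {x : ℝ | |x| < lam} := by
  induction S using Finset.induction_on with
  | empty =>
    refine ⟨ContinuousLinearEquiv.refl ℂ _, fun f => ?_, fun _ => Iff.rfl, fun _ _ => Iff.rfl⟩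
    exact Filter.Eventually.of_forall fun t => by simp [eulerSum]
  | insert q S hq ih =>
    obtain ⟨A, h1, h2, h3⟩ := ih
    have hq1 : (1 : NNReal) ≤ ((q : ℕ) : NNReal) := by exact_mod_cast q.2.one_le
    have hq0 : ((q : ℕ) : NNReal) ≠ 0 := (zero_lt_one.trans_le hq1).ne'
    set D := dilation hq0 with hD
    have hK : ‖((q : ℕ) : ℂ)⁻¹ • D‖ < 1 := by
      have hlt := one_lt_prime_cast (p := (q : ℕ))
      have hD' : ‖D‖ ≤ √((q : ℕ) : ℝ) :=
        (norm_compL2_le (measurable_const_mul _) (map_dilation_le hq0)).trans_eq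
          (by rw [NNReal.coe_natCast])
      rw [norm_smul, norm_inv, Complex.norm_natCast]
      calc ((q : ℕ) : ℝ)⁻¹ * ‖D‖ ≤ ((q : ℕ) : ℝ)⁻¹ * √((q : ℕ) : ℝ) := by gcongr
        _ < ((q : ℕ) : ℝ)⁻¹ * ((q : ℕ) : ℝ) := by
            refine mul_lt_mul_of_pos_left ?_ (by positivity)
            rw [Real.sqrt_lt' (by positivity)]
            nlinarith
        _ = 1 := inv_mul_cancel₀ (by positivity)
    obtain ⟨B, hB, hW⟩ := exists_equiv_one_sub hK
    refine ⟨A.trans B, fun f => ?_, fun f => ?_, fun lam f => ?_⟩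
    · have e : A.trans B f = A f - ((q : ℕ) : ℂ)⁻¹ • D (A f) := hB (A f)
      rw [e]
      have hq' : ((q : ℕ) : ℝ)⁻¹ ≠ 0 := inv_ne_zero (Nat.cast_ne_zero.mpr q.2.ne_zero)
      filter_upwards [Lp.coeFn_sub (A f) (((q : ℕ) : ℂ)⁻¹ • D (A f)),
        Lp.coeFn_smul ((q : ℕ) : ℂ)⁻¹ (D (A f)), coeFn_dilation hq0 (A f), h1 f,
        ae_of_ae_const_mul (h1 f) hq'] with t a1 a2 a3 a4 a5
      rw [a1, Pi.sub_apply, a2, Pi.smul_apply, a3, a4, eulerSum_insert hq, smul_eq_mul]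
      congr 2
    · exact (hW _ isClosed_evenL2
        (fun g hg => evenL2.smul_mem _ (dilation_mem_evenL2 hq0 hg)) _).trans (h2 f)
    · exact (hW _ (isClosed_vanishingOn (measurableSet_lt measurable_norm measurable_const))
        (fun g hg => Submodule.smul_mem _ _ (dilation_mem_vanishingOn hq1 hg)) _).trans (h3 lam f)

/-! ### Functions of the module -/

section Module

open scoped ENNReal NNReal

variable {S : Finset Nat.Primes}

theorem classModule_proj (x : Adele S) : classModule S (proj S x) = adeleModule S x := rfl

theorem adeleModule_of_mem {x : Adele S} (hx : x ∈ fundDomain S) : adeleModule S x = x.2 := by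
  rw [adeleModule, Finset.prod_eq_one fun p _ => hx.1 p, one_mul, abs_of_pos hx.2]

theorem measurable_classModule : Measurable (classModule S) := by
  rw [measurable_class_iff]
  change Measurable fun x : Adele S => (∏ p : S, ‖x.1 p‖) * |x.2|
  refine Continuous.measurable ?_
  fun_prop

/-- The volume of `∏ ℤ_p^×`. -/
def unitVolume (S : Finset Nat.Primes) : ℝ≥0 := (unitMeasure S Set.univ).toNNReal

theorem coe_unitVolume : (unitVolume S : ℝ≥0∞) = unitMeasure S Set.univ :=
  ENNReal.coe_toNNReal (measure_ne_top _ _)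

theorem unitVolume_ne_zero : unitVolume S ≠ 0 := by
  intro h
  refine unitMeasure_univ_ne_zero (S := S) ?_
  rw [← coe_unitVolume, h, ENNReal.coe_zero]

/-- The image of the measure of `X_S` under the module is a multiple of the Lebesgue measure of
`(0, ∞)`. -/
theorem map_classModule : (classMeasure S).map (classModule S)
    = unitVolume S • volume.restrict (Set.Ioi (0 : ℝ)) := by
  rw [← (measurePreserving_proj (S := S)).map_eq,
    Measure.map_map measurable_classModule measurable_proj]
  have h : classModule S ∘ proj S =ᵐ[domainMeasure S] Prod.snd := by
    filter_upwards [ae_mem_fundDomain] with x hx using adeleModule_of_mem hx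
  rw [Measure.map_congr h, domainMeasure_eq, Measure.map_snd_prod, ← coe_unitVolume]
  rfl

theorem map_classModule_le : (classMeasure S).map (classModule S) ≤ unitVolume S • volume := by
  rw [map_classModule]
  refine Measure.le_iff.mpr fun s _ => ?_
  simp only [Measure.smul_apply]
  exact smul_le_smul_of_nonneg_left (Measure.restrict_le_self s) zero_le

theorem map_abs_volume : (volume : Measure ℝ).map (fun t => |t|)
    = (2 : ℝ≥0) • volume.restrict (Set.Ioi (0 : ℝ)) := by
  have h1 : (volume.restrict (Set.Iic (0 : ℝ))).map (fun t => |t|)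
      = volume.restrict (Set.Ioi (0 : ℝ)) := by
    have h := ((Measure.measurePreserving_neg (volume : Measure ℝ)).restrict_preimage
      (measurableSet_Ici (a := (0 : ℝ)))).map_eq
    have e : Neg.neg ⁻¹' Set.Ici (0 : ℝ) = Set.Iic 0 := by ext; simp
    rw [show (Neg.neg : ℝ → ℝ) ⁻¹' Set.Ici (0 : ℝ) = Set.Iic 0 from e,
      ← restrict_Ioi_eq_restrict_Ici] at h
    rw [← h]
    refine Measure.map_congr ?_
    filter_upwards [ae_restrict_mem measurableSet_Iic] with t ht using abs_of_nonpos ht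
  have h2 : (volume.restrict (Set.Ioi (0 : ℝ))).map (fun t => |t|)
      = volume.restrict (Set.Ioi (0 : ℝ)) := by
    conv_rhs => rw [← Measure.map_id (μ := volume.restrict (Set.Ioi (0 : ℝ)))]
    refine Measure.map_congr ?_
    filter_upwards [ae_restrict_mem measurableSet_Ioi] with t ht using abs_of_pos ht
  have h3 := Measure.restrict_add_restrict_compl (μ := (volume : Measure ℝ))
    (measurableSet_Iic (a := (0 : ℝ)))
  rw [Set.compl_Iic] at h3
  conv_lhs => rw [← h3]
  rw [Measure.map_add _ _ measurable_abs, h1, h2, two_smul]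

theorem map_abs_le : (volume : Measure ℝ).map (fun t => |t|)
    ≤ (2 / unitVolume S) • (classMeasure S).map (classModule S) := by
  rw [map_abs_volume, map_classModule, smul_smul, div_mul_cancel₀ _ unitVolume_ne_zero]

/-- No measurability of `P` is needed: the null sets are compared through the product structure of
the fundamental domain. -/
theorem ae_classModule_iff {P : ℝ → Prop} :
    (∀ᵐ ξ ∂classMeasure S, P (classModule S ξ)) ↔ ∀ᵐ t : ℝ, P |t| := by
  have h1 : (∀ᵐ ξ ∂classMeasure S, P (classModule S ξ)) ↔
      ∀ᵐ t ∂volume.restrict (Set.Ioi (0 : ℝ)), P t := by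
    rw [ae_class_iff]
    have e : (∀ᵐ x ∂domainMeasure S, P (classModule S (proj S x))) ↔
        ∀ᵐ x ∂domainMeasure S, P x.2 := by
      refine Filter.eventually_congr ?_
      filter_upwards [ae_mem_fundDomain] with x hx
      rw [classModule_proj, adeleModule_of_mem hx]
    rw [e, domainMeasure_eq]
    refine ⟨fun h => ?_, fun h => Measure.quasiMeasurePreserving_snd.ae h⟩
    have hne : (ae (unitMeasure S)).NeBot := by
      rw [ae_neBot]
      intro h0
      exact unitMeasure_univ_ne_zero (S := S) (by rw [h0]; simp)
    have h' := Measure.ae_ae_of_ae_prod h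
    exact Filter.eventually_const.mp h'
  rw [h1]
  constructor
  · intro h
    have hq : Measure.QuasiMeasurePreserving (fun t : ℝ => |t|) volume
        (volume.restrict (Set.Ioi (0 : ℝ))) :=
      ⟨measurable_abs, by rw [map_abs_volume]; exact Measure.smul_absolutelyContinuous⟩
    exact hq.ae h
  · intro h
    filter_upwards [ae_restrict_of_ae h, ae_restrict_mem measurableSet_Ioi] with t ht ht0
    rwa [abs_of_pos ht0] at ht

/-- The operator `f ↦ f (|·|)` from `L²(ℝ)` to `L²(X_S)`. -/
def ofModule (S : Finset Nat.Primes) : Lp ℂ 2 (volume : Measure ℝ) →L[ℂ] L2Class S :=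
  compL2 measurable_classModule map_classModule_le

theorem coeFn_ofModule (f : Lp ℂ 2 (volume : Measure ℝ)) :
    ∀ᵐ ξ ∂classMeasure S, ofModule S f ξ = f (classModule S ξ) :=
  coeFn_compL2 measurable_classModule map_classModule_le f

/-- The measures of `ℝ` and `X_S` have proportional images under `|·|`. -/
theorem eLpNorm_comp_abs_le {f : ℝ → ℂ}
    (hf : AEStronglyMeasurable f ((classMeasure S).map (classModule S))) :
    eLpNorm (fun t => f |t|) 2 volume
      ≤ ENNReal.ofReal √((2 / unitVolume S : ℝ≥0) : ℝ) *
        eLpNorm (fun ξ => f (classModule S ξ)) 2 (classMeasure S) := by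
  have h := eLpNorm_comp_le measurable_abs (map_abs_le (S := S)) hf
  rwa [eLpNorm_map_measure hf measurable_classModule.aemeasurable] at h

/-- An even function is a function of `|t|`. -/
theorem ae_eq_comp_abs {f : Lp ℂ 2 (volume : Measure ℝ)} (hf : f ∈ evenL2) :
    ∀ᵐ t : ℝ, f t = f |t| := by
  have hf' : ∀ᵐ t : ℝ, f (-t) = f t := hf
  filter_upwards [hf'] with t ht
  rcases abs_choice t with h | h
  · rw [h]
  · rw [h, ht]

theorem aestronglyMeasurable_map_classModule {f : ℝ → ℂ} (hf : AEStronglyMeasurable f volume) :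
    AEStronglyMeasurable f ((classMeasure S).map (classModule S)) :=
  hf.mono_ac ((Measure.absolutelyContinuous_of_le map_classModule_le).trans
    Measure.smul_absolutelyContinuous)

theorem norm_le_norm_ofModule {f : Lp ℂ 2 (volume : Measure ℝ)} (hf : f ∈ evenL2) :
    ‖f‖ ≤ √((2 / unitVolume S : ℝ≥0) : ℝ) * ‖ofModule S f‖ := by
  have h := eLpNorm_comp_abs_le (S := S)
    (aestronglyMeasurable_map_classModule (Lp.aestronglyMeasurable f))
  rw [← eLpNorm_congr_ae (ae_eq_comp_abs hf), ← eLpNorm_congr_ae (coeFn_ofModule f)] at h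
  rw [Lp.norm_def, Lp.norm_def, ← ENNReal.toReal_ofReal (Real.sqrt_nonneg _), ← ENNReal.toReal_mul]
  exact ENNReal.toReal_mono (ENNReal.mul_ne_top ENNReal.ofReal_ne_top (Lp.eLpNorm_ne_top _)) h

theorem ofModule_mem_vanishingOn_iff {f : Lp ℂ 2 (volume : Measure ℝ)} (hf : f ∈ evenL2)
    (lam : ℝ) : ofModule S f ∈ vanishingOn (classMeasure S) {ξ | classModule S ξ < lam} ↔
      f ∈ vanishingOn volume {t : ℝ | |t| < lam} := by
  change (∀ᵐ ξ ∂classMeasure S, classModule S ξ < lam → ofModule S f ξ = 0)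
    ↔ ∀ᵐ t : ℝ, |t| < lam → f t = 0
  have h1 : (∀ᵐ ξ ∂classMeasure S, classModule S ξ < lam → ofModule S f ξ = 0)
      ↔ ∀ᵐ ξ ∂classMeasure S, classModule S ξ < lam → f (classModule S ξ) = 0 := by
    refine Filter.eventually_congr ?_
    filter_upwards [coeFn_ofModule f] with ξ hξ
    rw [hξ]
  rw [h1, ae_classModule_iff (P := fun t => t < lam → f t = 0)]
  refine Filter.eventually_congr ?_
  filter_upwards [ae_eq_comp_abs hf] with t ht
  rw [ht]

end Module

/-! ### The class of `σ_S ⊗ f` -/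

section Theta

open scoped ENNReal NNReal

variable {S : Finset Nat.Primes}

theorem sigma_of_norm_eq_zpow {p : ℕ} [Fact p.Prime] {x : ℚ_[p]} {k : ℤ}
    (h : ‖x‖ = (p : ℝ) ^ (-k)) :
    sigma p x = if k = 0 then 1 else if k = -1 then -(p : ℂ)⁻¹ else 0 := by
  have hp1 := one_lt_prime_cast (p := p)
  have hp0 := prime_cast_pos (p := p)
  have h1 : ‖x‖ = 1 ↔ k = 0 := by
    rw [h, zpow_eq_one_iff_right₀ hp0.le hp1.ne', neg_eq_zero]
  have h2 : ‖x‖ = p ↔ k = -1 := by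
    rw [h]
    conv_lhs => rhs; rw [← zpow_one (p : ℝ)]
    rw [zpow_right_inj₀ hp0 hp1.ne', neg_eq_iff_eq_neg]
  simp only [sigma, Set.indicator, Set.mem_ofPred_eq, h1, h2]
  by_cases hk : k = 0
  · simp [hk]
  · by_cases hk' : k = -1 <;> simp [hk, hk']

/-- The exponents of `∏_{p ∈ T} p⁻¹`. -/
def invExponent (S T : Finset Nat.Primes) (p : S) : ℤ := if (p : Nat.Primes) ∈ T then -1 else 0

theorem exists_eq_invExponent {n : S → ℤ} (hn : ∀ p, n p = 0 ∨ n p = -1) :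
    ∃ T ∈ S.powerset, invExponent S T = n := by
  refine ⟨S.filter fun p => ∃ h : p ∈ S, n ⟨p, h⟩ = -1,
    Finset.mem_powerset.mpr (Finset.filter_subset _ _), ?_⟩
  ext p
  rw [invExponent]
  rcases hn p with h | h <;> simp [h]

theorem invExponent_injOn : Set.InjOn (invExponent S) S.powerset := by
  intro T hT T' hT' h
  rw [Finset.mem_coe, Finset.mem_powerset] at hT hT'
  ext p
  by_cases hp : p ∈ S
  · have := congrFun h ⟨p, hp⟩
    simp only [invExponent] at this
    by_cases h1 : p ∈ T <;> by_cases h2 : p ∈ T' <;> simp_all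
  · exact iff_of_false (fun h => hp (hT h)) fun h => hp (hT' h)

/-- On the fundamental domain `|γ x|_p = p ^ (-n_p)` for `γ = ± ∏_p p ^ n_p`, so that
`σ_S` only leaves the terms with all `n_p` in `{0, -1}`. -/
theorem theta_proj (f : ℝ → ℂ) {x : Adele S} (hx : x ∈ fundDomain S) :
    theta S f (proj S x) = (1 / 2) * (eulerSum S f x.2 + eulerSum S f (-x.2)) := by
  set H : Bool × (S → ℤ) → ℂ := fun bn =>
    (∏ p : S,
      if bn.2 p = 0 then 1 else if bn.2 p = -1 then -(((p : Nat.Primes) : ℕ) : ℂ)⁻¹ else 0) *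
      f ((if bn.1 then -1 else 1) * (∏ p : S, (((p : Nat.Primes) : ℕ) : ℝ) ^ bn.2 p) * x.2) with hH
  have h1 : theta S f (proj S x) = (1 / 2) * ∑' bn, H bn := by
    rw [theta, toClass_proj, ← (gamEquiv S).tsum_eq]
    congr 1
    refine tsum_congr fun ⟨b, n⟩ => ?_
    rw [gamEquiv_apply, hH]
    congr 1
    · refine Finset.prod_congr rfl fun p _ => sigma_of_norm_eq_zpow ?_
      rw [gam_smul_fst, norm_mul, norm_gamSign_mul_gamOf, hx.1 p, mul_one]
    · rw [gam_smul_snd, Subgroup.coe_mul, Units.val_mul, coe_gamSign, coe_gamOf]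
      cases b <;> simp
  have h2 : ∀ bn ∉ (Finset.univ : Finset Bool) ×ˢ S.powerset.image (invExponent S), H bn = 0 := by
    rintro ⟨b, n⟩ hn
    have : ∃ p, n p ≠ 0 ∧ n p ≠ -1 := by
      by_contra hcon
      push Not at hcon
      obtain ⟨T, hT, rfl⟩ := exists_eq_invExponent (n := n) fun p =>
        or_iff_not_imp_left.mpr (hcon p)
      exact hn (Finset.mem_product.mpr ⟨Finset.mem_univ _, Finset.mem_image_of_mem _ hT⟩)
    obtain ⟨p, hp0, hp1⟩ := this
    rw [hH]
    refine mul_eq_zero_of_left (Finset.prod_eq_zero (Finset.mem_univ p) ?_) _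
    simp [hp0, hp1]
  have h3 : ∀ (b : Bool), ∀ T ∈ S.powerset, H (b, invExponent S T)
      = (∏ p ∈ T, -((p : ℕ) : ℂ)⁻¹) *
        f ((∏ p ∈ T, ((p : ℕ) : ℝ)⁻¹) * ((if b then -1 else 1) * x.2)) := by
    intro b T hT
    have hTS := Finset.mem_powerset.mp hT
    simp only [hH]
    congr 1
    · have e : ∏ p ∈ T, -((p : ℕ) : ℂ)⁻¹
          = ∏ p : S, if (p : Nat.Primes) ∈ T then -(((p : Nat.Primes) : ℕ) : ℂ)⁻¹ else 1 := by
        rw [Finset.prod_coe_sort S fun p => if p ∈ T then -((p : ℕ) : ℂ)⁻¹ else 1,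
          Finset.prod_ite_mem, Finset.inter_eq_right.mpr hTS]
      rw [e]
      refine Finset.prod_congr rfl fun p _ => ?_
      by_cases hp : (p : Nat.Primes) ∈ T <;> simp [invExponent, hp]
    · have e : ∏ p : S, (((p : Nat.Primes) : ℕ) : ℝ) ^ invExponent S T p
          = ∏ p ∈ T, ((p : ℕ) : ℝ)⁻¹ := by
        have e' : ∏ p ∈ T, ((p : ℕ) : ℝ)⁻¹
            = ∏ p : S, if (p : Nat.Primes) ∈ T then (((p : Nat.Primes) : ℕ) : ℝ)⁻¹ else 1 := by
          rw [Finset.prod_coe_sort S fun p => if p ∈ T then ((p : ℕ) : ℝ)⁻¹ else 1,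
            Finset.prod_ite_mem, Finset.inter_eq_right.mpr hTS]
        rw [e']
        refine Finset.prod_congr rfl fun p _ => ?_
        by_cases hp : (p : Nat.Primes) ∈ T <;> simp [invExponent, hp]
      rw [e]
      congr 1
      ring
  rw [h1, tsum_eq_sum h2, Finset.sum_product, Fintype.sum_bool,
    Finset.sum_image invExponent_injOn, Finset.sum_image invExponent_injOn,
    Finset.sum_congr rfl (h3 true), Finset.sum_congr rfl (h3 false), add_comm]
  simp [eulerSum]

/-- The operator `∏_{p ∈ S} (1 - p⁻¹ D_p)` of `L²(ℝ)`. -/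
def eulerEquiv (S : Finset Nat.Primes) :
    Lp ℂ 2 (volume : Measure ℝ) ≃L[ℂ] Lp ℂ 2 (volume : Measure ℝ) :=
  (exists_eulerEquiv S).choose

theorem coeFn_eulerEquiv (f : Lp ℂ 2 (volume : Measure ℝ)) :
    eulerEquiv S f =ᵐ[volume] eulerSum S f :=
  (exists_eulerEquiv S).choose_spec.1 f

theorem eulerEquiv_mem_evenL2_iff {f : Lp ℂ 2 (volume : Measure ℝ)} :
    eulerEquiv S f ∈ evenL2 ↔ f ∈ evenL2 :=
  (exists_eulerEquiv S).choose_spec.2.1 f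

theorem eulerEquiv_mem_vanishingOn_iff {lam : ℝ} {f : Lp ℂ 2 (volume : Measure ℝ)} :
    eulerEquiv S f ∈ vanishingOn volume {x : ℝ | |x| < lam} ↔
      f ∈ vanishingOn volume {x : ℝ | |x| < lam} :=
  (exists_eulerEquiv S).choose_spec.2.2 lam f

/-- The map `f ↦ [σ_S ⊗ f]` as an operator on `L²(ℝ)`: taking the class only sees the even part of
`f`, to which the Euler factors are applied before the composition with the module. -/
def thetaL2 (S : Finset Nat.Primes) : Lp ℂ 2 (volume : Measure ℝ) →L[ℂ] L2Class S :=
  (ofModule S).comp ((eulerEquiv S : Lp ℂ 2 (volume : Measure ℝ) →L[ℂ] _).comp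
    ((1 / 2 : ℂ) • (ContinuousLinearMap.id ℂ _ + reflection)))

theorem thetaL2_apply (f : Lp ℂ 2 (volume : Measure ℝ)) :
    thetaL2 S f = ofModule S (eulerEquiv S ((1 / 2 : ℂ) • (f + reflection f))) := rfl

theorem thetaL2_of_even {f : Lp ℂ 2 (volume : Measure ℝ)} (hf : f ∈ evenL2) :
    thetaL2 S f = ofModule S (eulerEquiv S f) := by
  rw [thetaL2_apply, mem_evenL2_iff.mp hf, ← two_smul ℂ f, smul_smul]
  norm_num

theorem ae_class_of_ae {P : ℝ → Prop} (h : ∀ᵐ t : ℝ, P t) : ∀ᵐ x ∂domainMeasure S, P x.2 := by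
  rw [domainMeasure_eq]
  exact Measure.quasiMeasurePreserving_snd.ae (ae_restrict_of_ae h)

theorem ae_neg {P : ℝ → Prop} (h : ∀ᵐ t : ℝ, P t) : ∀ᵐ t : ℝ, P (-t) :=
  (Measure.measurePreserving_neg (volume : Measure ℝ)).quasiMeasurePreserving.ae h

theorem coeFn_thetaL2 (f : Lp ℂ 2 (volume : Measure ℝ)) :
    thetaL2 S f =ᵐ[classMeasure S] theta S f := by
  set g := (1 / 2 : ℂ) • (f + reflection f) with hg
  have hg' : g =ᵐ[volume] fun t => (1 / 2 : ℂ) * (f t + f (-t)) := by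
    filter_upwards [Lp.coeFn_smul (1 / 2 : ℂ) (f + reflection f), Lp.coeFn_add f (reflection f),
      coeFn_reflection f] with t h1 h2 h3
    rw [h1, Pi.smul_apply, h2, Pi.add_apply, h3, smul_eq_mul]
  have hA : ∀ᵐ t : ℝ, eulerEquiv S g t = (1 / 2) * (eulerSum S f t + eulerSum S f (-t)) := by
    filter_upwards [coeFn_eulerEquiv (S := S) g, eulerSum_congr_ae S hg'] with t h1 h2
    rw [h1, h2]
    simp only [eulerSum]
    rw [← Finset.sum_add_distrib, Finset.mul_sum]
    refine Finset.sum_congr rfl fun T _ => ?_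
    rw [mul_neg]
    ring
  rw [thetaL2_apply]
  have h1 := coeFn_ofModule (S := S) (eulerEquiv S g)
  rw [ae_class_iff] at h1
  refine ae_class_iff.mpr ?_
  filter_upwards [h1, ae_mem_fundDomain, ae_class_of_ae hA] with x h1 hx h2
  rw [theta_proj _ hx, h1, classModule_proj, adeleModule_of_mem hx, h2]

theorem theta_congr_ae {f g : ℝ → ℂ} (h : f =ᵐ[volume] g) :
    theta S f =ᵐ[classMeasure S] theta S g := by
  have h1 := eulerSum_congr_ae S h
  refine ae_class_iff.mpr ?_
  filter_upwards [ae_mem_fundDomain, ae_class_of_ae h1, ae_class_of_ae (ae_neg h1)] with x hx h2 h3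
  rw [theta_proj _ hx, theta_proj _ hx, h2, h3]

end Theta

/-! ### Compatibility with the Fourier transforms -/

section Intertwining

variable {S : Finset Nat.Primes}

/-- The Schwartz–Bruhat function `σ_S ⊗ f`. -/
def sigmaTensor (S : Finset Nat.Primes) (f : SchwartzMap ℝ ℂ) : schwartzBruhat S :=
  ⟨fun x => (∏ p : S, sigma ((p : Nat.Primes) : ℕ) (x.1 p)) * f x.2,
    prod_mul_mem_schwartzBruhat f (fun _ => hasLevel_sigma.isLocallyConstant)
      fun _ => hasLevel_sigma.hasCompactSupport⟩

theorem thetaL2_toLp (f : SchwartzMap ℝ ℂ) :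
    thetaL2 S (f.toLp 2) = classMap S (sigmaTensor S f) := by
  have h1 := theta_congr_ae (S := S) (f.coeFn_toLp 2 volume)
  have h2 : classMap S (sigmaTensor S f) =ᵐ[classMeasure S] theta S f :=
    coeFn_classMap (sigmaTensor S f)
  exact Lp.ext ((coeFn_thetaL2 _).trans (h1.trans h2.symm))

theorem schwartzBruhatFourier_sigmaTensor (f : SchwartzMap ℝ ℂ) :
    schwartzBruhatFourier S (sigmaTensor S f) = sigmaTensor S (𝓕 f) := by
  refine Subtype.ext ?_
  change adeleFourier S (fun x : Adele S =>
    (∏ p : S, sigma ((p : Nat.Primes) : ℕ) (x.1 p)) * f x.2) = _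
  rw [adeleFourier_prod_mul]
  simp only [padicFourier_sigma]
  rfl

theorem classFourier_sigmaTensor (f : SchwartzMap ℝ ℂ) :
    classFourier S (classMap S (sigmaTensor S f)) = classMap S (sigmaTensor S (𝓕 f)) :=
  (classFourier_classMap (sigmaTensor S f)).trans
    (congrArg (classMap S) (schwartzBruhatFourier_sigmaTensor f))

theorem classFourier_thetaL2_toLp (f : SchwartzMap ℝ ℂ) :
    classFourier S (thetaL2 S (f.toLp 2)) = thetaL2 S ((𝓕 f).toLp 2) := by
  have h1 := congrArg (classFourier S) (thetaL2_toLp (S := S) f)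
  exact h1.trans ((classFourier_sigmaTensor f).trans (thetaL2_toLp (𝓕 f)).symm)

/-- As each `σ_p` is its own Fourier transform, `θ_S` intertwines the Fourier transforms of `L²(ℝ)`
and `L²(X_S)`. -/
theorem classFourier_thetaL2 (f : Lp ℂ 2 (volume : Measure ℝ)) :
    classFourier S (thetaL2 S f) = thetaL2 S (Lp.fourierTransformₗᵢ ℝ ℂ f) := by
  have hd : DenseRange fun f : SchwartzMap ℝ ℂ => f.toLp 2 volume :=
    SchwartzMap.denseRange_toLpCLM ENNReal.ofNat_ne_top
  have h1 : Continuous fun f => classFourier S (thetaL2 S f) :=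
    (classFourier S).continuous.comp (thetaL2 S).continuous
  have h2 : Continuous fun f => thetaL2 S (Lp.fourierTransformₗᵢ ℝ ℂ f) :=
    (thetaL2 S).continuous.comp (Lp.fourierTransformₗᵢ ℝ ℂ).continuous
  refine hd.induction_on (p := fun f =>
    classFourier S (thetaL2 S f) = thetaL2 S (Lp.fourierTransformₗᵢ ℝ ℂ f)) f
    (isClosed_eq h1 h2) fun f => ?_
  have h3 : Lp.fourierTransformₗᵢ ℝ ℂ (f.toLp 2) = (𝓕 f).toLp 2 := SchwartzMap.toLp_fourier_eq f
  exact (classFourier_thetaL2_toLp f).trans (congrArg (thetaL2 S) h3.symm)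

/-- Fourier inversion on `L²(ℝ)`, in the form `ℱ⁻¹ f = (ℱ f) (- ·)`. -/
theorem fourier_symm_eq_reflection (f : Lp ℂ 2 (volume : Measure ℝ)) :
    (Lp.fourierTransformₗᵢ ℝ ℂ).symm f = reflection (Lp.fourierTransformₗᵢ ℝ ℂ f) := by
  have hd := SchwartzMap.denseRange_toLpCLM (E := ℝ) (F := ℂ) (μ := volume) (p := 2)
    ENNReal.ofNat_ne_top
  refine congrFun (hd.equalizer (g := fun f => (Lp.fourierTransformₗᵢ ℝ ℂ).symm f)
    (h := fun f => reflection (Lp.fourierTransformₗᵢ ℝ ℂ f)) (by fun_prop) (by fun_prop)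
    (funext fun f => ?_)) f
  change 𝓕⁻ (f.toLp 2) = reflection (𝓕 (f.toLp 2))
  rw [SchwartzMap.toLp_fourier_eq, SchwartzMap.toLp_fourierInv_eq]
  refine Lp.ext ?_
  filter_upwards [(𝓕⁻ f).coeFn_toLp 2 volume, coeFn_reflection ((𝓕 f).toLp 2),
    ae_neg ((𝓕 f).coeFn_toLp 2 volume)] with t h1 h2 h3
  rw [h1, h2, h3, SchwartzMap.fourierInv_coe, SchwartzMap.fourier_coe]
  exact Real.fourierInv_eq_fourier_neg _ _

/-- For even `f`, inversion gives `ℱ (ℱ f) = f`, so `ℱ f = ℱ⁻¹ f` is the reflection of `ℱ f`. -/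
theorem fourier_mem_evenL2 {f : Lp ℂ 2 (volume : Measure ℝ)} (hf : f ∈ evenL2) :
    Lp.fourierTransformₗᵢ ℝ ℂ f ∈ evenL2 := by
  set F := Lp.fourierTransformₗᵢ ℝ ℂ
  rw [mem_evenL2_iff] at hf ⊢
  have hrr : ∀ g : Lp ℂ 2 (volume : Measure ℝ), reflection (reflection g) = g := by
    intro g
    refine Lp.ext ?_
    filter_upwards [coeFn_reflection (reflection g), ae_neg (coeFn_reflection g)] with t h1 h2
    rw [h1, h2, neg_neg]
  have h1 : F.symm (F f) = reflection (F (F f)) := fourier_symm_eq_reflection (F f)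
  rw [F.symm_apply_apply] at h1
  have h2 : F (F f) = f := by rw [← hrr (F (F f)), ← h1, hf]
  calc reflection (F f) = F.symm f := (fourier_symm_eq_reflection f).symm
    _ = F.symm (F (F f)) := by rw [h2]
    _ = F f := F.symm_apply_apply _

end Intertwining

/-! ### The functions invariant under `K_S` -/

section Invariant

open scoped ENNReal NNReal

variable {S : Finset Nat.Primes}

theorem adeleModule_mul (x y : Adele S) :
    adeleModule S (x * y) = adeleModule S x * adeleModule S y := by
  simp only [adeleModule, Prod.fst_mul, Prod.snd_mul, Pi.mul_apply, norm_mul, abs_mul,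
    Finset.prod_mul_distrib]
  ring

theorem classModule_ideleAct {a : (Adele S)ˣ} (ha : adeleModule S a = 1) (ξ : AdeleClass S) :
    classModule S (ideleAct S a ξ) = classModule S ξ := by
  induction ξ using Quotient.inductionOn with
  | h x =>
    change adeleModule S (a * x) = adeleModule S x
    rw [adeleModule_mul, ha, one_mul]

theorem classModule_nonneg (ξ : AdeleClass S) : 0 ≤ classModule S ξ := by
  induction ξ using Quotient.inductionOn with
  | h x => exact mul_nonneg (Finset.prod_nonneg fun _ _ => norm_nonneg _) (abs_nonneg _)

theorem ofModule_mem_kInvariant (f : Lp ℂ 2 (volume : Measure ℝ)) :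
    ofModule S f ∈ kInvariant S :=
  ⟨fun ξ => f (classModule S ξ), coeFn_ofModule f, fun _ ha =>
    Filter.Eventually.of_forall fun ξ => congrArg f (classModule_ideleAct ha ξ)⟩

theorem measurePreserving_mul_unitMeasure {v : (p : S) → ℚ_[((p : Nat.Primes) : ℕ)]}
    (hv : v ∈ unitSet S) : MeasurePreserving (fun u => u * v) (unitMeasure S) (unitMeasure S) := by
  have h1 : ∀ p : S, MeasurePreserving (fun t => v p * t) (padicHaar ((p : Nat.Primes) : ℕ))
      (padicHaar ((p : Nat.Primes) : ℕ)) := by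
    intro p
    have hp : ‖v p‖ = 1 := hv p
    refine ⟨measurable_padic_mul _, ?_⟩
    rw [padicHaar_map_mul (norm_ne_zero_iff.mp (by rw [hp]; exact one_ne_zero)), hp]
    simp
  have h2 := measurePreserving_pi (fun p : S => padicHaar ((p : Nat.Primes) : ℕ))
    (fun p : S => padicHaar ((p : Nat.Primes) : ℕ)) h1
  have h3 := h2.restrict_preimage (measurableSet_unitSet (S := S))
  have e1 : (fun (u : (p : S) → ℚ_[((p : Nat.Primes) : ℕ)]) p => v p * u p) = fun u => u * v := by
    ext u p
    exact mul_comm _ _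
  have e2 : (fun (u : (p : S) → ℚ_[((p : Nat.Primes) : ℕ)]) p => v p * u p) ⁻¹' unitSet S
      = unitSet S := by
    ext u
    refine forall_congr' fun p => ?_
    have hp : ‖v p‖ = 1 := hv p
    rw [norm_mul, hp, one_mul]
  rw [e2, e1] at h3
  exact h3

/-- The elements of `∏ ℤ_p^×` represent elements of `K_S`. -/
theorem exists_unit_eq {v : (p : S) → ℚ_[((p : Nat.Primes) : ℕ)]} (hv : v ∈ unitSet S) :
    ∃ a : (Adele S)ˣ, (a : Adele S) = (v, 1) ∧ adeleModule S a = 1 := by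
  have hv0 : ∀ p, v p ≠ 0 := fun p => norm_ne_zero_iff.mp (by rw [hv p]; exact one_ne_zero)
  refine ⟨⟨(v, 1), (fun p => (v p)⁻¹, 1), ?_, ?_⟩, rfl, ?_⟩
  · ext p <;> simp [hv0]
  · ext p <;> simp [hv0]
  · change (∏ p : S, ‖v p‖) * |(1 : ℝ)| = 1
    rw [Finset.prod_eq_one fun p _ => hv p, abs_one, one_mul]

/-- A function on `X_S` invariant under `K_S` agrees almost everywhere on `∏ ℤ_p^× × (0, ∞)` with
its average over `∏ ℤ_p^×`, which depends on the real coordinate only. -/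
theorem exists_eq_comp_classModule {f : L2Class S} (hf : f ∈ kInvariant S) :
    ∃ Φ : ℝ → ℂ, StronglyMeasurable Φ ∧ ∀ᵐ ξ ∂classMeasure S, f ξ = Φ (classModule S ξ) := by
  obtain ⟨g, hfg, hg⟩ := hf
  set G : Adele S → ℂ := fun x => f (proj S x) with hG
  have hGm : StronglyMeasurable G := (Lp.stronglyMeasurable f).comp_measurable measurable_proj
  have hfg' : ∀ᵐ x ∂domainMeasure S, G x = g (proj S x) := ae_class_iff.mp hfg
  have hinv : ∀ v ∈ unitSet S, ∀ᵐ x ∂domainMeasure S, G (x.1 * v, x.2) = G x := by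
    intro v hv
    obtain ⟨a, ha, ha1⟩ := exists_unit_eq hv
    have hmp : MeasurePreserving (fun x : Adele S => (x.1 * v, x.2)) (domainMeasure S)
        (domainMeasure S) := by
      rw [domainMeasure_eq]
      exact (measurePreserving_mul_unitMeasure hv).prod (MeasurePreserving.id _)
    filter_upwards [hfg', hmp.quasiMeasurePreserving.ae hfg', ae_class_iff.mp (hg a ha1)]
      with x h1 h2 h3
    rw [h1, h2, ← h3]
    congr 1
    change proj S _ = proj S (a * x)
    rw [ha]
    congr 1
    ext p
    · exact mul_comm _ _
    · exact (one_mul _).symm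
  have hmeas : MeasurableSet {z : ((p : S) → ℚ_[((p : Nat.Primes) : ℕ)]) × Adele S |
      G (z.2.1 * z.1, z.2.2) = G z.2} := by
    refine measurableSet_eq_fun (hGm.measurable.comp ?_) (hGm.measurable.comp measurable_snd)
    refine Continuous.measurable ?_
    fun_prop
  -- the exceptional set of `x` depends on `v`; Fubini's theorem exchanges the quantifiers
  have hae : ∀ᵐ x ∂domainMeasure S, ∀ᵐ v ∂unitMeasure S, G (x.1 * v, x.2) = G x := by
    have hfin : SFinite (domainMeasure S) := by rw [domainMeasure_eq]; infer_instance
    refine (Measure.ae_ae_comm (p := fun v (x : Adele S) => G (x.1 * v, x.2) = G x) hmeas).mp ?_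
    filter_upwards [ae_restrict_mem measurableSet_unitSet] with v hv using hinv v hv
  set c : ℝ := (unitMeasure S).real Set.univ with hc
  have hc0 : c ≠ 0 := by
    rw [hc, measureReal_def, ENNReal.toReal_ne_zero]
    exact ⟨unitMeasure_univ_ne_zero, measure_ne_top _ _⟩
  refine ⟨fun t => c⁻¹ • ∫ v, G (v, t) ∂unitMeasure S,
    (hGm.integral_prod_left' (μ := unitMeasure S)).const_smul c⁻¹, ae_class_iff.mpr ?_⟩
  filter_upwards [hae, ae_mem_fundDomain] with x hx hxF
  have e1 : ∫ v, G (v, x.2) ∂unitMeasure S = ∫ v, G (x.1 * v, x.2) ∂unitMeasure S := by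
    have hmp := measurePreserving_mul_unitMeasure (S := S) (v := x.1) hxF.1
    have h := integral_map (μ := unitMeasure S) (φ := fun u => u * x.1) (f := fun v => G (v, x.2))
      hmp.measurable.aemeasurable
      (hGm.comp_measurable measurable_prodMk_right).aestronglyMeasurable
    rw [hmp.map_eq] at h
    rw [h]
    simp only [mul_comm]
  rw [classModule_proj, adeleModule_of_mem hxF, e1, integral_congr_ae hx, integral_const, smul_smul,
    inv_mul_cancel₀ hc0, one_smul]

theorem ae_abs {P : ℝ → Prop} (h : ∀ᵐ t : ℝ, P t) : ∀ᵐ t : ℝ, P |t| := by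
  filter_upwards [h, ae_neg h] with t h1 h2
  rcases abs_choice t with h | h <;> rw [h] <;> assumption

/-- The space `L²(X_S)^{K_S}` is the image of `L²(ℝ)^{ev}` by composition with the module. -/
theorem exists_ofModule_eq {f : L2Class S} (hf : f ∈ kInvariant S) :
    ∃ k ∈ evenL2, ofModule S k = f := by
  obtain ⟨Φ, hΦ, hfΦ⟩ := exists_eq_comp_classModule hf
  have hk : MemLp (fun t => Φ |t|) 2 volume := by
    refine ⟨(hΦ.comp_measurable measurable_abs).aestronglyMeasurable, ?_⟩
    refine (eLpNorm_comp_abs_le (S := S) hΦ.aestronglyMeasurable).trans_lt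
      (ENNReal.mul_lt_top ENNReal.ofReal_lt_top ?_)
    rw [← eLpNorm_congr_ae hfΦ]
    exact Lp.eLpNorm_lt_top f
  refine ⟨hk.toLp _, ?_, ?_⟩
  · change ∀ᵐ t : ℝ, _
    filter_upwards [hk.coeFn_toLp, ae_neg hk.coeFn_toLp] with t h1 h2
    rw [h1, h2, abs_neg]
  · refine Lp.ext ?_
    have h1 := ae_classModule_iff (S := S) (P := fun t => hk.toLp _ t = Φ |t|) |>.mpr
      (ae_abs hk.coeFn_toLp)
    filter_upwards [coeFn_ofModule (S := S) (hk.toLp _), h1, hfΦ] with ξ a1 a2 a3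
    rw [a1, a2, a3, abs_of_nonneg (classModule_nonneg ξ)]

end Invariant

/-! ### The isomorphism of Sonin spaces -/

section Isomorphism

variable {S : Finset Nat.Primes}

theorem thetaL2_mem_semilocalSonin {lam : ℝ} {f : Lp ℂ 2 (volume : Measure ℝ)}
    (hf : f ∈ realSonin lam) : thetaL2 S f ∈ semilocalSonin S (classFourier S) lam := by
  obtain ⟨⟨h1, h2⟩, h3⟩ := hf
  change Lp.fourierTransformₗᵢ ℝ ℂ f ∈ vanishingOn volume {x : ℝ | |x| < lam} at h3
  have h4 := fourier_mem_evenL2 h1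
  refine ⟨⟨ofModule_mem_kInvariant _, ?_⟩, ?_⟩
  · change thetaL2 S f ∈ vanishingOn (classMeasure S) {x | classModule S x < lam}
    rw [thetaL2_of_even h1, ofModule_mem_vanishingOn_iff (eulerEquiv_mem_evenL2_iff.mpr h1),
      eulerEquiv_mem_vanishingOn_iff]
    exact h2
  · change classFourier S (thetaL2 S f) ∈ vanishingOn (classMeasure S) {x | classModule S x < lam}
    rw [classFourier_thetaL2, thetaL2_of_even h4,
      ofModule_mem_vanishingOn_iff (eulerEquiv_mem_evenL2_iff.mpr h4),
      eulerEquiv_mem_vanishingOn_iff]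
    exact h3

/-- Surjectivity of `θ_S` on the Sonin spaces: a function `f` with `θ_S f = g` inherits both
vanishing conditions, the second one from `θ_S (ℱ f) = 𝔽_S g`. -/
theorem exists_thetaL2_eq {lam : ℝ} {g : L2Class S}
    (hg : g ∈ semilocalSonin S (classFourier S) lam) : ∃ f ∈ realSonin lam, thetaL2 S f = g := by
  obtain ⟨⟨h1, h2⟩, h3⟩ := hg
  change classFourier S g ∈ vanishingOn (classMeasure S) {x | classModule S x < lam} at h3
  obtain ⟨k, hk, rfl⟩ := exists_ofModule_eq h1
  obtain ⟨f, rfl⟩ := (eulerEquiv S).surjective k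
  have hf : f ∈ evenL2 := eulerEquiv_mem_evenL2_iff.mp hk
  have hFf := fourier_mem_evenL2 hf
  refine ⟨f, ⟨⟨hf, ?_⟩, ?_⟩, thetaL2_of_even hf⟩
  · exact eulerEquiv_mem_vanishingOn_iff.mp ((ofModule_mem_vanishingOn_iff hk lam).mp h2)
  · change Lp.fourierTransformₗᵢ ℝ ℂ f ∈ vanishingOn volume {x : ℝ | |x| < lam}
    rw [← thetaL2_of_even hf, classFourier_thetaL2, thetaL2_of_even hFf] at h3
    exact eulerEquiv_mem_vanishingOn_iff.mp ((ofModule_mem_vanishingOn_iff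
      (eulerEquiv_mem_evenL2_iff.mpr hFf) lam).mp h3)

/-- On the even functions `θ_S` is bounded below: composition with the module is a similarity and
the factor `∏_{p ∈ S} (1 - p⁻¹ D_p)` is invertible. -/
theorem exists_norm_le_norm_thetaL2 (S : Finset Nat.Primes) : ∃ C : ℝ, ∀ f ∈ evenL2,
    ‖f‖ ≤ C * ‖thetaL2 S f‖ := by
  set B : Lp ℂ 2 (volume : Measure ℝ) →L[ℂ] Lp ℂ 2 (volume : Measure ℝ) :=
    ((eulerEquiv S).symm : Lp ℂ 2 (volume : Measure ℝ) →L[ℂ] Lp ℂ 2 (volume : Measure ℝ)) with hB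
  refine ⟨‖B‖ * √((2 / unitVolume S : NNReal) : ℝ), fun f hf => ?_⟩
  rw [thetaL2_of_even hf]
  calc ‖f‖ = ‖B (eulerEquiv S f)‖ := by
        rw [hB]
        exact congrArg norm ((eulerEquiv S).symm_apply_apply f).symm
    _ ≤ ‖B‖ * ‖eulerEquiv S f‖ := B.le_opNorm _
    _ ≤ ‖B‖ * (√((2 / unitVolume S : NNReal) : ℝ) * ‖ofModule S (eulerEquiv S f)‖) :=
        mul_le_mul_of_nonneg_left (norm_le_norm_ofModule (eulerEquiv_mem_evenL2_iff.mpr hf))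
          (norm_nonneg B)
    _ = _ := by ring

theorem exists_equiv_sonin (S : Finset Nat.Primes) (lam : ℝ) :
    ∃ T : realSonin lam ≃L[ℂ] semilocalSonin S (classFourier S) lam,
      ∀ f : realSonin lam, (T f : L2Class S) = thetaL2 S f := by
  obtain ⟨C, hC⟩ := exists_norm_le_norm_thetaL2 S
  set L : realSonin lam →ₗ[ℂ] semilocalSonin S (classFourier S) lam :=
    (thetaL2 S).toLinearMap.restrict fun f hf => thetaL2_mem_semilocalSonin hf with hL
  have hLv : ∀ f : realSonin lam, (L f : L2Class S) = thetaL2 S f := fun _ => rfl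
  have hb : ∀ f : realSonin lam, ‖f‖ ≤ C * ‖L f‖ := fun f => hC f f.2.1.1
  have hinj : Function.Injective L := by
    rw [injective_iff_map_eq_zero]
    intro f hf
    have := hb f
    rw [hf, norm_zero, mul_zero] at this
    exact norm_le_zero_iff.mp this
  have hsurj : Function.Surjective L := by
    intro g
    obtain ⟨f, hf, hfg⟩ := exists_thetaL2_eq g.2
    exact ⟨⟨f, hf⟩, Subtype.ext hfg⟩
  set E := LinearEquiv.ofBijective L ⟨hinj, hsurj⟩ with hE
  refine ⟨E.toContinuousLinearEquivOfBounds ‖thetaL2 S‖ C (fun f => (thetaL2 S).le_opNorm f)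
    (fun g => ?_), fun f => rfl⟩
  have h := hb (E.symm g)
  have e : L (E.symm g) = g := E.apply_symm_apply g
  rwa [e] at h

end Isomorphism

end SemilocalSonin

end

theorem theorem4 (S : Finset Nat.Primes) :
    ∃ F : SemilocalSonin.L2Class S →L[ℂ] SemilocalSonin.L2Class S,
      SemilocalSonin.IsSemilocalFourier S F ∧
      (∀ G : SemilocalSonin.L2Class S →L[ℂ] SemilocalSonin.L2Class S,
        SemilocalSonin.IsSemilocalFourier S G → G = F) ∧
      ∀ lam : ℝ, 0 < lam →
        ∃ T : SemilocalSonin.realSonin lam ≃L[ℂ] SemilocalSonin.semilocalSonin S F lam,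
          ∀ f : SemilocalSonin.realSonin lam,
            ((T f : SemilocalSonin.L2Class S) : SemilocalSonin.AdeleClass S → ℂ)
              =ᵐ[SemilocalSonin.classMeasure S]
                SemilocalSonin.theta S ((f : Lp ℂ 2 (volume : Measure ℝ)) : ℝ → ℂ) := by
  refine ⟨SemilocalSonin.classFourier S, SemilocalSonin.isSemilocalFourier_classFourier,
    fun G hG => hG.eq_classFourier, fun lam _ => ?_⟩
  obtain ⟨T, hT⟩ := SemilocalSonin.exists_equiv_sonin S lam
  refine ⟨T, fun f => ?_⟩
  rw [hT f]
  exact SemilocalSonin.coeFn_thetaL2 _
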